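/- **Setting.** Let $n\ge 1$, let $S$ be an $m\times m$ Hermitian matrix, and let $\Lambda,d>0$, $L\ge 0$. Write $D=-i\partial$, $\widehat f(\xi)=\int_{\mathbb R^n}e^{-ix\cdot\xi}f(x)\,dx$, ${\bf L}^2=(L^2(\mathbb R^n))^m$, and let $\sigma$ be the surface measure on $S^{n-1}$; the norm of $(L^\infty(S^{n-1}))^{m^2}$ is the largest of the $L^\infty$ norms of the entries. *Class $\mathcal K(\Lambda,K)$.* The $m\times m$ matrix symbols $A(t,\xi)$, $t\in\mathbb R$, positively homogeneous of order one in $\xi\neq0$, with $A(t,\xi/|\xi|)$ locally Lipschitz in $t\in\mathbb R$ with values in $L^\infty$, with $\sup_t\|A(t,\omega)\|_{L^\infty(S^{n-1})}\le\Lambda$ and $\int_{-\infty}^\infty\|\partial_tA(t,\omega)\|_{L^\infty(S^{n-1})}\,dt\le K$. *Strict hyperbolicity with gap $d$.* The roots $\varphi_1(t,\omega),\dots,\varphi_m(t,\omega)$ of $\det(\tau I-A(t,\omega))$ are real, and $|\varphi_j(t,\omega)-\varphi_k(t,\omega)|\ge d$ for $j\ne k$, all $t\in\mathbb R$ and almost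 all $\omega\in S^{n-1}$. *Class $\mathcal Y$.* $U_0={}^t(f_0,\dots,f_{m-1})\in{\bf L}^2$ is in $\mathcal Y(\mathbb R^n)$ if $$|U_0|_{\mathcal Y}=\sum_{j,k=0}^{m-1}\int_{-\infty}^\infty\int_{S^{n-1}}\Big|\int_0^\infty e^{i\tau\rho}\,\widehat f_j(\rho\omega)\overline{\widehat f_k(\rho\omega)}\,\rho^n\,d\rho\Big|\,d\sigma(\omega)\,d\tau<\infty ,$$ the inner integral being understood, where it is not absolutely convergent, in the sense of tempered distributions in $\tau$; these must be given by a function integrable in $(\tau,\omega)$. **Statement.** There are constants $K_0,M,c>0$ with $cK_0<1$, depending only on $n,m,S,\Lambda,d,L$, such that the following holds. Let $0<K\le K_0$, and let $A(t,\xi)\in\mathcal K(\Lambda,K)$ be strictly hyperbolic with gap $d$. Let $\mathcal A(s,\xi)$, $s\in J\subset\mathbb R$, be the coefficient of the Kirchhoff system $D_tU=\mathcal A(s(t),D_x)U$: an $m\times m$ matrix symbol, positively homogeneous of order one in $\xi$, such that $s\mapsto\mathcal A(s,\omega)$ is Lipschitz on $J$ with constant $L$ with values in $(L^\infty(S^{n-1}))^{m^2}$.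 Let $U_0\in{\bf L}^2\cap\mathcal Y(\mathbb R^n)$, let $U\in C(\mathbb R;{\bf L}^2)$ be a weak solution of the linear problem $D_tU=A(t,D_x)U$, $U(0)=U_0$, and put $s(t)=\langle SU(t),U(t)\rangle_{{\bf L}^2}$. Assume that $s(t)\in J$ for all $t$, so that $\mathcal A(s(t),\omega)$ is defined. Then for all $t\in\mathbb R$ $$\|\mathcal A(s(t),\omega)\|_{(L^\infty(S^{n-1}))^{m^2}}\le\|\mathcal A(s(0),\omega)\|_{(L^\infty(S^{n-1}))^{m^2}}+M\Big(K\|U_0\|_{{\bf L}^2}^2+\frac1{1-cK}|U_0|_{\mathcal Y}\Big),$$ for almost every $\omega$ the function $t\mapsto\mathcal A(s(t),\omega)$ is locally absolutely continuous, and $$\int_{-\infty}^\infty\big\|\partial_t[\mathcal A(s(t),\omega)]\big\|_{(L^\infty(S^{n-1}))^{m^2}}\,dt\le M\Big(K\|U_0\|_{{\bf L}^2}^2+\frac1{1-cK}|U_0|_{\mathcal Y}\Big).$$ -/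

import Mathlib

open MeasureTheory
open scoped ENNReal SchwartzMap FourierTransform

noncomputable section

namespace KirchhoffSystem

/-- Euclidean space `ℝⁿ`. -/
abbrev Space (n : ℕ) := EuclideanSpace ℝ (Fin n)

/-- The unit sphere `S^{n-1}` of `ℝⁿ`. -/
abbrev USphere (n : ℕ) := Metric.sphere (0 : Space n) 1

/-- The surface measure on `S^{n-1}` (counting measure on `{-1, 1}` if `n = 1`). It is normalised
by polar coordinates, `dξ = ρ^{n-1} dρ dσ(ω)`. -/
def surf (n : ℕ) : Measure (USphere n) := (volume : Measure (Space n)).toSphere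

/-- The space `(L²(ℝⁿ))^m` of `ℂ^m`-valued square integrable functions. -/
abbrev L2 (n m : ℕ) := Lp (EuclideanSpace ℂ (Fin m)) 2 (volume : Measure (Space n))

/-- A matrix-valued function of a real variable and of the frequency `ξ`. -/
abbrev MatSymbol (n m : ℕ) := ℝ → Space n → Matrix (Fin m) (Fin m) ℂ

/-- The norm of `(L^∞(S^{n-1}))^{m²}`: the essential supremum over `ω` of the largest modulus of
an entry. -/
def linf {n m : ℕ} (F : USphere n → Fin m → Fin m → ℂ) : ℝ≥0∞ := eLpNorm F ⊤ (surf n)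

/-- Positive homogeneity of order one in `ξ`. -/
def HomogeneousOne {n m : ℕ} (A : MatSymbol n m) : Prop :=
  ∀ (t r : ℝ) (ξ : Space n), 0 < r → ξ ≠ 0 → A t (r • ξ) = (r : ℂ) • A t ξ

/-- Lipschitz continuity with constant `L` on `J`, with values in `(L^∞(S^{n-1}))^{m²}`. As usual,
the representative is chosen so that the exceptional null set of directions does not depend on the
first variable. -/
def LipOn {n m : ℕ} (J : Set ℝ) (L : ℝ) (A : MatSymbol n m) : Prop :=
  ∀ᵐ ω : USphere n ∂(surf n), ∀ t ∈ J, ∀ t' ∈ J, ∀ j k,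
    ‖A t (ω : Space n) j k - A t' (ω : Space n) j k‖ ≤ L * |t - t'|

/-- The class `𝒦(Λ, K)` of symbols `A(t, ξ)`, positively homogeneous of order one in `ξ`, with
`A(t, ξ/|ξ|)` locally Lipschitz in `t ∈ ℝ` with values in `L^∞`, bounded by `Λ`, and with
`∫ ‖∂_t A(t, ξ/|ξ|)‖_{L^∞} dt ≤ K`. -/
structure ClassK {n m : ℕ} (Λ K : ℝ) (A : MatSymbol n m) : Prop where
  homogeneous : HomogeneousOne A
  measurable : ∀ t j k,
    AEStronglyMeasurable (fun ω : USphere n => A t (ω : Space n) j k) (surf n)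
  lipLoc : ∀ T : ℝ, ∃ L : ℝ, LipOn (Set.Icc (-T) T) L A
  bound : ∀ t, linf (fun (ω : USphere n) j k => A t (ω : Space n) j k) ≤ ENNReal.ofReal Λ
  variation : ∫⁻ t : ℝ, linf (fun (ω : USphere n) j k => deriv (fun r => A r (ω : Space n) j k) t)
    ≤ ENNReal.ofReal K

/-- Strict hyperbolicity with gap `d`: the characteristic roots
`φ_1(t, ω), …, φ_m(t, ω)` of `A(t, ω)` are real, and any two of them differ by at least `d`,
for all `t ∈ ℝ` and (almost) all directions `ω`. -/
def StrictlyHyperbolic {n m : ℕ} (d : ℝ) (A : MatSymbol n m) : Prop :=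
  ∃ φ : Fin m → ℝ → USphere n → ℝ, ∀ᵐ ω : USphere n ∂(surf n), ∀ t : ℝ,
    (∀ τ : ℂ, (τ • (1 : Matrix (Fin m) (Fin m) ℂ) - A t (ω : Space n)).det
      = ∏ j, (τ - (φ j t ω : ℂ))) ∧
    ∀ j k, j ≠ k → d ≤ |φ j t ω - φ k t ω|

/-- The coefficient `A(s, ξ)` of a Kirchhoff system: positively homogeneous of order one in `ξ`,
and, on the domain `J` of the variable `s`, Lipschitz in `s` with constant `L` with values in
`(L^∞(S^{n-1}))^{m²}`. -/
structure KirchhoffCoefficient {n m : ℕ} (J : Set ℝ) (L : ℝ) (A : MatSymbol n m) : Prop where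
  homogeneous : HomogeneousOne A
  memLinf : ∀ s ∈ J, MemLp (fun (ω : USphere n) j k => A s (ω : Space n) j k) ⊤ (surf n)
  lipschitz : LipOn J L A

/-- The quadratic form `⟨SU, U⟩ = ∫ ᵗ(SU) conj(U) dx`; it is real when `S` is Hermitian. -/
def quadForm {n m : ℕ} (S : Matrix (Fin m) (Fin m) ℂ) (U : L2 n m) : ℝ :=
  (∫ x, (S.mulVec (fun j => U x j)) ⬝ᵥ star (fun j => U x j)).re

/-- The pairing `⟨A(t, D_x) U, ψ⟩_{L²}` of `A(t, D_x) U` with a Schwartz function `ψ`, computed on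
the Fourier side by Plancherel. Mathlib's transform `𝓕 f (ξ) = ∫ exp(-2πi x·ξ) f(x) dx` turns
`D = -i∂` into multiplication by `2πξ`, hence the argument `2πξ` of the symbol. -/
def opPairing {n m : ℕ} (A : MatSymbol n m) (t : ℝ) (U : L2 n m)
    (ψ : 𝓢(Space n, EuclideanSpace ℂ (Fin m))) : ℂ :=
  ∫ ξ : Space n, inner ℂ ((𝓕 ψ) ξ)
    (Matrix.toEuclideanLin (A t ((2 * Real.pi) • ξ)) ((𝓕 U : L2 n m) ξ))

/-- `U ∈ C(ℝ; L²)` is a (weak) solution of `D_t U = A(t, D_x) U`, `U(0) = U₀`: the equation is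
tested against Schwartz functions of `x`, and reads `d/dt ⟨U, ψ⟩ = i ⟨A(t, D_x) U, ψ⟩`. -/
structure IsSolution {n m : ℕ} (A : MatSymbol n m) (U₀ : L2 n m) (U : ℝ → L2 n m) : Prop where
  continuous : Continuous U
  initial : U 0 = U₀
  equation : ∀ (ψ : 𝓢(Space n, EuclideanSpace ℂ (Fin m))) (t : ℝ),
    HasDerivAt (fun r => ∫ x, inner ℂ (ψ x) (U r x)) (Complex.I * opPairing A t (U t) ψ) t

/-- The Fourier transform of `U₀ = ᵗ(f_0, …, f_{m-1})` in the convention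
`f̂(ξ) = ∫ exp(-i x·ξ) f(x) dx`. -/
def hat {n m : ℕ} (U₀ : L2 n m) (ξ : Space n) (j : Fin m) : ℂ :=
  (𝓕 U₀ : L2 n m) ((2 * Real.pi)⁻¹ • ξ) j

/-- `F(τ) = ∫_0^∞ exp(iτρ) g(ρ) dρ` in the sense of distributions in `τ`. If `g` is integrable,
then (by Fubini) this says that `F` is almost everywhere equal to the Lebesgue integral. -/
def IsHalfLineTransform (g F : ℝ → ℂ) : Prop :=
  ∀ χ : 𝓢(ℝ, ℂ), ∫ τ, F τ * χ τ
    = ∫ ρ in Set.Ioi (0 : ℝ), (∫ τ : ℝ, Complex.exp (Complex.I * τ * ρ) * χ τ) * g ρ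

/-- The integrable function `F(τ, ω)` is
`∫_0^∞ exp(iτρ) f̂_j(ρω) conj(f̂_k(ρω)) ρ^n dρ`. -/
def IsRayTransform {n m : ℕ} (U₀ : L2 n m) (j k : Fin m) (F : ℝ × USphere n → ℂ) : Prop :=
  Integrable F (volume.prod (surf n)) ∧
  ∀ᵐ ω : USphere n ∂(surf n), IsHalfLineTransform
    (fun ρ => hat U₀ (ρ • (ω : Space n)) j * star (hat U₀ (ρ • (ω : Space n)) k) * (ρ : ℂ) ^ n)
    (fun τ => F (τ, ω))

/-- `|U₀|_𝒴 = ∑_{j,k} ∫_ℝ ∫_{S^{n-1}} |∫_0^∞ exp(iτρ) f̂_j(ρω) conj(f̂_k(ρω)) ρ^n dρ| dσ(ω) dτ`.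
The inner integral is unique up to null sets, so that the infimum is over at most one value; it is
`∞` if the inner integral is not an integrable function of `(τ, ω)`. -/
def yNorm {n m : ℕ} (U₀ : L2 n m) : ℝ≥0∞ :=
  ∑ j, ∑ k, ⨅ (F : ℝ × USphere n → ℂ) (_ : IsRayTransform U₀ j k F),
    ∫⁻ τ : ℝ, ∫⁻ ω, ‖F (τ, ω)‖ₑ ∂(surf n)

/-- Membership of `U₀` in the class `𝒴(ℝⁿ)`. -/
def MemY {n m : ℕ} (U₀ : L2 n m) : Prop := yNorm U₀ < ⊤

end KirchhoffSystem

end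

/-!
The function `s(t) = ⟨SU(t), U(t)⟩` is absolutely continuous, and its total variation is at most a
constant times `|U₀|_𝒴` (`exists_eVariationOn_quadForm_le`). Since `s ↦ 𝒜(s, ω)` is Lipschitz, both
bounds for `𝒜(s(t), ω)` follow, even without the term `K ‖U₀‖²`.

By Plancherel and polar coordinates, `s(t)` is an integral over directions `ω` of the functions
`tr (S ∫ X(t, ρ) ρ^{n-1} dρ)`, where `X = v v^*` and `v(t, ρ)` is the Fourier transform of `U(t)`
at `ρω`. The weak equation provides a version of this transform which solves, for each frequency,
the ordinary differential equation `∂ₜ v = iρ a v` with `a(t) = A(t, ω)`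
(`IsSolution.exists_pointwise`), so that `∂ₜ X = iρ (a X - X a^*)`. It suffices to bound the
variation on each ray, by the `L¹` norm of the transform of the data on this ray, and to integrate
over `ω`.

On a ray, let `φ_j` be the roots of `a`, `P_j` its spectral projections and `θ_j = ∫₀ᵗ φ_j`. By the
gap, the `P_j` are Lipschitz functions of `a` (`exists_lipschitz_specProj`), hence of small total
variation in `t` if `K` is small (`exists_spectralFamily`). The blocks
`e^{iρ(x - θ_j + θ_k)} P_j X P_k^*` have a time derivative without the factor `ρ`: it is a
combination of `P_j'`, `P_k'` and of blocks whose argument `x` is translated by an amount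
independent of `ρ` (`RayFlow.blockDeriv_eq`). Integrating against `ρ^n dρ` gives functions
`w_{jk}(t, x)` which satisfy a Volterra inequality with small kernel and translations in `x`.
Translations preserve the `L¹` norm in `x`; so `sup_t |w_{jk}(t, x)|` is dominated by an `L¹`
function of `x`, with norm controlled by that of `w_{jk}(0, ·)`, that is, up to the bounded factors
`P_j(0)` and `P_k(0)^*`, by that of the transform in the definition of `|U₀|_𝒴`
(`exists_majorant`).

Finally `a X - X a^*` is the sum of the off-diagonal blocks with weights `φ_j - φ_k`, so that the
time derivative of `∫ X ρ^{n-1} dρ` is `i ∑ (φ_j - φ_k) w_{jk}(t, θ_j - θ_k)`. As the roots never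
cross, the change of variables `x = θ_j(t) - θ_k(t)` bounds the integral of its norm over `t` by
the `L¹` norms of the majorants (`RayFlow.eVariationOn_avg_le`). The integrals against `ρ^n dρ`
need not converge absolutely; they are first cut off by the transform of a bump function, which
amounts to mollifying the transform of the data, and the cutoff is removed by convergence in
variation (`RayFlow.variation_integral`).
-/

namespace KirchhoffSystem

set_option linter.unusedSectionVars false

/-! ### Spectral projections -/

section Projections

variable {R : Type*} [NormedRing R] [NormedAlgebra ℂ R] {m : ℕ}

/-- `φ` lists `m` real numbers in increasing order, with consecutive gaps at least `d`, whose
complexifications are the roots of a polynomial annihilating `a`, and which belong to the spectrum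
of `a`. -/
structure HasGapSpectrum (d : ℝ) (a : R) (φ : Fin m → ℝ) : Prop where
  gap : ∀ i j, i < j → φ i + d ≤ φ j
  annihilates : Polynomial.aeval a (Lagrange.nodal Finset.univ fun j => (φ j : ℂ)) = 0
  mem_spectrum : ∀ j, (φ j : ℂ) ∈ spectrum ℂ a

/-- The spectral projection of `a` for the root `φ j`, as a Lagrange interpolation polynomial
in `a`. -/
noncomputable def specProj (a : R) (φ : Fin m → ℝ) (j : Fin m) : R :=
  Polynomial.aeval a (Lagrange.basis Finset.univ (fun j => (φ j : ℂ)) j)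

namespace HasGapSpectrum

variable {d : ℝ} {a b : R} {φ ψ : Fin m → ℝ}

lemma strictMono (h : HasGapSpectrum d a φ) (hd : 0 < d) : StrictMono φ := fun i j hij => by
  linarith [h.gap i j hij]

lemma le_abs_sub (h : HasGapSpectrum d a φ) {i j : Fin m} (hij : i ≠ j) : d ≤ |φ i - φ j| := by
  rcases lt_or_gt_of_ne hij with h1 | h1
  · rw [abs_sub_comm]; exact le_trans (by linarith [h.gap i j h1]) (le_abs_self _)
  · exact le_trans (by linarith [h.gap j i h1]) (le_abs_self _)

lemma injOn (h : HasGapSpectrum d a φ) (hd : 0 < d) :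
    Set.InjOn (fun j => (φ j : ℂ)) (Finset.univ : Finset (Fin m)) := fun i _ j _ hij =>
  (h.strictMono hd).injective (by simpa using hij)

lemma mul_specProj (h : HasGapSpectrum d a φ) (j : Fin m) :
    a * specProj a φ j = (φ j : ℂ) • specProj a φ j := by
  have key : (Polynomial.X - Polynomial.C (φ j : ℂ)) *
      Lagrange.basis Finset.univ (fun j => (φ j : ℂ)) j
      = Polynomial.C (∏ k ∈ Finset.univ.erase j, ((φ j : ℂ) - (φ k : ℂ))⁻¹) *
        Lagrange.nodal Finset.univ fun j => (φ j : ℂ) := by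
    rw [Lagrange.nodal_eq_mul_nodal_erase (Finset.mem_univ j), Lagrange.basis, Lagrange.nodal]
    simp only [Lagrange.basisDivisor, Finset.prod_mul_distrib, map_prod]
    ring
  have := congrArg (Polynomial.aeval a) key
  rw [map_mul, map_mul, h.annihilates, mul_zero] at this
  simp only [map_sub, Polynomial.aeval_X, Polynomial.aeval_C, sub_mul, sub_eq_zero] at this
  rw [specProj, this, Algebra.smul_def]

lemma specProj_mul (h : HasGapSpectrum d a φ) (j : Fin m) :
    specProj a φ j * a = (φ j : ℂ) • specProj a φ j := by
  rw [← h.mul_specProj]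
  conv_lhs => rw [← Polynomial.aeval_X (R := ℂ) a, specProj, Polynomial.aeval_X]
  have := Commute.all (Lagrange.basis Finset.univ (fun j => (φ j : ℂ)) j) Polynomial.X
  have := this.map (Polynomial.aeval a)
  rw [Polynomial.aeval_X] at this
  exact this

lemma sum_specProj (h : HasGapSpectrum d a φ) (hd : 0 < d) (hm : m = 0 → (1 : R) = 0) :
    ∑ j, specProj a φ j = 1 := by
  rcases Nat.eq_zero_or_pos m with rfl | hpos
  · simp [hm rfl]
  · have : Nonempty (Fin m) := ⟨⟨0, hpos⟩⟩
    simp only [specProj]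
    rw [← map_sum, Lagrange.sum_basis (h.injOn hd) Finset.univ_nonempty, map_one]

lemma specProj_ne_zero (h : HasGapSpectrum d a φ) (hd : 0 < d) (j : Fin m) :
    specProj a φ j ≠ 0 := by
  intro h0
  have h1 : (1 : ℂ) ∈ spectrum ℂ (specProj a φ j) := by
    refine spectrum.subset_polynomial_aeval a _ ⟨_, h.mem_spectrum j, ?_⟩
    exact Lagrange.eval_basis_self (h.injOn hd) (Finset.mem_univ j)
  rw [h0, spectrum.mem_iff] at h1
  apply h1
  simp

lemma abs_le [CompleteSpace R] (h : HasGapSpectrum d a φ) (j : Fin m) :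
    |φ j| ≤ ‖a‖ * ‖(1 : R)‖ := by
  simpa using spectrum.norm_le_norm_mul_of_mem (h.mem_spectrum j)

/-- Each of the at most `m` factors `(φ j - φ k)⁻¹ (a - φ k)` of a spectral projection is bounded,
because the gap bounds the denominators from below. -/
lemma norm_specProj_le [CompleteSpace R] (h : HasGapSpectrum d a φ) (hd : 0 < d) {Λ : ℝ}
    (ha : ‖a‖ ≤ Λ) (j : Fin m) :
    ‖specProj a φ j‖ ≤ ‖(1 : R)‖ * (1 + d⁻¹ * (Λ + Λ * ‖(1 : R)‖ * ‖(1 : R)‖)) ^ m := by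
  set c : ℝ := d⁻¹ * (Λ + Λ * ‖(1 : R)‖ * ‖(1 : R)‖) with hc
  have hΛ : 0 ≤ Λ := (norm_nonneg a).trans ha
  have hc0 : 0 ≤ c := by positivity
  have key : ∀ s : Finset (Fin m), j ∉ s →
      ‖Polynomial.aeval a (∏ k ∈ s, Lagrange.basisDivisor (φ j : ℂ) (φ k : ℂ))‖
        ≤ ‖(1 : R)‖ * c ^ s.card := by
    intro s
    induction s using Finset.induction with
    | empty => simp
    | insert k s hk ih =>
      intro hj
      simp only [Finset.mem_insert, not_or] at hj
      rw [Finset.prod_insert hk, map_mul, Finset.card_insert_of_notMem hk]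
      have h1 : ‖Polynomial.aeval a (Lagrange.basisDivisor (φ j : ℂ) (φ k : ℂ))‖ ≤ c := by
        simp only [Lagrange.basisDivisor, map_mul, map_sub, Polynomial.aeval_X, Polynomial.aeval_C]
        rw [← Algebra.smul_def, norm_smul, norm_inv, ← Complex.ofReal_sub, Complex.norm_real,
          Real.norm_eq_abs, hc]
        gcongr
        · exact h.le_abs_sub hj.1
        · refine (norm_sub_le _ _).trans ?_
          gcongr
          rw [Algebra.algebraMap_eq_smul_one, norm_smul, Complex.norm_real, Real.norm_eq_abs]
          gcongr
          exact (h.abs_le k).trans (by gcongr)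
      calc _ ≤ ‖Polynomial.aeval a (Lagrange.basisDivisor (φ j : ℂ) (φ k : ℂ))‖ * _ :=
            norm_mul_le _ _
        _ ≤ c * (‖(1 : R)‖ * c ^ s.card) := by
            gcongr
            exact ih hj.2
        _ = _ := by ring
  refine (key (Finset.univ.erase j) (by simp)).trans ?_
  have : (Finset.univ.erase j).card ≤ m := (Finset.card_le_univ _).trans (by simp)
  gcongr
  calc c ^ (Finset.univ.erase j).card ≤ (1 + c) ^ (Finset.univ.erase j).card := by
        gcongr; linarith
    _ ≤ (1 + c) ^ m := pow_le_pow_right₀ (by linarith) this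

/-- Near coincidence of two increasing lists of roots: root `j` of `a` is close to root `j`
of `b`. Every root of `a` is close to some root of `b` because
`(φ i - ψ k) P_i Q_k = P_i (a - b) Q_k`; by the gaps this correspondence is strictly increasing,
hence the identity. -/
lemma abs_sub_le_of_close (ha : HasGapSpectrum d a φ) (hb : HasGapSpectrum d b ψ) (hd : 0 < d)
    (hm : m = 0 → (1 : R) = 0) {B : ℝ} (hB : ∀ k, ‖specProj b ψ k‖ ≤ B)
    (hclose : 2 * (m * B * ‖a - b‖) < d) (j : Fin m) : |φ j - ψ j| ≤ m * B * ‖a - b‖ := by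
  have h1 : ∀ i, ∃ k, |φ i - ψ k| ≤ m * B * ‖a - b‖ := by
    intro i
    by_contra! hcon
    have hne : (Finset.univ : Finset (Fin m)).Nonempty := ⟨i, Finset.mem_univ i⟩
    have hmpos : (0 : ℝ) < m := by exact_mod_cast i.pos
    have hPi : 0 < ‖specProj a φ i‖ := norm_pos_iff.2 (ha.specProj_ne_zero hd i)
    have h2 : ∀ k, (φ i - ψ k : ℂ) • (specProj a φ i * specProj b ψ k)
        = specProj a φ i * (a - b) * specProj b ψ k := by
      intro k
      rw [mul_sub, sub_mul, ha.specProj_mul, mul_assoc, hb.mul_specProj, sub_smul, smul_mul_assoc,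
        mul_smul_comm]
    have h3 : ∀ k, |φ i - ψ k| * ‖specProj a φ i * specProj b ψ k‖
        ≤ ‖specProj a φ i‖ * ‖a - b‖ * B := by
      intro k
      have := congrArg norm (h2 k)
      rw [norm_smul, ← Complex.ofReal_sub, Complex.norm_real, Real.norm_eq_abs] at this
      rw [this]
      refine (norm_mul_le _ _).trans ?_
      gcongr
      · exact norm_mul_le _ _
      · exact hB k
    have h4 : ‖specProj a φ i‖ ≤ ∑ k, ‖specProj a φ i * specProj b ψ k‖ := by
      conv_lhs => rw [← mul_one (specProj a φ i), ← hb.sum_specProj hd hm, Finset.mul_sum]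
      exact norm_sum_le _ _
    obtain ⟨k, -, hk⟩ : ∃ k ∈ (Finset.univ : Finset (Fin m)),
        ‖specProj a φ i‖ / m ≤ ‖specProj a φ i * specProj b ψ k‖ := by
      apply Finset.exists_le_of_sum_le hne
      refine le_trans (le_of_eq ?_) h4
      simp only [Finset.sum_const, Finset.card_univ, Fintype.card_fin, nsmul_eq_mul]
      field_simp
    have h5 := h3 k
    have h6 := hcon k
    have h7 : |φ i - ψ k| * (‖specProj a φ i‖ / m) ≤ ‖specProj a φ i‖ * ‖a - b‖ * B :=
      le_trans (by gcongr) h5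
    have h8 : m * B * ‖a - b‖ * (‖specProj a φ i‖ / m)
        < |φ i - ψ k| * (‖specProj a φ i‖ / m) := by gcongr
    have h9 : m * B * ‖a - b‖ * (‖specProj a φ i‖ / m) = ‖specProj a φ i‖ * ‖a - b‖ * B := by
      field_simp
    linarith
  choose π hπ using h1
  have hmono : StrictMono π := by
    intro i i' hii'
    by_contra! hle
    have h2 : ψ (π i') ≤ ψ (π i) := (hb.strictMono hd).monotone hle
    have h3 := _root_.abs_le.1 (hπ i)
    have h4 := _root_.abs_le.1 (hπ i')
    linarith [ha.gap i i' hii']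
  have hid : π = id := by
    refine hmono.range_inj strictMono_id |>.1 ?_
    rw [Set.range_id, Set.range_eq_univ]
    exact Finite.surjective_of_injective hmono.injective
  simpa [hid] using hπ j

/-- Lipschitz estimate for the projections of close elements. It rests on the identity
`P_j - Q_j = ∑ k, (P_j Q_k - P_k Q_j)`, whose terms with `k ≠ j` are small since
`(φ i - ψ k) P_i Q_k = P_i (a - b) Q_k` and `|φ i - ψ k| ≥ d / 2` for `i ≠ k`. -/
lemma norm_specProj_sub_le_of_close (ha : HasGapSpectrum d a φ) (hb : HasGapSpectrum d b ψ)
    (hd : 0 < d) (hm : m = 0 → (1 : R) = 0) {B : ℝ} (hB0 : 0 ≤ B)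
    (hBa : ∀ k, ‖specProj a φ k‖ ≤ B) (hB : ∀ k, ‖specProj b ψ k‖ ≤ B)
    (hclose : 2 * (m * B * ‖a - b‖) < d) (j : Fin m) :
    ‖specProj a φ j - specProj b ψ j‖ ≤ m * (4 / d * B ^ 2) * ‖a - b‖ := by
  have hφ := fun j => ha.abs_sub_le_of_close hb hd hm hB hclose j
  have h2 : ∀ i k, (φ i - ψ k : ℂ) • (specProj a φ i * specProj b ψ k)
      = specProj a φ i * (a - b) * specProj b ψ k := by
    intro i k
    rw [mul_sub, sub_mul, ha.specProj_mul, mul_assoc, hb.mul_specProj, sub_smul, smul_mul_assoc,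
      mul_smul_comm]
  have h3 : ∀ i k, i ≠ k →
      ‖specProj a φ i * specProj b ψ k‖ ≤ 2 / d * B ^ 2 * ‖a - b‖ := by
    intro i k hik
    have h4 : d / 2 ≤ |φ i - ψ k| := by
      have h5 := ha.le_abs_sub hik
      have h6 := hφ k
      have h7 : |φ i - φ k| ≤ |φ i - ψ k| + |φ k - ψ k| := by
        rw [abs_sub_comm (φ k)]; exact abs_sub_le _ _ _
      linarith
    have := congrArg norm (h2 i k)
    rw [norm_smul, ← Complex.ofReal_sub, Complex.norm_real, Real.norm_eq_abs] at this
    have h5 : |φ i - ψ k| * ‖specProj a φ i * specProj b ψ k‖ ≤ B * ‖a - b‖ * B := by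
      rw [this]
      refine (norm_mul_le _ _).trans ?_
      gcongr
      · refine (norm_mul_le _ _).trans ?_
        gcongr
        exact hBa i
      · exact hB k
    have h6 : d / 2 * ‖specProj a φ i * specProj b ψ k‖ ≤ B * ‖a - b‖ * B :=
      le_trans (by gcongr) h5
    calc ‖specProj a φ i * specProj b ψ k‖
        = 2 / d * (d / 2 * ‖specProj a φ i * specProj b ψ k‖) := by field_simp
      _ ≤ 2 / d * (B * ‖a - b‖ * B) := by gcongr
      _ = _ := by ring
  have h4 : specProj a φ j - specProj b ψ j
      = ∑ k, (specProj a φ j * specProj b ψ k - specProj a φ k * specProj b ψ j) := by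
    rw [Finset.sum_sub_distrib, ← Finset.mul_sum, ← Finset.sum_mul, ha.sum_specProj hd hm,
      hb.sum_specProj hd hm, mul_one, one_mul]
  rw [h4]
  refine (norm_sum_le _ _).trans ?_
  calc ∑ k, ‖specProj a φ j * specProj b ψ k - specProj a φ k * specProj b ψ j‖
      ≤ ∑ _k : Fin m, 4 / d * B ^ 2 * ‖a - b‖ := by
        refine Finset.sum_le_sum fun k _ => ?_
        by_cases hjk : j = k
        · subst hjk; simp; positivity
        · refine (norm_sub_le _ _).trans ?_
          have := h3 j k hjk
          have := h3 k j (Ne.symm hjk)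
          have e : 4 / d * B ^ 2 * ‖a - b‖ = 2 / d * B ^ 2 * ‖a - b‖ + 2 / d * B ^ 2 * ‖a - b‖ := by
            ring
          linarith
    _ = _ := by simp; ring

end HasGapSpectrum

/-- Roots and spectral projections are Lipschitz functions of the matrix on bounded sets of
matrices with a spectral gap. The hypothesis `hm` only concerns `m = 0`, where the empty sum of
projections has to be the unit. -/
theorem exists_lipschitz_specProj [CompleteSpace R] {d : ℝ} (hd : 0 < d) (Λ : ℝ)
    (hm : m = 0 → (1 : R) = 0) :
    ∃ B C : ℝ, 0 ≤ B ∧ 0 ≤ C ∧ ∀ (a b : R) (φ ψ : Fin m → ℝ), HasGapSpectrum d a φ →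
      HasGapSpectrum d b ψ → ‖a‖ ≤ Λ → ‖b‖ ≤ Λ → ∀ j, ‖specProj a φ j‖ ≤ B ∧
        ‖specProj a φ j - specProj b ψ j‖ ≤ C * ‖a - b‖ ∧ |φ j - ψ j| ≤ C * ‖a - b‖ := by
  by_cases hΛ : 0 ≤ Λ
  swap
  · refine ⟨0, 0, le_rfl, le_rfl, fun a b φ ψ _ _ ha => ?_⟩
    exact absurd ((norm_nonneg a).trans ha) hΛ
  set B := ‖(1 : R)‖ * (1 + d⁻¹ * (Λ + Λ * ‖(1 : R)‖ * ‖(1 : R)‖)) ^ m with hBdef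
  have hB : 0 ≤ B := by positivity
  set Λ' := Λ * ‖(1 : R)‖ with hΛ'
  have hΛ'0 : 0 ≤ Λ' := by positivity
  -- At distance at least `d / (2 m B)` the trivial bounds `2 B` and `2 Λ ‖1‖` are used.
  set C := (m * B + m * (4 / d * B ^ 2)) + (2 * B + 2 * Λ') * (2 * (m * B) / d) with hC
  refine ⟨B, C, hB, by positivity, fun a b φ ψ ha hb hna hnb j => ?_⟩
  have hBa := fun k => ha.norm_specProj_le hd hna k
  have hBb := fun k => hb.norm_specProj_le hd hnb k
  refine ⟨hBa j, ?_⟩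
  by_cases hclose : 2 * (m * B * ‖a - b‖) < d
  · have h1 := ha.abs_sub_le_of_close hb hd hm hBb hclose j
    have h2 := ha.norm_specProj_sub_le_of_close hb hd hm hB hBa hBb hclose j
    have h3 : m * B ≤ C := by
      rw [hC, add_assoc]; exact le_add_of_nonneg_right (by positivity)
    have h4 : m * (4 / d * B ^ 2) ≤ C := by
      have : 0 ≤ m * B + (2 * B + 2 * Λ') * (2 * (m * B) / d) := by positivity
      rw [hC]; linarith
    exact ⟨h2.trans (by gcongr), h1.trans (by gcongr)⟩
  · push Not at hclose
    have h0 : 1 ≤ 2 * (m * B) / d * ‖a - b‖ := by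
      rw [div_mul_eq_mul_div, le_div_iff₀ hd]; linarith
    have h3 : 2 * B + 2 * Λ' ≤ C * ‖a - b‖ := by
      calc 2 * B + 2 * Λ' ≤ (2 * B + 2 * Λ') * (2 * (m * B) / d * ‖a - b‖) :=
            le_mul_of_one_le_right (by positivity) h0
        _ = (2 * B + 2 * Λ') * (2 * (m * B) / d) * ‖a - b‖ := by ring
        _ ≤ C * ‖a - b‖ := by
            gcongr
            rw [hC]
            exact le_add_of_nonneg_left (by positivity)
    constructor
    · have := norm_sub_le (specProj a φ j) (specProj b ψ j)
      linarith [hBa j, hBb j]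
    · have h1 := (ha.abs_le j).trans (mul_le_mul_of_nonneg_right hna (norm_nonneg _))
      have h2 := (hb.abs_le j).trans (mul_le_mul_of_nonneg_right hnb (norm_nonneg _))
      have := abs_sub (φ j) (ψ j)
      linarith

end Projections

section MatrixSpectrum

open scoped Matrix.Norms.L2Operator

/-- Sorting the characteristic roots of a matrix with real roots and gap `d`. -/
theorem exists_hasGapSpectrum {m : ℕ} {d : ℝ} (a : Matrix (Fin m) (Fin m) ℂ) (φ : Fin m → ℝ)
    (hdet : ∀ τ : ℂ, (τ • (1 : Matrix (Fin m) (Fin m) ℂ) - a).det = ∏ j, (τ - (φ j : ℂ)))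
    (hgap : ∀ j k, j ≠ k → d ≤ |φ j - φ k|) :
    ∃ ψ : Fin m → ℝ, HasGapSpectrum d a ψ := by
  refine ⟨φ ∘ Tuple.sort φ, ?_, ?_, ?_⟩
  · intro i j hij
    have h1 := Tuple.monotone_sort φ hij.le
    have h2 := hgap _ _ ((Tuple.sort φ).injective.ne hij.ne)
    rw [abs_sub_comm, abs_of_nonneg (by simpa using h1)] at h2
    simp only [Function.comp]
    linarith
  · have : Lagrange.nodal Finset.univ (fun j => (((φ ∘ Tuple.sort φ) j : ℝ) : ℂ)) = a.charpoly := by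
      apply Polynomial.funext
      intro τ
      rw [Lagrange.eval_nodal, Matrix.eval_charpoly, Matrix.scalar_apply,
        ← Matrix.smul_one_eq_diagonal, hdet]
      exact Equiv.prod_comp (Tuple.sort φ) (fun j => τ - (φ j : ℂ))
    rw [this, Matrix.aeval_self_charpoly]
  · intro j
    rw [spectrum.mem_iff, Matrix.isUnit_iff_isUnit_det, Algebra.algebraMap_eq_smul_one, hdet]
    rw [Finset.prod_eq_zero (Finset.mem_univ (Tuple.sort φ j)) (by simp)]
    simp

end MatrixSpectrum

/-! ### Calculus of locally Lipschitz curves -/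

section Curves

open Set Filter Topology
open scoped NNReal

lemma _root_.LocallyLipschitz.exists_lipschitzOnWith_Icc {E : Type*} [NormedAddCommGroup E]
    {f : ℝ → E} (hf : LocallyLipschitz f) (a b : ℝ) : ∃ C : ℝ≥0, LipschitzOnWith C f (Icc a b) :=
  LocallyLipschitzOn.exists_lipschitzOnWith_of_compact isCompact_Icc (hf.locallyLipschitzOn)

variable {E : Type*} [NormedAddCommGroup E] [NormedSpace ℝ E] [FiniteDimensional ℝ E] {f : ℝ → E}

lemma _root_.LocallyLipschitz.ae_differentiableAt_real (hf : LocallyLipschitz f) :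
    ∀ᵐ t, DifferentiableAt ℝ f t := by
  have h : ∀ n : ℕ, ∀ᵐ t, t ∈ Icc (-n : ℝ) n → DifferentiableWithinAt ℝ f (Icc (-n : ℝ) n) t := by
    intro n
    obtain ⟨C, hC⟩ := hf.exists_lipschitzOnWith_Icc (-n) n
    exact (ae_restrict_iff' measurableSet_Icc).1
      (hC.ae_differentiableWithinAt_real measurableSet_Icc)
  filter_upwards [ae_all_iff.2 h] with t ht
  obtain ⟨n, hn⟩ := exists_nat_gt |t|
  have h1 := abs_lt.1 hn
  exact (ht n ⟨h1.1.le, h1.2.le⟩).differentiableAt (Icc_mem_nhds h1.1 h1.2)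

lemma _root_.LocallyLipschitz.intervalIntegrable_deriv (hf : LocallyLipschitz f) (a b : ℝ) :
    IntervalIntegrable (deriv f) volume a b := by
  have : CompleteSpace E := FiniteDimensional.complete ℝ E
  wlog hab : a ≤ b generalizing a b
  · exact (this b a (le_of_not_ge hab)).symm
  obtain ⟨C, hC⟩ := hf.exists_lipschitzOnWith_Icc (a - 1) (b + 1)
  rw [intervalIntegrable_iff_integrableOn_Ioc_of_le hab]
  refine Measure.integrableOn_of_bounded (M := C) (by simp)
    (stronglyMeasurable_deriv f).aestronglyMeasurable ?_
  filter_upwards [ae_restrict_mem measurableSet_Ioc] with t ht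
  exact norm_deriv_le_of_lipschitzOn (Icc_mem_nhds (by linarith [ht.1]) (by linarith [ht.2])) hC

lemma _root_.LocallyLipschitz.integral_deriv_eq_sub (hf : LocallyLipschitz f) (a b : ℝ) :
    ∫ t in a..b, deriv f t = f b - f a := by
  have : CompleteSpace E := FiniteDimensional.complete ℝ E
  have hint := hf.intervalIntegrable_deriv a b
  obtain ⟨C, hC⟩ := hf.exists_lipschitzOnWith_Icc (min a b - 1) (max a b + 1)
  have hbd : ∀ t ∈ uIcc a b, ‖deriv f t‖ ≤ C := fun t ht =>
    norm_deriv_le_of_lipschitzOn (Icc_mem_nhds (by linarith [ht.1]) (by linarith [ht.2])) hC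
  -- `f` and the primitive of `deriv f` are both absolutely continuous, with the same derivative
  -- almost everywhere, so that their difference is constant.
  have hF : LipschitzOnWith C (fun x => ∫ t in a..x, deriv f t) (uIcc a b) := by
    refine LipschitzOnWith.of_dist_le_mul fun x hx y hy => ?_
    rw [dist_eq_norm, intervalIntegral.integral_interval_sub_left
      (hf.intervalIntegrable_deriv _ _) (hf.intervalIntegrable_deriv _ _), Real.dist_eq]
    refine intervalIntegral.norm_integral_le_of_norm_le_const fun t ht => hbd t ?_
    exact uIcc_subset_uIcc hy hx (uIoc_subset_uIcc ht)
  have hf' : AbsolutelyContinuousOnInterval f a b :=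
    (hC.mono (Icc_subset_Icc (by linarith) (by linarith))).absolutelyContinuousOnInterval
  obtain ⟨c, hc⟩ := (hf'.sub hF.absolutelyContinuousOnInterval).const_of_ae_hasDerivAt_zero (by
    filter_upwards [hf.ae_differentiableAt_real, hint.ae_hasDerivAt_integral] with x h1 h2 hx
    convert! h1.hasDerivAt.sub (h2 hx a (by simp)) using 1
    simp)
  have h1 := hc a (by simp)
  have h2 := hc b (by simp)
  simp only [Pi.sub_apply, intervalIntegral.integral_same, sub_zero] at h1 h2
  rw [← h1] at h2
  rw [← sub_eq_zero, ← neg_eq_zero, ← sub_eq_zero.2 h2]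
  abel

/-- Increments dominated by a measure density bound the total variation. -/
lemma eVariationOn_le_lintegral {E : Type*} [PseudoEMetricSpace E] {f : ℝ → E} {g : ℝ → ℝ≥0∞}
    (h : ∀ s t, s ≤ t → edist (f t) (f s) ≤ ∫⁻ x in Ioc s t, g x) :
    eVariationOn f univ ≤ ∫⁻ x, g x := by
  refine iSup_le fun p => ?_
  obtain ⟨n, u, hu, -⟩ := p
  calc ∑ i ∈ Finset.range n, edist (f (u (i + 1))) (f (u i))
      ≤ ∑ i ∈ Finset.range n, ∫⁻ x in Ioc (u i) (u (i + 1)), g x :=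
        Finset.sum_le_sum fun i _ => h _ _ (hu (Nat.le_succ i))
    _ = ∫⁻ x in ⋃ i ∈ Finset.range n, Ioc (u i) (u (i + 1)), g x := by
        rw [lintegral_biUnion_finset]
        · exact fun i _ j _ hij => hu.pairwise_disjoint_on_Ioc_succ hij
        · exact fun i _ => measurableSet_Ioc
    _ ≤ ∫⁻ x, g x := setLIntegral_le_lintegral _ _

end Curves

/-! ### A comparison principle for translated Volterra inequalities -/

section Comparison

open Filter Topology

variable {ι : Type*} [Fintype ι]

/-- The positive operator which dominates one Duhamel step: it acts on families `G j k` of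
functions of `x` by translations and integration against the densities `β j`. -/
noncomputable def stepOp (θ : ι → ℝ → ℝ) (β : ι → ℝ → ℝ≥0∞) (G : ι → ι → ℝ → ℝ≥0∞) (j k : ι)
    (x : ℝ) : ℝ≥0∞ :=
  ∫⁻ s, (β j s * ∑ l, G l k (x - θ j s + θ l s) + β k s * ∑ l, G j l (x - θ l s + θ k s))

variable {θ : ι → ℝ → ℝ} {β : ι → ℝ → ℝ≥0∞}

lemma measurable_stepOp_integrand (hθ : ∀ j, Measurable (θ j)) (hβ : ∀ j, Measurable (β j))
    {G : ι → ι → ℝ → ℝ≥0∞} (hG : ∀ j k, Measurable (G j k)) (j k : ι) :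
    Measurable fun p : ℝ × ℝ => β j p.2 * ∑ l, G l k (p.1 - θ j p.2 + θ l p.2)
      + β k p.2 * ∑ l, G j l (p.1 - θ l p.2 + θ k p.2) := by
  have h1 : ∀ j, Measurable fun p : ℝ × ℝ => θ j p.2 := fun j => (hθ j).comp measurable_snd
  have h2 : ∀ j, Measurable fun p : ℝ × ℝ => β j p.2 := fun j => (hβ j).comp measurable_snd
  refine ((h2 j).mul (Finset.measurable_sum _ fun l _ => ?_)).add
    ((h2 k).mul (Finset.measurable_sum _ fun l _ => ?_))
  · exact (hG l k).comp ((measurable_fst.sub (h1 j)).add (h1 l))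
  · exact (hG j l).comp ((measurable_fst.sub (h1 l)).add (h1 k))

lemma measurable_stepOp (hθ : ∀ j, Measurable (θ j)) (hβ : ∀ j, Measurable (β j))
    {G : ι → ι → ℝ → ℝ≥0∞} (hG : ∀ j k, Measurable (G j k)) (j k : ι) :
    Measurable (stepOp θ β G j k) :=
  (measurable_stepOp_integrand hθ hβ hG j k).lintegral_prod_right'

/-- Translations preserve the `L¹` norm, so that `stepOp` is bounded on `L¹`. -/
lemma sum_lintegral_stepOp (hθ : ∀ j, Measurable (θ j)) (hβ : ∀ j, Measurable (β j))
    {G : ι → ι → ℝ → ℝ≥0∞} (hG : ∀ j k, Measurable (G j k)) :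
    ∑ j, ∑ k, ∫⁻ x, stepOp θ β G j k x = 2 * (∑ j, ∫⁻ s, β j s) * ∑ j, ∑ k, ∫⁻ x, G j k x := by
  have htr : ∀ (g : ℝ → ℝ≥0∞) (a b : ℝ), ∫⁻ x, g (x - a + b) = ∫⁻ x, g x := by
    intro g a b
    have := lintegral_add_right_eq_self (μ := (volume : Measure ℝ)) g (-a + b)
    rw [← this]
    congr 1; ext x; congr 1; ring
  have key : ∀ j k, ∫⁻ x, stepOp θ β G j k x
      = (∫⁻ s, β j s) * ∑ l, (∫⁻ x, G l k x) + (∫⁻ s, β k s) * ∑ l, ∫⁻ x, G j l x := by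
    intro j k
    unfold stepOp
    rw [lintegral_lintegral_swap (measurable_stepOp_integrand hθ hβ hG j k).aemeasurable]
    have h1 : ∀ s, ∫⁻ x, (β j s * ∑ l, G l k (x - θ j s + θ l s)
        + β k s * ∑ l, G j l (x - θ l s + θ k s))
        = β j s * ∑ l, (∫⁻ x, G l k x) + β k s * ∑ l, ∫⁻ x, G j l x := by
      intro s
      have m1 : ∀ l, Measurable fun x => G l k (x - θ j s + θ l s) := fun l =>
        (hG l k).comp (by fun_prop)
      have m2 : ∀ l, Measurable fun x => G j l (x - θ l s + θ k s) := fun l =>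
        (hG j l).comp (by fun_prop)
      rw [lintegral_add_left, lintegral_const_mul, lintegral_const_mul, lintegral_finsetSum,
        lintegral_finsetSum]
      · simp only [htr]
      · exact fun l _ => m2 l
      · exact fun l _ => m1 l
      · exact Finset.measurable_sum _ fun l _ => m2 l
      · exact Finset.measurable_sum _ fun l _ => m1 l
      · exact (Finset.measurable_sum _ fun l _ => m1 l).const_mul _
    simp only [h1]
    rw [lintegral_add_left ((hβ j).mul_const _), lintegral_mul_const _ (hβ j),
      lintegral_mul_const _ (hβ k)]
  simp only [key, Finset.sum_add_distrib]
  have e1 : ∑ j, ∑ k, (∫⁻ s, β j s) * ∑ l, (∫⁻ x, G l k x)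
      = (∑ j, ∫⁻ s, β j s) * ∑ j, ∑ k, ∫⁻ x, G j k x := by
    simp only [← Finset.mul_sum]
    rw [← Finset.sum_mul]
    congr 1
    rw [Finset.sum_comm]
  have e2 : ∑ j, ∑ k, (∫⁻ s, β k s) * ∑ l, (∫⁻ x, G j l x)
      = (∑ j, ∫⁻ s, β j s) * ∑ j, ∑ k, ∫⁻ x, G j k x := by
    simp only [← Finset.sum_mul]
    rw [← Finset.mul_sum]
  rw [e1, e2]
  ring

/-- A bounded family `w j k t x` satisfying the integral inequality `w ≤ g + stepOp w`, with a
small total density, is dominated by a function of `x` alone whose `L¹` norm is controlled by that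
of `g`. This is how a supremum over `t` is placed inside the `L¹` norm in `x`. -/
theorem exists_majorant (hθ : ∀ j, Measurable (θ j)) (hβ : ∀ j, Measurable (β j))
    (hsmall : (Fintype.card ι + 1) * ∑ j, ∫⁻ s, β j s ≤ 1 / 4)
    {g : ι → ι → ℝ → ℝ≥0∞} (hg : ∀ j k, Measurable (g j k)) {w : ι → ι → ℝ → ℝ → ℝ≥0∞}
    {b : ℝ≥0∞} (hb : b ≠ ⊤) (hw : ∀ j k t x, w j k t x ≤ b)
    (hineq : ∀ j k t x, w j k t x ≤ g j k x + ∫⁻ s, (β j s * ∑ l, w l k s (x - θ j s + θ l s)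
      + β k s * ∑ l, w j l s (x - θ l s + θ k s))) :
    ∃ G : ι → ι → ℝ → ℝ≥0∞, (∀ j k, Measurable (G j k)) ∧ (∀ j k t x, w j k t x ≤ G j k x) ∧
      ∑ j, ∑ k, ∫⁻ x, G j k x ≤ 2 * ∑ j, ∑ k, ∫⁻ x, g j k x := by
  -- The majorant is the limit of the Picard iterates of `G ↦ g + stepOp G`, started at zero.
  set G : ℕ → ι → ι → ℝ → ℝ≥0∞ := fun N =>
    Nat.rec (fun _ _ _ => 0) (fun _ H j k x => g j k x + stepOp θ β H j k x) N with hGdef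
  have hGs : ∀ N j k x, G (N + 1) j k x = g j k x + stepOp θ β (G N) j k x := fun _ _ _ _ => rfl
  have hGm : ∀ N j k, Measurable (G N j k) := by
    intro N
    induction N with
    | zero => exact fun j k => measurable_const
    | succ N ih => exact fun j k => (hg j k).add (measurable_stepOp hθ hβ ih j k)
  have hβj : ∀ j, (Fintype.card ι : ℝ≥0∞) * ∫⁻ s, β j s ≤ 1 / 4 := fun j => by
    refine le_trans ?_ hsmall
    gcongr
    · exact le_self_add
    · exact Finset.single_le_sum (f := fun j => ∫⁻ s, β j s) (fun _ _ => zero_le)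
        (Finset.mem_univ j)
  have hβs : ∑ j, ∫⁻ s, β j s ≤ 1 / 4 := by
    refine le_trans ?_ hsmall
    exact le_mul_of_one_le_left zero_le le_add_self
  have h4 : (1 / 4 : ℝ≥0∞) + 1 / 4 = 1 / 2 := by
    rw [show (1 / 4 : ℝ≥0∞) = 1 / 2 / 2 by
      rw [show (4 : ℝ≥0∞) = 2 * 2 by norm_num, one_div, one_div, ENNReal.div_eq_inv_mul,
        ENNReal.mul_inv (by norm_num) (by norm_num)]]
    exact ENNReal.add_halves _
  -- After `N` steps the remainder is at most `2⁻ᴺ b`.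
  have hwG : ∀ N j k t x, w j k t x ≤ G N j k x + (1 / 2) ^ N * b := by
    intro N
    induction N with
    | zero => intro j k t x; simpa [hGdef] using hw j k t x
    | succ N ih =>
      intro j k t x
      rw [hGs, add_assoc]
      refine (hineq j k t x).trans ?_
      gcongr
      set r : ℝ≥0∞ := (1 / 2) ^ N * b
      calc _ ≤ ∫⁻ s, ((β j s * ∑ l, G N l k (x - θ j s + θ l s)
              + β k s * ∑ l, G N j l (x - θ l s + θ k s))
              + (β j s * (Fintype.card ι * r) + β k s * (Fintype.card ι * r))) := by
            refine lintegral_mono fun s => ?_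
            calc _ ≤ β j s * ∑ l, (G N l k (x - θ j s + θ l s) + r)
                  + β k s * ∑ l, (G N j l (x - θ l s + θ k s) + r) := by
                  gcongr <;> exact ih _ _ _ _
              _ = _ := by
                  simp only [Finset.sum_add_distrib, Finset.sum_const, Finset.card_univ,
                    nsmul_eq_mul, mul_add]
                  ring
        _ = stepOp θ β (G N) j k x
              + ((∫⁻ s, β j s) * (Fintype.card ι * r) + (∫⁻ s, β k s) * (Fintype.card ι * r)) := by
            have m1 : Measurable fun s => β j s * (Fintype.card ι * r)
                + β k s * (Fintype.card ι * r) := ((hβ j).mul_const _).add ((hβ k).mul_const _)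
            rw [lintegral_add_right _ m1, lintegral_add_left ((hβ j).mul_const _),
              lintegral_mul_const _ (hβ j), lintegral_mul_const _ (hβ k)]
            rfl
        _ ≤ stepOp θ β (G N) j k x + (1 / 2) ^ (N + 1) * b := by
            gcongr
            calc _ = (Fintype.card ι * ∫⁻ s, β j s) * r + (Fintype.card ι * ∫⁻ s, β k s) * r := by
                  ring
              _ ≤ (1 / 4) * r + (1 / 4) * r := by
                  gcongr
                  · exact hβj j
                  · exact hβj k
              _ = _ := by rw [← add_mul, h4, pow_succ']; ring
  have hGint : ∀ N, ∑ j, ∑ k, ∫⁻ x, G N j k x ≤ 2 * ∑ j, ∑ k, ∫⁻ x, g j k x := by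
    intro N
    induction N with
    | zero => simp [hGdef]
    | succ N ih =>
      have : ∑ j, ∑ k, ∫⁻ x, G (N + 1) j k x
          = (∑ j, ∑ k, ∫⁻ x, g j k x) + ∑ j, ∑ k, ∫⁻ x, stepOp θ β (G N) j k x := by
        simp only [← Finset.sum_add_distrib, hGs]
        refine Finset.sum_congr rfl fun j _ => Finset.sum_congr rfl fun k _ => ?_
        rw [lintegral_add_left (hg j k)]
      rw [this, sum_lintegral_stepOp hθ hβ (hGm N)]
      calc _ ≤ (∑ j, ∑ k, ∫⁻ x, g j k x) + 2 * (1 / 4) * (2 * ∑ j, ∑ k, ∫⁻ x, g j k x) := by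
            gcongr
        _ = _ := by
            rw [two_mul (1 / 4 : ℝ≥0∞), h4, ← mul_assoc, one_div,
              ENNReal.inv_mul_cancel two_ne_zero ENNReal.ofNat_ne_top]
            ring
  have hGmono : ∀ N j k x, G N j k x ≤ G (N + 1) j k x := by
    intro N
    induction N with
    | zero => intro j k x; exact zero_le
    | succ N ih =>
      intro j k x
      rw [hGs, hGs (N + 1)]
      unfold stepOp
      gcongr <;> exact ih _ _ _
  have hGmono' : ∀ j k x, Monotone fun N => G N j k x := fun j k x =>
    monotone_nat_of_le_succ fun N => hGmono N j k x
  refine ⟨fun j k x => ⨆ N, G N j k x, fun j k => Measurable.iSup fun N => hGm N j k,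
    fun j k t x => ?_, ?_⟩
  · have hr : Tendsto (fun N : ℕ => (⨆ N, G N j k x) + ((1 / 2 : ℝ≥0∞)) ^ N * b) atTop
        (𝓝 ((⨆ N, G N j k x) + 0 * b)) :=
      tendsto_const_nhds.add (ENNReal.Tendsto.mul_const
        (ENNReal.tendsto_pow_atTop_nhds_zero_of_lt_one (r := 1 / 2)
          (by rw [one_div]; exact ENNReal.inv_lt_one.2 (by norm_num))) (Or.inr hb))
    rw [zero_mul, add_zero] at hr
    refine ge_of_tendsto' hr fun N => (hwG N j k t x).trans ?_
    gcongr
    exact le_iSup (fun N => G N j k x) N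
  · have h1 : ∀ j k, ∫⁻ x, ⨆ N, G N j k x = ⨆ N, ∫⁻ x, G N j k x := fun j k =>
      lintegral_iSup (fun N => hGm N j k) fun N M hNM x => hGmono' j k x hNM
    have h2 : ∀ j k, Monotone fun N => ∫⁻ x, G N j k x := fun j k N M hNM =>
      lintegral_mono fun x => hGmono' j k x hNM
    have h3 : ∀ j, ∑ k, ⨆ N, ∫⁻ x, G N j k x = ⨆ N, ∑ k, ∫⁻ x, G N j k x := fun j =>
      ENNReal.finsetSum_iSup_of_monotone fun k => h2 j k
    simp only [h1, h3]
    rw [ENNReal.finsetSum_iSup_of_monotone fun j N M hNM =>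
      Finset.sum_le_sum fun k _ => h2 j k hNM]
    exact iSup_le hGint

end Comparison

/-! ### Diagonalized flow along a ray -/

section Ray

open Set Filter Topology
open scoped NNReal

variable {R : Type*} [NormedRing R] [NormedAlgebra ℂ R] [StarRing R] [NormedStarGroup R]
  [StarModule ℂ R] [FiniteDimensional ℂ R] {ι : Type*} [Fintype ι]

/-- A curve `a` with real spectral decomposition `a t = ∑ j, φ j t • P j t`. The projections are
uniformly bounded, of small total variation, and the roots never cross. -/
structure SpectralFamily (a : ℝ → R) (φ : ι → ℝ → ℝ) (P : ι → ℝ → R) (B : ℝ) : Prop where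
  continuous_curve : Continuous a
  continuous_root : ∀ j, Continuous (φ j)
  locallyLipschitz_proj : ∀ j, LocallyLipschitz (P j)
  mul_proj : ∀ j t, a t * P j t = (φ j t : ℂ) • P j t
  proj_mul : ∀ j t, P j t * a t = (φ j t : ℂ) • P j t
  sum_proj : ∀ t, ∑ j, P j t = 1
  norm_proj_le : ∀ j t, ‖P j t‖ ≤ B
  root_lt : ∀ j k, j ≠ k → (∀ t, φ j t < φ k t) ∨ ∀ t, φ k t < φ j t
  variation : (Fintype.card ι + 1) * ∑ j, ∫⁻ t, ‖deriv (P j) t‖ₑ ≤ 1 / 4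

/-- Solutions of `∂ₜ X = i ρ (a X - X a^*)`, the equation satisfied by the matrices
`X t ρ = v(t, ρ) v(t, ρ)^*` when `∂ₜ v = i ρ a v`. The measure `μ` on the frequencies `ρ` stands for
the radial part of Lebesgue measure. -/
structure RayFlow (a : ℝ → R) (X : ℝ → ℝ → R) (μ : Measure ℝ) : Prop where
  stronglyMeasurable : ∀ t, StronglyMeasurable (X t)
  hasDerivAt : ∀ ρ t, HasDerivAt (fun r => X r ρ)
    ((Complex.I * ρ) • (a t * X t ρ - X t ρ * star (a t))) t
  integrable : Integrable (X 0) μ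

/-- The phase `θ j t = ∫₀ᵗ φ j`. -/
noncomputable def phase (φ : ι → ℝ → ℝ) (j : ι) (t : ℝ) : ℝ := ∫ s in (0 : ℝ)..t, φ j s

@[simp] lemma phase_zero (φ : ι → ℝ → ℝ) (j : ι) : phase φ j 0 = 0 := by simp [phase]

/-- The oscillating factor `e^{iρ(x - θ_j + θ_k)}`. -/
noncomputable def osc (φ : ι → ℝ → ℝ) (j k : ι) (ρ x t : ℝ) : ℂ :=
  Complex.exp (Complex.I * (ρ * (x - phase φ j t + phase φ k t) : ℝ))

lemma norm_osc (φ : ι → ℝ → ℝ) (j k : ι) (ρ x t : ℝ) : ‖osc φ j k ρ x t‖ = 1 := by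
  rw [osc, mul_comm, Complex.norm_exp_ofReal_mul_I]

namespace SpectralFamily

variable {a : ℝ → R} {φ : ι → ℝ → ℝ} {P : ι → ℝ → R} {B : ℝ}

lemma hasDerivAt_phase (h : SpectralFamily a φ P B) (j : ι) (t : ℝ) :
    HasDerivAt (phase φ j) (φ j t) t :=
  intervalIntegral.integral_hasDerivAt_right ((h.continuous_root j).intervalIntegrable _ _)
    ((h.continuous_root j).stronglyMeasurableAtFilter _ _) (h.continuous_root j).continuousAt

lemma continuous_phase (h : SpectralFamily a φ P B) (j : ι) : Continuous (phase φ j) :=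
  continuous_iff_continuousAt.2 fun t => (h.hasDerivAt_phase j t).continuousAt

lemma hasDerivAt_osc (h : SpectralFamily a φ P B) (j k : ι) (ρ x t : ℝ) :
    HasDerivAt (osc φ j k ρ x)
      (Complex.I * ρ * (-φ j t + φ k t) * osc φ j k ρ x t) t := by
  have h1 : HasDerivAt (fun t => ρ * (x - phase φ j t + phase φ k t))
      (ρ * (-φ j t + φ k t)) t := by
    have := (((h.hasDerivAt_phase j t).const_sub x).add (h.hasDerivAt_phase k t)).const_mul ρ
    exact this
  have h2 := (h1.ofReal_comp.const_mul Complex.I).cexp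
  convert! h2 using 1
  rw [osc]
  push_cast
  ring

lemma continuous_osc (h : SpectralFamily a φ P B) (j k : ι) (ρ x : ℝ) :
    Continuous (osc φ j k ρ x) :=
  continuous_iff_continuousAt.2 fun t => (h.hasDerivAt_osc j k ρ x t).continuousAt

lemma continuous_proj (h : SpectralFamily a φ P B) (j : ι) : Continuous (P j) :=
  (h.locallyLipschitz_proj j).continuous

end SpectralFamily

lemma _root_.LocallyLipschitz.of_hasDerivAt {E : Type*} [NormedAddCommGroup E] [NormedSpace ℝ E]
    {f f' : ℝ → E} (hf : ∀ t, HasDerivAt f (f' t) t) (hf' : Continuous f') :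
    LocallyLipschitz f := by
  have : ContDiff ℝ 1 f := by
    rw [contDiff_one_iff_deriv]
    refine ⟨fun t => (hf t).differentiableAt, ?_⟩
    rwa [funext fun t => (hf t).deriv]
  exact this.locallyLipschitz

lemma _root_.LocallyLipschitz.mul_ring {f g : ℝ → R} (hf : LocallyLipschitz f)
    (hg : LocallyLipschitz g) : LocallyLipschitz fun t => f t * g t :=
  (contDiff_mul (𝕜 := ℂ) (n := 1) (𝔸 := R)).locallyLipschitz.comp (hf.prodMk hg)

lemma enorm_intervalIntegral_le {E : Type*} [NormedAddCommGroup E] [NormedSpace ℝ E]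
    (f : ℝ → E) (s t : ℝ) : ‖∫ r in s..t, f r‖ₑ ≤ ∫⁻ r in uIoc s t, ‖f r‖ₑ := by
  rw [← ofReal_norm, intervalIntegral.norm_intervalIntegral_eq, ofReal_norm]
  exact enorm_integral_le_lintegral_enorm _

lemma enorm_mul_le_mul {S : Type*} [NormedRing S] (u v : S) : ‖u * v‖ₑ ≤ ‖u‖ₑ * ‖v‖ₑ := by
  simp only [enorm, ← ENNReal.coe_mul, ENNReal.coe_le_coe]
  exact nnnorm_mul_le u v

namespace RayFlow

variable {a : ℝ → R} {φ : ι → ℝ → ℝ} {P : ι → ℝ → R} {B : ℝ} {X : ℝ → ℝ → R} {μ : Measure ℝ}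

lemma continuous (hX : RayFlow a X μ) (ρ : ℝ) : Continuous fun t => X t ρ :=
  continuous_iff_continuousAt.2 fun t => (hX.hasDerivAt ρ t).continuousAt

lemma stronglyMeasurable_uncurry (hX : RayFlow a X μ) :
    StronglyMeasurable (Function.uncurry X) :=
  stronglyMeasurable_uncurry_of_continuous_of_stronglyMeasurable hX.continuous
    hX.stronglyMeasurable

lemma locallyLipschitz (hX : RayFlow a X μ) (h : SpectralFamily a φ P B) (ρ : ℝ) :
    LocallyLipschitz fun t => X t ρ := by
  refine LocallyLipschitz.of_hasDerivAt (hX.hasDerivAt ρ) ?_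
  have h1 := hX.continuous ρ
  have h2 := h.continuous_curve
  fun_prop

/-- One block `e^{iρ(x - θ_j + θ_k)} P_j X P_k^*`. Its phase is chosen so that the time derivative
only sees the derivatives of the projections. -/
noncomputable def block (φ : ι → ℝ → ℝ) (P : ι → ℝ → R) (X : ℝ → ℝ → R) (j k : ι) (ρ x t : ℝ) :
    R :=
  osc φ j k ρ x t • (P j t * X t ρ * star (P k t))

/-- The time derivative of a block. -/
noncomputable def blockDeriv (φ : ι → ℝ → ℝ) (P : ι → ℝ → R) (X : ℝ → ℝ → R) (j k : ι)
    (ρ x t : ℝ) : R :=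
  osc φ j k ρ x t • (deriv (P j) t * X t ρ * star (P k t) + P j t * X t ρ * star (deriv (P k) t))

lemma locallyLipschitz_block (hX : RayFlow a X μ) (h : SpectralFamily a φ P B) (j k : ι)
    (ρ x : ℝ) : LocallyLipschitz (block φ P X j k ρ x) := by
  have h1 : LocallyLipschitz (osc φ j k ρ x) := by
    refine LocallyLipschitz.of_hasDerivAt (h.hasDerivAt_osc j k ρ x) ?_
    have := h.continuous_osc j k ρ x
    have := h.continuous_root j
    have := h.continuous_root k
    fun_prop
  have h2 : LocallyLipschitz fun t => algebraMap ℂ R (osc φ j k ρ x t) :=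
    ((algebraMapCLM ℂ R).lipschitz.locallyLipschitz).comp h1
  have h3 : LocallyLipschitz fun t => star (P k t) :=
    (LipschitzWith.locallyLipschitz (starₗᵢ ℂ (E := R)).lipschitz).comp
      (h.locallyLipschitz_proj k)
  have := h2.mul_ring (((h.locallyLipschitz_proj j).mul_ring (hX.locallyLipschitz h ρ)).mul_ring h3)
  convert! this using 1
  ext t
  rw [block, Algebra.smul_def]

lemma hasDerivAt_block (hX : RayFlow a X μ) (h : SpectralFamily a φ P B) (j k : ι) (ρ x : ℝ)
    {t : ℝ} (hj : DifferentiableAt ℝ (P j) t) (hk : DifferentiableAt ℝ (P k) t) :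
    HasDerivAt (block φ P X j k ρ x) (blockDeriv φ P X j k ρ x t) t := by
  have h1 := (h.hasDerivAt_osc j k ρ x t).smul
    ((hj.hasDerivAt.mul (hX.hasDerivAt ρ t)).mul hk.hasDerivAt.star)
  convert! h1 using 1
  have e1 : P j t * ((Complex.I * ρ) • (a t * X t ρ - X t ρ * star (a t))) * star (P k t)
      = (Complex.I * ρ * (φ j t - φ k t)) • (P j t * X t ρ * star (P k t)) := by
    have e2 : star (a t) * star (P k t) = (φ k t : ℂ) • star (P k t) := by
      rw [← star_mul, h.proj_mul, star_smul]
      simp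
    rw [mul_smul_comm, smul_mul_assoc, mul_sub, sub_mul, ← mul_assoc, h.proj_mul, mul_assoc (P j t),
      mul_assoc (X t ρ), e2, mul_smul_comm, mul_smul_comm, mul_smul (Complex.I * ρ), sub_smul]
    simp only [smul_mul_assoc, mul_assoc]
  simp only [Pi.mul_apply, blockDeriv]
  rw [add_mul, e1]
  module

variable [CompleteSpace R] [SecondCountableTopology R]

lemma stronglyMeasurable_blockDeriv (hX : RayFlow a X μ) (h : SpectralFamily a φ P B)
    (j k : ι) (x : ℝ) :
    StronglyMeasurable fun p : ℝ × ℝ => blockDeriv φ P X j k p.2 x p.1 := by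
  have h1 : StronglyMeasurable fun p : ℝ × ℝ => osc φ j k p.2 x p.1 := by
    have := h.continuous_phase j
    have := h.continuous_phase k
    apply Continuous.stronglyMeasurable
    unfold osc
    fun_prop
  have h2 : ∀ j, StronglyMeasurable fun p : ℝ × ℝ => P j p.1 := fun j =>
    (h.continuous_proj j).stronglyMeasurable.comp_measurable measurable_fst
  have h3 : ∀ j, StronglyMeasurable fun p : ℝ × ℝ => deriv (P j) p.1 := fun j =>
    (stronglyMeasurable_deriv (P j)).comp_measurable measurable_fst
  have h4 : StronglyMeasurable fun p : ℝ × ℝ => X p.1 p.2 := hX.stronglyMeasurable_uncurry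
  exact h1.smul ((((h3 j).mul h4).mul (h2 k).star).add (((h2 j).mul h4).mul (h3 k).star))

lemma block_sub_block (hX : RayFlow a X μ) (h : SpectralFamily a φ P B) (j k : ι) (ρ x s t : ℝ) :
    block φ P X j k ρ x t - block φ P X j k ρ x s
      = ∫ r in s..t, blockDeriv φ P X j k ρ x r := by
  have : FiniteDimensional ℝ R := FiniteDimensional.complexToReal R
  rw [← (hX.locallyLipschitz_block h j k ρ x).integral_deriv_eq_sub]
  refine intervalIntegral.integral_congr_ae ?_
  filter_upwards [(h.locallyLipschitz_proj j).ae_differentiableAt_real,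
    (h.locallyLipschitz_proj k).ae_differentiableAt_real] with r hj hk _
  exact (hX.hasDerivAt_block h j k ρ x hj hk).deriv

lemma norm_block (j k : ι) (ρ x t : ℝ) :
    ‖block φ P X j k ρ x t‖ = ‖P j t * X t ρ * star (P k t)‖ := by
  rw [block, norm_smul, norm_osc, one_mul]

lemma norm_le_sum_block (h : SpectralFamily a φ P B) (ρ x t : ℝ) :
    ‖X t ρ‖ ≤ ∑ j, ∑ k, ‖block φ P X j k ρ x t‖ := by
  simp only [norm_block]
  have h1 : X t ρ = ∑ j, ∑ k, P j t * X t ρ * star (P k t) := by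
    simp only [← Finset.mul_sum, ← star_sum, h.sum_proj, star_one, mul_one, ← Finset.sum_mul,
      one_mul]
  conv_lhs => rw [h1]
  exact (norm_sum_le _ _).trans (Finset.sum_le_sum fun j _ => norm_sum_le _ _)

lemma norm_block_le (h : SpectralFamily a φ P B) (j k : ι) (ρ x t : ℝ) :
    ‖block φ P X j k ρ x t‖ ≤ B ^ 2 * ‖X t ρ‖ := by
  have hB : 0 ≤ B := (norm_nonneg _).trans (h.norm_proj_le j t)
  rw [norm_block]
  calc _ ≤ ‖P j t‖ * ‖X t ρ‖ * ‖star (P k t)‖ := by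
        refine (norm_mul_le _ _).trans ?_
        gcongr
        exact norm_mul_le _ _
    _ ≤ B * ‖X t ρ‖ * B := by
        rw [norm_star]
        gcongr
        · exact h.norm_proj_le j t
        · exact h.norm_proj_le k t
    _ = _ := by ring

/-- The resolution of the identity expresses the derivative of a block through the blocks
themselves. The difference between the phases of two blocks is absorbed into a translation of `x`,
which does not depend on `ρ`. -/
lemma blockDeriv_eq (h : SpectralFamily a φ P B) (j k : ι) (ρ x t : ℝ) :
    blockDeriv φ P X j k ρ x t
      = deriv (P j) t * ∑ l, block φ P X l k ρ (x - phase φ j t + phase φ l t) t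
        + (∑ l, block φ P X j l ρ (x - phase φ l t + phase φ k t) t) * star (deriv (P k) t) := by
  have o1 : ∀ l, osc φ l k ρ (x - phase φ j t + phase φ l t) t = osc φ j k ρ x t := fun l => by
    simp only [osc]; congr 4; ring
  have o2 : ∀ l, osc φ j l ρ (x - phase φ l t + phase φ k t) t = osc φ j k ρ x t := fun l => by
    simp only [osc]; congr 4; ring
  simp only [block, blockDeriv, o1, o2, ← Finset.smul_sum]
  rw [← Finset.sum_mul, ← Finset.sum_mul, h.sum_proj, one_mul, ← Finset.mul_sum, ← star_sum,
    h.sum_proj, star_one, mul_one, smul_add, mul_smul_comm, smul_mul_assoc, mul_assoc]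

lemma enorm_blockDeriv_le (h : SpectralFamily a φ P B) (j k : ι) (ρ x y t : ℝ) :
    ‖blockDeriv φ P X j k ρ x t‖ₑ ≤ ‖deriv (P j) t‖ₑ * ∑ l, ‖block φ P X l k ρ y t‖ₑ
      + ‖deriv (P k) t‖ₑ * ∑ l, ‖block φ P X j l ρ y t‖ₑ := by
  have hb : ∀ j k z, ‖block φ P X j k ρ z t‖ₑ = ‖block φ P X j k ρ y t‖ₑ := fun j k z => by
    rw [← ofReal_norm, norm_block, ← norm_block (x := y), ofReal_norm]
  have e3 : ‖star (deriv (P k) t)‖ₑ = ‖deriv (P k) t‖ₑ := by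
    simp only [enorm, nnnorm_star]
  rw [blockDeriv_eq h]
  refine (enorm_add_le _ _).trans (add_le_add ?_ ?_)
  · refine (enorm_mul_le_mul _ _).trans ?_
    gcongr
    refine (enorm_sum_le _ _).trans (le_of_eq ?_)
    exact Finset.sum_congr rfl fun l _ => hb _ _ _
  · rw [mul_comm (‖deriv (P k) t‖ₑ), ← e3]
    refine (enorm_mul_le_mul _ _).trans ?_
    gcongr
    refine (enorm_sum_le _ _).trans (le_of_eq ?_)
    exact Finset.sum_congr rfl fun l _ => hb _ _ _

lemma sum_lintegral_deriv_le (h : SpectralFamily a φ P B) :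
    ∑ j, ∫⁻ t, ‖deriv (P j) t‖ₑ ≤ 1 / 4 :=
  le_trans (le_mul_of_one_le_left zero_le le_add_self) h.variation

/-- A frequency-independent energy estimate: the size of the solution at time `t` is controlled by
that of its initial value because the projections have small variation. -/
lemma norm_le_initial (hX : RayFlow a X μ) (h : SpectralFamily a φ P B) (t ρ : ℝ) :
    ‖X t ρ‖ ≤ 2 * (Fintype.card ι) ^ 2 * B ^ 2 * ‖X 0 ρ‖ := by
  set Z : ℝ → ℝ≥0∞ := fun s => ∑ j, ∑ k, ‖block φ P X j k ρ 0 s‖ₑ with hZ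
  have hZc : Continuous Z := by
    refine continuous_finsetSum _ fun j _ => continuous_finsetSum _ fun k _ => ?_
    exact (hX.locallyLipschitz_block h j k ρ 0).continuous.enorm
  -- At the maximum of `Z` the integrated derivative is at most half of `Z`, and is absorbed.
  obtain ⟨s, hs, hmax⟩ := isCompact_uIcc.exists_isMaxOn (⟨0, left_mem_uIcc⟩ : (uIcc 0 t).Nonempty)
    hZc.continuousOn
  have hstep : Z s ≤ Z 0 + (1 / 2) * Z s := by
    have h1 : ∀ j k, ‖block φ P X j k ρ 0 s‖ₑ ≤ ‖block φ P X j k ρ 0 0‖ₑ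
        + ∫⁻ r in uIoc 0 s, ‖blockDeriv φ P X j k ρ 0 r‖ₑ := by
      intro j k
      have := hX.block_sub_block h j k ρ 0 0 s
      rw [sub_eq_iff_eq_add'] at this
      rw [this]
      refine (enorm_add_le _ _).trans ?_
      gcongr
      exact enorm_intervalIntegral_le _ _ _
    have hmeas : ∀ j k, Measurable fun r => ‖blockDeriv φ P X j k ρ 0 r‖ₑ := fun j k =>
      ((hX.stronglyMeasurable_blockDeriv h j k 0).comp_measurable
        (measurable_id.prodMk measurable_const)).enorm
    calc Z s ≤ ∑ j, ∑ k, (‖block φ P X j k ρ 0 0‖ₑ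
        + ∫⁻ r in uIoc 0 s, ‖blockDeriv φ P X j k ρ 0 r‖ₑ) :=
          Finset.sum_le_sum fun j _ => Finset.sum_le_sum fun k _ => h1 j k
      _ = Z 0 + ∫⁻ r in uIoc 0 s, ∑ j, ∑ k, ‖blockDeriv φ P X j k ρ 0 r‖ₑ := by
          simp only [Finset.sum_add_distrib]
          rw [lintegral_finsetSum _ fun j _ => Finset.measurable_sum _ fun k _ => hmeas j k]
          congr 1
          refine Finset.sum_congr rfl fun j _ => ?_
          rw [lintegral_finsetSum _ fun k _ => hmeas j k]
      _ ≤ Z 0 + ∫⁻ r in uIoc 0 s, 2 * (∑ j, ‖deriv (P j) r‖ₑ) * Z s := by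
          gcongr 1
          refine setLIntegral_mono' measurableSet_uIoc fun r hr => ?_
          have hr' : r ∈ uIcc 0 t := uIcc_subset_uIcc left_mem_uIcc hs (uIoc_subset_uIcc hr)
          calc _ ≤ ∑ j, ∑ k, (‖deriv (P j) r‖ₑ * ∑ l, ‖block φ P X l k ρ 0 r‖ₑ
                + ‖deriv (P k) r‖ₑ * ∑ l, ‖block φ P X j l ρ 0 r‖ₑ) :=
                Finset.sum_le_sum fun j _ => Finset.sum_le_sum fun k _ =>
                  enorm_blockDeriv_le h j k ρ 0 0 r
            _ = 2 * (∑ j, ‖deriv (P j) r‖ₑ) * Z r := by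
                simp only [Finset.sum_add_distrib, ← Finset.mul_sum, ← Finset.sum_mul, hZ]
                rw [Finset.sum_comm, two_mul, add_mul]
            _ ≤ _ := by
                gcongr
                exact hmax hr'
      _ ≤ Z 0 + ∫⁻ r, 2 * (∑ j, ‖deriv (P j) r‖ₑ) * Z s := by
          gcongr 1
          exact setLIntegral_le_lintegral _ _
      _ ≤ Z 0 + (1 / 2) * Z s := by
          have hm : ∀ j, Measurable fun r => ‖deriv (P j) r‖ₑ := fun j =>
            (stronglyMeasurable_deriv (P j)).enorm
          have hm' : Measurable fun r => ∑ j, ‖deriv (P j) r‖ₑ :=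
            Finset.measurable_sum _ fun j _ => hm j
          rw [lintegral_mul_const _ (hm'.const_mul 2), lintegral_const_mul _ hm',
            lintegral_finsetSum _ fun j _ => hm j]
          gcongr
          calc _ ≤ 2 * (1 / 4 : ℝ≥0∞) := by gcongr; exact sum_lintegral_deriv_le h
            _ = 1 / 2 := by
              rw [show (4 : ℝ≥0∞) = 2 * 2 by norm_num, one_div, one_div,
                ENNReal.mul_inv (by norm_num) (by norm_num), ← mul_assoc,
                ENNReal.mul_inv_cancel (by norm_num) (by norm_num), one_mul]
  have hfin : Z s ≠ ⊤ := by simp [hZ, ENNReal.sum_eq_top]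
  have hZs : Z s ≤ 2 * Z 0 := by
    have h2 : (1 / 2) * Z s + (1 / 2) * Z s ≤ Z 0 + (1 / 2) * Z s := by
      rw [← add_mul, ENNReal.add_halves, one_mul]; exact hstep
    have h3 := (ENNReal.add_le_add_iff_right (ENNReal.mul_ne_top (by norm_num) hfin)).1 h2
    calc Z s = 2 * ((1 / 2) * Z s) := by
          rw [← mul_assoc, one_div, ENNReal.mul_inv_cancel (by norm_num) (by norm_num), one_mul]
      _ ≤ _ := by gcongr
  have hZr : ∀ r, Z r = ENNReal.ofReal (∑ j, ∑ k, ‖block φ P X j k ρ 0 r‖) := by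
    intro r
    rw [ENNReal.ofReal_sum_of_nonneg fun j _ => Finset.sum_nonneg fun k _ => norm_nonneg _]
    refine Finset.sum_congr rfl fun j _ => ?_
    rw [ENNReal.ofReal_sum_of_nonneg fun k _ => norm_nonneg _]
    simp only [ofReal_norm]
  have h4 : Z t ≤ 2 * Z 0 := (hmax right_mem_uIcc).trans hZs
  rw [hZr, hZr, show (2 : ℝ≥0∞) = ENNReal.ofReal 2 by simp, ← ENNReal.ofReal_mul (by norm_num),
    ENNReal.ofReal_le_ofReal_iff (by positivity)] at h4
  calc ‖X t ρ‖ ≤ _ := norm_le_sum_block h ρ 0 t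
    _ ≤ _ := h4
    _ ≤ 2 * ∑ _j : ι, ∑ _k : ι, B ^ 2 * ‖X 0 ρ‖ := by
        gcongr
        exact norm_block_le h _ _ _ _ _
    _ = _ := by simp; ring

end RayFlow

end Ray

/-! ### Frequency averages of the flow -/

section Average

open Set Filter Topology
open scoped NNReal

variable {R : Type*} [NormedRing R] [NormedAlgebra ℂ R] [StarRing R] [NormedStarGroup R]
  [StarModule ℂ R] [FiniteDimensional ℂ R] {ι : Type*} [Fintype ι]
  [CompleteSpace R] [SecondCountableTopology R]
  {a : ℝ → R} {φ : ι → ℝ → ℝ} {P : ι → ℝ → R} {B : ℝ} {X : ℝ → ℝ → R} {μ : Measure ℝ}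

/-- A bounded multiplier in the radial frequency, decaying at least like `1 / |ρ|`. -/
structure IsCutoff (χ : ℝ → ℂ) (C : ℝ) : Prop where
  stronglyMeasurable : StronglyMeasurable χ
  norm_le : ∀ ρ, ‖χ ρ‖ ≤ C
  norm_mul_le : ∀ ρ : ℝ, ‖χ ρ * ρ‖ ≤ C

namespace RayFlow

/-- The frequency average of a block, with one additional power of `ρ`: the power that the equation
produces when the average of `X` is differentiated in time. -/
noncomputable def blockAvg (φ : ι → ℝ → ℝ) (P : ι → ℝ → R) (X : ℝ → ℝ → R) (μ : Measure ℝ)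
    (χ : ℝ → ℂ) (j k : ι) (t x : ℝ) : R :=
  ∫ ρ, (χ ρ * ρ) • block φ P X j k ρ x t ∂μ

/-- The frequency average of `X`. -/
noncomputable def avg (X : ℝ → ℝ → R) (μ : Measure ℝ) (χ : ℝ → ℂ) (t : ℝ) : R :=
  ∫ ρ, χ ρ • X t ρ ∂μ

variable {χ : ℝ → ℂ} {C : ℝ}

lemma stronglyMeasurable_block (hX : RayFlow a X μ) (h : SpectralFamily a φ P B)
    (j k : ι) : StronglyMeasurable fun p : ℝ × ℝ × ℝ => block φ P X j k p.2.2 p.2.1 p.1 := by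
  have h1 : StronglyMeasurable fun p : ℝ × ℝ × ℝ => osc φ j k p.2.2 p.2.1 p.1 := by
    have := h.continuous_phase j
    have := h.continuous_phase k
    apply Continuous.stronglyMeasurable
    unfold osc
    fun_prop
  have h2 : ∀ j, StronglyMeasurable fun p : ℝ × ℝ × ℝ => P j p.1 := fun j =>
    (h.continuous_proj j).stronglyMeasurable.comp_measurable measurable_fst
  have h4 : StronglyMeasurable fun p : ℝ × ℝ × ℝ => X p.1 p.2.2 :=
    hX.stronglyMeasurable_uncurry.comp_measurable (g := fun p : ℝ × ℝ × ℝ => (p.1, p.2.2))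
      (by fun_prop)
  exact h1.smul (((h2 j).mul h4).mul (h2 k).star)

lemma stronglyMeasurable_cutoff (hχ : IsCutoff χ C) : StronglyMeasurable fun ρ : ℝ => χ ρ * ρ :=
  hχ.stronglyMeasurable.mul (Complex.continuous_ofReal.stronglyMeasurable)

lemma norm_cutoff_block_le (hX : RayFlow a X μ) (h : SpectralFamily a φ P B) (hχ : IsCutoff χ C)
    (j k : ι) (ρ x t : ℝ) : ‖(χ ρ * ρ) • block φ P X j k ρ x t‖
      ≤ C * (B ^ 2 * (2 * (Fintype.card ι) ^ 2 * B ^ 2)) * ‖X 0 ρ‖ := by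
  have hC : 0 ≤ C := (norm_nonneg _).trans (hχ.norm_le 0)
  rw [norm_smul]
  calc _ ≤ C * (B ^ 2 * (2 * (Fintype.card ι) ^ 2 * B ^ 2 * ‖X 0 ρ‖)) := by
        gcongr
        · exact hχ.norm_mul_le ρ
        · exact (norm_block_le h _ _ _ _ _).trans (by gcongr; exact hX.norm_le_initial h t ρ)
    _ = _ := by ring

lemma integrable_cutoff_block (hX : RayFlow a X μ) (h : SpectralFamily a φ P B)
    (hχ : IsCutoff χ C) (j k : ι) (x t : ℝ) :
    Integrable (fun ρ => (χ ρ * ρ) • block φ P X j k ρ x t) μ := by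
  refine (hX.integrable.norm.const_mul (C * (B ^ 2 * (2 * (Fintype.card ι) ^ 2 * B ^ 2)))).mono'
    ?_ (ae_of_all _ fun ρ => hX.norm_cutoff_block_le h hχ j k ρ x t)
  exact ((stronglyMeasurable_cutoff hχ).smul ((hX.stronglyMeasurable_block h j k).comp_measurable
    (g := fun ρ => (t, x, ρ)) (by fun_prop))).aestronglyMeasurable

lemma norm_blockAvg_le (hX : RayFlow a X μ) (h : SpectralFamily a φ P B) (hχ : IsCutoff χ C)
    (j k : ι) (t x : ℝ) : ‖blockAvg φ P X μ χ j k t x‖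
      ≤ C * (B ^ 2 * (2 * (Fintype.card ι) ^ 2 * B ^ 2)) * ∫ ρ, ‖X 0 ρ‖ ∂μ := by
  refine (norm_integral_le_integral_norm _).trans ?_
  rw [← integral_const_mul]
  exact integral_mono (hX.integrable_cutoff_block h hχ j k x t).norm
    (hX.integrable.norm.const_mul _) fun ρ => hX.norm_cutoff_block_le h hχ j k ρ x t

variable [SFinite μ]

lemma stronglyMeasurable_blockAvg (hX : RayFlow a X μ) (h : SpectralFamily a φ P B)
    (hχ : IsCutoff χ C) (j k : ι) :
    StronglyMeasurable fun p : ℝ × ℝ => blockAvg φ P X μ χ j k p.1 p.2 := by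
  refine StronglyMeasurable.integral_prod_right'
    (f := fun q : (ℝ × ℝ) × ℝ => (χ q.2 * q.2) • block φ P X j k q.2 q.1.2 q.1.1) ?_
  exact ((stronglyMeasurable_cutoff hχ).comp_measurable measurable_snd).smul
    ((hX.stronglyMeasurable_block h j k).comp_measurable
      (g := fun q : (ℝ × ℝ) × ℝ => (q.1.1, q.1.2, q.2)) (by fun_prop))

/-- The averaged blocks satisfy a closed Volterra inequality: since the phases enter the derivative
of a block only through translations of `x`, the integration over `ρ` can be carried out. -/
lemma enorm_blockAvg_le (hX : RayFlow a X μ) (h : SpectralFamily a φ P B) (hχ : IsCutoff χ C)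
    (j k : ι) (t x : ℝ) : ‖blockAvg φ P X μ χ j k t x‖ₑ ≤ ‖blockAvg φ P X μ χ j k 0 x‖ₑ
      + ∫⁻ s, (‖deriv (P j) s‖ₑ *
          ∑ l, ‖blockAvg φ P X μ χ l k s (x - phase φ j s + phase φ l s)‖ₑ
        + ‖deriv (P k) s‖ₑ *
          ∑ l, ‖blockAvg φ P X μ χ j l s (x - phase φ l s + phase φ k s)‖ₑ) := by
  have : FiniteDimensional ℝ R := FiniteDimensional.complexToReal R
  have hC : 0 ≤ C := (norm_nonneg _).trans (hχ.norm_le 0)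
  have hB : 0 ≤ B := (norm_nonneg _).trans (h.norm_proj_le j 0)
  have hX0 := hX.integrable
  have hsplit : ∀ s, ∫ ρ, (χ ρ * ρ) • blockDeriv φ P X j k ρ x s ∂μ
      = deriv (P j) s * ∑ l, blockAvg φ P X μ χ l k s (x - phase φ j s + phase φ l s)
        + (∑ l, blockAvg φ P X μ χ j l s (x - phase φ l s + phase φ k s))
          * star (deriv (P k) s) := by
    intro s
    have i1 : ∀ l, Integrable (fun ρ => (χ ρ * ρ) •
        block φ P X l k ρ (x - phase φ j s + phase φ l s) s) μ := fun l =>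
      hX.integrable_cutoff_block h hχ l k _ s
    have i2 : ∀ l, Integrable (fun ρ => (χ ρ * ρ) •
        block φ P X j l ρ (x - phase φ l s + phase φ k s) s) μ := fun l =>
      hX.integrable_cutoff_block h hχ j l _ s
    have e : ∀ ρ, (χ ρ * ρ) • blockDeriv φ P X j k ρ x s
        = deriv (P j) s * ∑ l, (χ ρ * ρ) • block φ P X l k ρ (x - phase φ j s + phase φ l s) s
          + (∑ l, (χ ρ * ρ) • block φ P X j l ρ (x - phase φ l s + phase φ k s) s)
            * star (deriv (P k) s) := by
      intro ρ
      rw [blockDeriv_eq h, smul_add, ← mul_smul_comm, ← smul_mul_assoc, Finset.smul_sum,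
        Finset.smul_sum]
    simp only [e]
    rw [integral_add, integral_const_mul_of_integrable, integral_mul_const_of_integrable,
      integral_finsetSum, integral_finsetSum]
    · rfl
    · exact fun l _ => i2 l
    · exact fun l _ => i1 l
    · exact integrable_finsetSum _ fun l _ => i2 l
    · exact integrable_finsetSum _ fun l _ => i1 l
    · exact (integrable_finsetSum _ fun l _ => i1 l).const_mul _
    · exact (integrable_finsetSum _ fun l _ => i2 l).mul_const _
  have hdiff : blockAvg φ P X μ χ j k t x - blockAvg φ P X μ χ j k 0 x
      = ∫ s in (0 : ℝ)..t, ∫ ρ, (χ ρ * ρ) • blockDeriv φ P X j k ρ x s ∂μ := by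
    rw [intervalIntegral_integral_swap, blockAvg, blockAvg, ← integral_sub
      (hX.integrable_cutoff_block h hχ j k x t) (hX.integrable_cutoff_block h hχ j k x 0)]
    · congr 1
      ext ρ
      rw [← smul_sub, hX.block_sub_block h, intervalIntegral.integral_smul]
    · have hP : ∀ j, IntegrableOn (fun s => ‖deriv (P j) s‖) (uIoc 0 t) := fun j =>
        ((h.locallyLipschitz_proj j).intervalIntegrable_deriv 0 t).def'.norm
      refine (((hP j).add (hP k)).mul_prod (hX0.norm.const_mul
        (C * (B * (2 * (Fintype.card ι) ^ 2 * B ^ 2))))).mono' ?_ (ae_of_all _ fun p => ?_)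
      · exact (((stronglyMeasurable_cutoff hχ).comp_measurable measurable_snd).smul
          (hX.stronglyMeasurable_blockDeriv h j k x)).aestronglyMeasurable
      · obtain ⟨s, ρ⟩ := p
        simp only [Function.uncurry, Pi.add_apply]
        have hx := hX.norm_le_initial h s ρ
        have hn : ‖blockDeriv φ P X j k ρ x s‖
            ≤ (‖deriv (P j) s‖ + ‖deriv (P k) s‖) * (B * ‖X s ρ‖) := by
          rw [blockDeriv, norm_smul, norm_osc, one_mul]
          calc _ ≤ ‖deriv (P j) s‖ * ‖X s ρ‖ * ‖star (P k s)‖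
                + ‖P j s‖ * ‖X s ρ‖ * ‖star (deriv (P k) s)‖ := by
                refine (norm_add_le _ _).trans ?_
                gcongr
                · refine (_root_.norm_mul_le _ _).trans ?_
                  gcongr
                  exact _root_.norm_mul_le _ _
                · refine (_root_.norm_mul_le _ _).trans ?_
                  gcongr
                  exact _root_.norm_mul_le _ _
            _ ≤ ‖deriv (P j) s‖ * ‖X s ρ‖ * B + B * ‖X s ρ‖ * ‖deriv (P k) s‖ := by
                rw [norm_star, norm_star]
                gcongr
                · exact h.norm_proj_le k s
                · exact h.norm_proj_le j s
            _ = _ := by ring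
        rw [norm_smul]
        calc _ ≤ C * ((‖deriv (P j) s‖ + ‖deriv (P k) s‖) *
                (B * (2 * (Fintype.card ι) ^ 2 * B ^ 2 * ‖X 0 ρ‖))) := by
              gcongr
              · exact hχ.norm_mul_le ρ
              · exact hn.trans (by gcongr)
          _ = _ := by ring
  have e3 : ∀ s, ‖star (deriv (P k) s)‖ₑ = ‖deriv (P k) s‖ₑ := fun s => by
    simp only [enorm, nnnorm_star]
  rw [sub_eq_iff_eq_add'] at hdiff
  rw [hdiff]
  refine (enorm_add_le _ _).trans ?_
  gcongr
  refine (enorm_intervalIntegral_le _ _ _).trans ((setLIntegral_le_lintegral _ _).trans ?_)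
  refine lintegral_mono fun s => ?_
  simp only [hsplit]
  refine (enorm_add_le _ _).trans (add_le_add ?_ ?_)
  · refine (enorm_mul_le_mul _ _).trans ?_
    gcongr
    exact enorm_sum_le _ _
  · rw [mul_comm (‖deriv (P k) s‖ₑ), ← e3]
    refine (enorm_mul_le_mul _ _).trans ?_
    gcongr
    exact enorm_sum_le _ _

/-- The commutator `a X - X a^*` only involves off-diagonal blocks, weighted by the differences of
the roots. -/
lemma commutator_eq (h : SpectralFamily a φ P B) (t ρ : ℝ) :
    a t * X t ρ - X t ρ * star (a t) = ∑ j, ∑ k, ((φ j t - φ k t : ℝ) : ℂ) •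
      block φ P X j k ρ (phase φ j t - phase φ k t) t := by
  have ho : ∀ j k, osc φ j k ρ (phase φ j t - phase φ k t) t = 1 := fun j k => by
    simp [osc]
  simp only [block, ho, one_smul]
  have e1 : a t = ∑ j, (φ j t : ℂ) • P j t := by
    rw [← mul_one (a t), ← h.sum_proj t, Finset.mul_sum]
    exact Finset.sum_congr rfl fun j _ => h.mul_proj j t
  have e2 : star (a t) = ∑ j, (φ j t : ℂ) • star (P j t) := by
    conv_lhs => rw [e1]
    simp [star_sum, star_smul]
  have s1 : X t ρ = ∑ k, X t ρ * star (P k t) := by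
    rw [← Finset.mul_sum, ← star_sum, h.sum_proj, star_one, mul_one]
  have s2 : X t ρ = ∑ j, P j t * X t ρ := by
    rw [← Finset.sum_mul, h.sum_proj, one_mul]
  have t1 : a t * X t ρ = ∑ j, ∑ k, (φ j t : ℂ) • (P j t * X t ρ * star (P k t)) := by
    conv_lhs => rw [e1, s1, Finset.sum_mul]
    refine Finset.sum_congr rfl fun j _ => ?_
    rw [Finset.mul_sum]
    exact Finset.sum_congr rfl fun k _ => by rw [smul_mul_assoc, mul_assoc]
  have t2 : X t ρ * star (a t) = ∑ j, ∑ k, (φ k t : ℂ) • (P j t * X t ρ * star (P k t)) := by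
    conv_lhs => rw [e2, s2, Finset.sum_mul]
    refine Finset.sum_congr rfl fun j _ => ?_
    rw [Finset.mul_sum]
    exact Finset.sum_congr rfl fun k _ => by rw [mul_smul_comm]
  rw [t1, t2, ← Finset.sum_sub_distrib]
  refine Finset.sum_congr rfl fun j _ => ?_
  rw [← Finset.sum_sub_distrib]
  exact Finset.sum_congr rfl fun k _ => by rw [← sub_smul]; push_cast; rfl

lemma integrable_cutoff (hX : RayFlow a X μ) (h : SpectralFamily a φ P B) (hχ : IsCutoff χ C)
    (t : ℝ) : Integrable (fun ρ => χ ρ • X t ρ) μ := by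
  have hC : 0 ≤ C := (norm_nonneg _).trans (hχ.norm_le 0)
  refine (hX.integrable.norm.const_mul (C * (2 * (Fintype.card ι) ^ 2 * B ^ 2))).mono'
    (hχ.stronglyMeasurable.smul (hX.stronglyMeasurable t)).aestronglyMeasurable
    (ae_of_all _ fun ρ => ?_)
  rw [norm_smul, mul_assoc]
  gcongr
  · exact hχ.norm_le ρ
  · exact hX.norm_le_initial h t ρ

/-- The time derivative of the average is a sum of averaged off-diagonal blocks, evaluated at the
point `x = θ_j - θ_k` where their phase is cancelled. -/
lemma avg_sub_avg (hX : RayFlow a X μ) (h : SpectralFamily a φ P B) (hχ : IsCutoff χ C)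
    (s t : ℝ) : avg X μ χ t - avg X μ χ s = ∫ r in s..t, Complex.I •
      ∑ j, ∑ k, ((φ j r - φ k r : ℝ) : ℂ) •
        blockAvg φ P X μ χ j k r (phase φ j r - phase φ k r) := by
  have : FiniteDimensional ℝ R := FiniteDimensional.complexToReal R
  have hC : 0 ≤ C := (norm_nonneg _).trans (hχ.norm_le 0)
  have hc := h.continuous_curve
  have hXc := hX.continuous
  set f : ℝ → ℝ → R := fun r ρ =>
    χ ρ • ((Complex.I * ρ) • (a r * X r ρ - X r ρ * star (a r))) with hf
  have hinner : ∀ r, ∫ ρ, f r ρ ∂μ = Complex.I •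
      ∑ j, ∑ k, ((φ j r - φ k r : ℝ) : ℂ) •
        blockAvg φ P X μ χ j k r (phase φ j r - phase φ k r) := by
    intro r
    have i1 : ∀ j k, Integrable (fun ρ => ((φ j r - φ k r : ℝ) : ℂ) • ((χ ρ * ρ) •
        block φ P X j k ρ (phase φ j r - phase φ k r) r)) μ := fun j k =>
      (hX.integrable_cutoff_block h hχ j k (phase φ j r - phase φ k r) r).smul
        ((φ j r - φ k r : ℝ) : ℂ)
    have e : ∀ ρ, f r ρ = Complex.I • ∑ j, ∑ k, ((φ j r - φ k r : ℝ) : ℂ) • ((χ ρ * ρ) •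
        block φ P X j k ρ (phase φ j r - phase φ k r) r) := by
      intro ρ
      simp only [hf, commutator_eq h, Finset.smul_sum, smul_smul]
      refine Finset.sum_congr rfl fun j _ => Finset.sum_congr rfl fun k _ => ?_
      congr 1
      ring
    simp only [e]
    rw [integral_smul, integral_finsetSum _ fun j _ => integrable_finsetSum _ fun k _ => i1 j k]
    congr 1
    refine Finset.sum_congr rfl fun j _ => ?_
    rw [integral_finsetSum _ fun k _ => i1 j k]
    refine Finset.sum_congr rfl fun k _ => ?_
    rw [integral_smul, blockAvg]
  obtain ⟨A, hA⟩ := (isCompact_uIcc (a := s) (b := t)).exists_bound_of_continuousOn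
    hc.continuousOn
  have hA0 : 0 ≤ A := (norm_nonneg _).trans (hA s left_mem_uIcc)
  have hint : Integrable (Function.uncurry f) ((volume.restrict (uIoc s t)).prod μ) := by
    have hconst : IntegrableOn (fun _ : ℝ => (1 : ℝ)) (uIoc s t) := by simp [uIoc]
    refine (hconst.mul_prod (hX.integrable.norm.const_mul
      (C * (2 * A * (2 * (Fintype.card ι) ^ 2 * B ^ 2))))).mono' ?_ ?_
    · have m1 : StronglyMeasurable fun p : ℝ × ℝ => a p.1 :=
        hc.stronglyMeasurable.comp_measurable measurable_fst
      have m2 : StronglyMeasurable fun p : ℝ × ℝ => X p.1 p.2 := hX.stronglyMeasurable_uncurry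
      have m3 : StronglyMeasurable fun p : ℝ × ℝ => χ p.2 :=
        hχ.stronglyMeasurable.comp_measurable measurable_snd
      have m4 : StronglyMeasurable fun p : ℝ × ℝ => Complex.I * (p.2 : ℂ) :=
        Continuous.stronglyMeasurable (by fun_prop)
      exact (m3.smul (m4.smul ((m1.mul m2).sub (m2.mul m1.star)))).aestronglyMeasurable
    · have hr : ∀ᵐ p ∂((volume.restrict (uIoc s t)).prod μ), p.1 ∈ uIoc s t :=
        Measure.quasiMeasurePreserving_fst.ae (ae_restrict_mem measurableSet_uIoc)
      filter_upwards [hr] with p hp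
      obtain ⟨r, ρ⟩ := p
      simp only [Function.uncurry, hf, one_mul]
      have hAr := hA r (uIoc_subset_uIcc hp)
      have hx := hX.norm_le_initial h r ρ
      have e0 : χ ρ • ((Complex.I * ρ) • (a r * X r ρ - X r ρ * star (a r)))
          = (Complex.I * (χ ρ * ρ)) • (a r * X r ρ - X r ρ * star (a r)) := by
        rw [smul_smul]; congr 1; ring
      rw [e0, norm_smul, norm_mul, Complex.norm_I, one_mul]
      calc _ ≤ C * (A * ‖X r ρ‖ + ‖X r ρ‖ * A) := by
            gcongr
            · exact hχ.norm_mul_le ρ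
            · refine (norm_sub_le _ _).trans (add_le_add ?_ ?_)
              · exact (_root_.norm_mul_le _ _).trans (by gcongr)
              · refine (_root_.norm_mul_le _ _).trans ?_
                rw [norm_star]
                gcongr
        _ = C * (2 * A * ‖X r ρ‖) := by ring
        _ ≤ C * (2 * A * (2 * (Fintype.card ι) ^ 2 * B ^ 2 * ‖X 0 ρ‖)) := by gcongr
        _ = _ := by ring
  simp only [← hinner]
  rw [intervalIntegral_integral_swap hint, avg, avg, ← integral_sub
    (hX.integrable_cutoff h hχ t) (hX.integrable_cutoff h hχ s)]
  congr 1
  ext ρ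
  have hd : ∀ r, HasDerivAt (fun r => χ ρ • X r ρ) (f r ρ) r := fun r =>
    (hX.hasDerivAt ρ r).const_smul (χ ρ)
  have hfc : Continuous fun r => f r ρ := by
    have := hXc ρ
    simp only [hf]
    fun_prop
  exact (intervalIntegral.integral_eq_sub_of_hasDerivAt (fun r _ => hd r)
    (hfc.intervalIntegrable _ _)).symm

/-- Total variation of the frequency average of the flow. The change of variables
`x = θ_j(t) - θ_k(t)`, which is injective because the roots do not cross, turns the time integral
into an `L¹` norm in `x`. -/
theorem eVariationOn_avg_le (hX : RayFlow a X μ) (h : SpectralFamily a φ P B)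
    (hχ : IsCutoff χ C) : eVariationOn (avg X μ χ) univ
      ≤ 2 * ∑ j, ∑ k, ∫⁻ x, ‖blockAvg φ P X μ χ j k 0 x‖ₑ := by
  have hm : ∀ j k, StronglyMeasurable fun p : ℝ × ℝ => blockAvg φ P X μ χ j k p.1 p.2 := fun j k =>
    hX.stronglyMeasurable_blockAvg h hχ j k
  obtain ⟨G, hGm, hG, hGint⟩ := exists_majorant (θ := phase φ)
    (β := fun j s => ‖deriv (P j) s‖ₑ) (fun j => (h.continuous_phase j).measurable)
    (fun j => (stronglyMeasurable_deriv (P j)).enorm) h.variation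
    (g := fun j k x => ‖blockAvg φ P X μ χ j k 0 x‖ₑ)
    (fun j k => ((hm j k).comp_measurable
      (measurable_const.prodMk measurable_id : Measurable fun x : ℝ => ((0 : ℝ), x))).enorm)
    (w := fun j k t x => ‖blockAvg φ P X μ χ j k t x‖ₑ)
    (b := ENNReal.ofReal (C * (B ^ 2 * (2 * (Fintype.card ι) ^ 2 * B ^ 2)) * ∫ ρ, ‖X 0 ρ‖ ∂μ))
    ENNReal.ofReal_ne_top
    (fun j k t x => by
      rw [← ofReal_norm]
      exact ENNReal.ofReal_le_ofReal (hX.norm_blockAvg_le h hχ j k t x))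
    (fun j k t x => hX.enorm_blockAvg_le h hχ j k t x)
  refine le_trans ?_ hGint
  have hmeas : ∀ j k, Measurable fun r => ENNReal.ofReal |φ j r - φ k r| *
      G j k (phase φ j r - phase φ k r) := by
    intro j k
    have h1 := (h.continuous_root j).measurable
    have h2 := (h.continuous_root k).measurable
    have h3 := (h.continuous_phase j).measurable
    have h4 := (h.continuous_phase k).measurable
    have h5 := (hGm j k).comp (h3.sub h4)
    exact Measurable.mul (by fun_prop) h5
  calc eVariationOn (avg X μ χ) univ
      ≤ ∫⁻ r, ∑ j, ∑ k, ENNReal.ofReal |φ j r - φ k r| *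
          G j k (phase φ j r - phase φ k r) := by
        refine eVariationOn_le_lintegral fun s t hst => ?_
        rw [edist_eq_enorm_sub, hX.avg_sub_avg h hχ]
        refine (enorm_intervalIntegral_le _ _ _).trans ?_
        rw [uIoc_of_le hst]
        refine lintegral_mono fun r => ?_
        rw [enorm_smul]
        have : ‖Complex.I‖ₑ = 1 := by rw [← ofReal_norm]; simp
        rw [this, one_mul]
        refine (enorm_sum_le _ _).trans (Finset.sum_le_sum fun j _ => ?_)
        refine (enorm_sum_le _ _).trans (Finset.sum_le_sum fun k _ => ?_)
        rw [enorm_smul]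
        gcongr
        · rw [← ofReal_norm, Complex.norm_real, Real.norm_eq_abs]
        · exact hG j k r _
    _ = ∑ j, ∑ k, ∫⁻ r, ENNReal.ofReal |φ j r - φ k r| *
          G j k (phase φ j r - phase φ k r) := by
        rw [lintegral_finsetSum _ fun j _ => Finset.measurable_sum _ fun k _ => hmeas j k]
        refine Finset.sum_congr rfl fun j _ => ?_
        rw [lintegral_finsetSum _ fun k _ => hmeas j k]
    _ ≤ ∑ j, ∑ k, ∫⁻ x, G j k x := by
        refine Finset.sum_le_sum fun j _ => Finset.sum_le_sum fun k _ => ?_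
        by_cases hjk : j = k
        · subst hjk; simp
        have hd : ∀ r, HasDerivAt (fun r => phase φ j r - phase φ k r) (φ j r - φ k r) r :=
          fun r => (h.hasDerivAt_phase j r).sub (h.hasDerivAt_phase k r)
        have hinj : Function.Injective fun r => phase φ j r - phase φ k r := by
          rcases h.root_lt j k hjk with hlt | hlt
          · exact (strictAnti_of_deriv_neg fun r => by
              rw [(hd r).deriv]; linarith [hlt r]).injective
          · exact (strictMono_of_deriv_pos fun r => by
              rw [(hd r).deriv]; linarith [hlt r]).injective
        have := lintegral_image_eq_lintegral_abs_deriv_mul MeasurableSet.univ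
          (fun r _ => (hd r).hasDerivWithinAt) hinj.injOn (G j k)
        rw [setLIntegral_univ] at this
        rw [← this]
        exact setLIntegral_le_lintegral _ _

end RayFlow

end Average

/-! ### Mollification in `L¹` -/

section Mollify

open Set Filter Topology
open scoped NNReal

variable {E : Type*} [NormedAddCommGroup E]

/-- Continuity of translations in `L¹(ℝ)`. -/
lemma tendsto_lintegral_translate_sub {F : ℝ → E} (hF : Integrable F) :
    Tendsto (fun u => ∫⁻ x, ‖F (x - u) - F x‖ₑ) (𝓝 0) (𝓝 0) := by
  have hL : MemLp F 1 := memLp_one_iff_integrable.2 hF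
  have : Fact ((1 : ℝ≥0∞) ≠ ⊤) := ⟨ENNReal.one_ne_top⟩
  have hc : Continuous fun u : ℝ => DomAddAct.mk (-u) +ᵥ hL.toLp F := by
    have : Continuous fun u : ℝ => DomAddAct.mk (-u) :=
      DomAddAct.continuous_mk.comp continuous_neg
    exact this.vadd continuous_const
  have h1 := (hc.tendsto 0).edist (tendsto_const_nhds (x := hL.toLp F))
  simp only [neg_zero, DomAddAct.mk_zero, zero_vadd, edist_self] at h1
  refine h1.congr fun u => ?_
  rw [DomAddAct.mk_vadd_toLp, Lp.edist_toLp_toLp, eLpNorm_one_eq_lintegral_enorm]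
  refine lintegral_congr fun x => ?_
  simp only [Pi.sub_apply, vadd_eq_add]
  rw [neg_add_eq_sub]

variable [NormedSpace ℝ E]

/-- The mollification of `F` by a normalized bump function. -/
noncomputable def mollify (f : ContDiffBump (0 : ℝ)) (F : ℝ → E) (x : ℝ) : E :=
  ∫ τ, f.normed volume (x - τ) • F τ

lemma aestronglyMeasurable_mollify (f : ContDiffBump (0 : ℝ)) {F : ℝ → E} (hF : Integrable F) :
    AEStronglyMeasurable (mollify f F) := by
  refine AEStronglyMeasurable.integral_prod_right'
    (f := fun p : ℝ × ℝ => f.normed volume (p.1 - p.2) • F p.2) ?_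
  refine AEStronglyMeasurable.smul ?_ hF.1.comp_snd
  have : Continuous (f.normed volume) := f.continuous_normed
  exact Continuous.aestronglyMeasurable (by fun_prop)

lemma lintegral_mollify_sub_le [CompleteSpace E] (f : ContDiffBump (0 : ℝ)) {F : ℝ → E}
    (hF : Integrable F) {c : ℝ≥0∞} (hc : ∀ u, |u| < f.rOut → ∫⁻ x, ‖F (x - u) - F x‖ₑ ≤ c) :
    ∫⁻ x, ‖mollify f F x - F x‖ₑ ≤ c := by
  have hfc : Continuous (f.normed volume) := f.continuous_normed
  have hG := hF.1.ae_eq_mk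
  set G := hF.1.mk F with hGdef
  have hGm : StronglyMeasurable G := hF.1.stronglyMeasurable_mk
  have hGi : Integrable G := hF.congr hG
  have hmol : ∀ x, mollify f F x = mollify f G x := fun x => by
    refine integral_congr_ae ?_
    filter_upwards [hG] with τ hτ
    rw [hτ]
  have hc' : ∀ u, |u| < f.rOut → ∫⁻ x, ‖G (x - u) - G x‖ₑ ≤ c := by
    intro u hu
    refine le_trans (le_of_eq (lintegral_congr_ae ?_)) (hc u hu)
    have h2 : ∀ᵐ x, F (x - u) = G (x - u) :=
      (measurePreserving_sub_right volume u).quasiMeasurePreserving.ae hG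
    filter_upwards [hG, h2] with x h1 h2
    rw [h1, h2]
  have hkey : ∀ x, ‖mollify f G x - G x‖ₑ
      ≤ ∫⁻ u, ‖f.normed volume u‖ₑ * ‖G (x - u) - G x‖ₑ := by
    intro x
    have hbd : ∃ C, ∀ u, ‖f.normed volume u‖ ≤ C := by
      obtain ⟨C, hC⟩ := hfc.bounded_above_of_compact_support f.hasCompactSupport_normed
      exact ⟨C, hC⟩
    obtain ⟨C, hC⟩ := hbd
    have e1 : mollify f G x = ∫ u, f.normed volume u • G (x - u) := by
      rw [mollify, ← integral_sub_left_eq_self _ volume x]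
      simp
    have i1 : Integrable fun u => f.normed volume u • G (x - u) :=
      (hGi.comp_sub_left x).bdd_smul C hfc.aestronglyMeasurable (ae_of_all _ hC)
    have i2 : Integrable fun u => f.normed volume u • G x :=
      (hfc.integrable_of_hasCompactSupport f.hasCompactSupport_normed).smul_const _
    have e2 : G x = ∫ u, f.normed volume u • G x := by
      rw [integral_smul_const, f.integral_normed, one_smul]
    rw [e1]
    conv_lhs => rw [e2]
    rw [← integral_sub i1 i2]
    refine (enorm_integral_le_lintegral_enorm _).trans (le_of_eq ?_)
    refine lintegral_congr fun u => ?_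
    rw [← smul_sub, enorm_smul]
  calc ∫⁻ x, ‖mollify f F x - F x‖ₑ = ∫⁻ x, ‖mollify f G x - G x‖ₑ := by
        refine lintegral_congr_ae ?_
        filter_upwards [hG] with x hx
        rw [hmol, hx]
    _ ≤ ∫⁻ x, ∫⁻ u, ‖f.normed volume u‖ₑ * ‖G (x - u) - G x‖ₑ := lintegral_mono hkey
    _ = ∫⁻ u, ∫⁻ x, ‖f.normed volume u‖ₑ * ‖G (x - u) - G x‖ₑ := by
        refine lintegral_lintegral_swap (Measurable.aemeasurable ?_)
        have m1 : Measurable fun p : ℝ × ℝ => ‖f.normed volume p.2‖ₑ :=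
          hfc.measurable.enorm.comp measurable_snd
        have m2 : StronglyMeasurable fun p : ℝ × ℝ => G (p.1 - p.2) - G p.1 :=
          (hGm.comp_measurable (measurable_fst.sub measurable_snd)).sub
            (hGm.comp_measurable measurable_fst)
        exact m1.mul m2.enorm
    _ ≤ ∫⁻ u, ‖f.normed volume u‖ₑ * c := by
        refine lintegral_mono fun u => ?_
        rw [lintegral_const_mul' _ _ enorm_ne_top]
        by_cases hu : |u| < f.rOut
        · gcongr
          exact hc' u hu
        · have : f.normed volume u = 0 := by
            rw [← Function.notMem_support, f.support_normed_eq, Metric.mem_ball, dist_zero_right]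
            exact hu
          simp [this]
    _ = c := by
        have h1 : ∫⁻ u, ‖f.normed volume u‖ₑ = 1 := by
          have : ∀ u, ‖f.normed volume u‖ₑ = ENNReal.ofReal (f.normed volume u) := fun u =>
            Real.enorm_of_nonneg (f.nonneg_normed u)
          simp only [this]
          rw [← ofReal_integral_eq_lintegral_ofReal
            (hfc.integrable_of_hasCompactSupport f.hasCompactSupport_normed)
            (ae_of_all _ f.nonneg_normed), f.integral_normed, ENNReal.ofReal_one]
        rw [lintegral_mul_const _ hfc.measurable.enorm, h1, one_mul]

lemma tendsto_lintegral_mollify_sub [CompleteSpace E] {f : ℕ → ContDiffBump (0 : ℝ)}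
    (hf : Tendsto (fun N => (f N).rOut) atTop (𝓝 0)) {F : ℝ → E} (hF : Integrable F) :
    Tendsto (fun N => ∫⁻ x, ‖mollify (f N) F x - F x‖ₑ) atTop (𝓝 0) := by
  rw [ENNReal.tendsto_nhds_zero]
  intro ε hε
  have h1 := ENNReal.tendsto_nhds_zero.1 (tendsto_lintegral_translate_sub hF) ε hε
  obtain ⟨δ, hδ, h2⟩ := Metric.eventually_nhds_iff.1 h1
  filter_upwards [hf.eventually_lt_const hδ] with N hN
  refine lintegral_mollify_sub_le (f N) hF fun u hu => h2 ?_
  rw [dist_zero_right]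
  exact lt_trans hu hN

/-- The Fourier transform of a normalized bump function, as a multiplier. -/
noncomputable def bumpCutoff (f : ContDiffBump (0 : ℝ)) (ρ : ℝ) : ℂ :=
  ∫ u : ℝ, Complex.exp (-(Complex.I * u * ρ)) * (f.normed volume u : ℂ)

lemma integral_exp_mul_bump (f : ContDiffBump (0 : ℝ)) (ρ x : ℝ) :
    ∫ τ : ℝ, Complex.exp (Complex.I * τ * ρ) * (f.normed volume (x - τ) : ℂ)
      = Complex.exp (Complex.I * (ρ * x : ℝ)) * bumpCutoff f ρ := by
  rw [bumpCutoff, ← integral_const_mul, ← integral_sub_left_eq_self _ volume x]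
  congr 1
  ext u
  rw [← mul_assoc, ← Complex.exp_add]
  simp only [sub_sub_cancel]
  congr 2
  push_cast
  ring

lemma exists_isCutoff_bumpCutoff (f : ContDiffBump (0 : ℝ)) :
    ∃ C, IsCutoff (bumpCutoff f) C := by
  have hs : HasCompactSupport fun u => (f.normed volume u : ℂ) :=
    f.hasCompactSupport_normed.comp_left (g := fun r : ℝ => (r : ℂ)) rfl
  have hd : ContDiff ℝ (⊤ : ℕ∞) fun u => (f.normed volume u : ℂ) :=
    Complex.ofRealCLM.contDiff.comp f.contDiff_normed
  set g : 𝓢(ℝ, ℂ) := hs.toSchwartzMap hd with hg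
  have he : ∀ ρ, bumpCutoff f ρ = (𝓕 g) ((2 * Real.pi)⁻¹ * ρ) := by
    intro ρ
    rw [SchwartzMap.fourier_coe, Real.fourier_eq', bumpCutoff]
    congr 1
    ext u
    rw [smul_eq_mul]
    congr 2
    have : (Real.pi : ℂ) ≠ 0 := by exact_mod_cast Real.pi_ne_zero
    simp only [RCLike.inner_apply, conj_trivial]
    push_cast
    field_simp
  obtain ⟨C0, hC0, h0⟩ := (𝓕 g).decay 0 0
  obtain ⟨C1, hC1, h1⟩ := (𝓕 g).decay 1 0
  refine ⟨max C0 (2 * Real.pi * C1), ?_, fun ρ => ?_, fun ρ => ?_⟩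
  · rw [funext he]
    exact ((𝓕 g).continuous.comp (by fun_prop)).stronglyMeasurable
  · have := h0 ((2 * Real.pi)⁻¹ * ρ)
    simp only [pow_zero, one_mul, norm_iteratedFDeriv_zero] at this
    rw [he]
    exact this.trans (le_max_left _ _)
  · have := h1 ((2 * Real.pi)⁻¹ * ρ)
    simp only [pow_one, norm_iteratedFDeriv_zero] at this
    refine le_trans ?_ (le_max_right _ _)
    rw [he, norm_mul, Complex.norm_real]
    have h2 : ‖ρ‖ = 2 * Real.pi * ‖(2 * Real.pi)⁻¹ * ρ‖ := by
      rw [norm_mul, norm_inv, Real.norm_of_nonneg Real.two_pi_pos.le]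
      field_simp
    rw [h2]
    calc _ = 2 * Real.pi * (‖(2 * Real.pi)⁻¹ * ρ‖ * ‖(𝓕 g) ((2 * Real.pi)⁻¹ * ρ)‖) := by ring
      _ ≤ _ := by gcongr

lemma norm_bumpCutoff_le (f : ContDiffBump (0 : ℝ)) (ρ : ℝ) : ‖bumpCutoff f ρ‖ ≤ 1 := by
  refine (norm_integral_le_integral_norm _).trans (le_of_eq ?_)
  rw [← f.integral_normed (μ := volume)]
  congr 1
  ext u
  rw [norm_mul, Complex.norm_real, Real.norm_of_nonneg (f.nonneg_normed u),
    show -(Complex.I * u * ρ) = ((-(u * ρ) : ℝ) : ℂ) * Complex.I by push_cast; ring,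
    Complex.norm_exp_ofReal_mul_I, one_mul]

lemma tendsto_bumpCutoff {f : ℕ → ContDiffBump (0 : ℝ)}
    (hf : Tendsto (fun N => (f N).rOut) atTop (𝓝 0)) (ρ : ℝ) :
    Tendsto (fun N => bumpCutoff (f N) ρ) atTop (𝓝 1) := by
  have := ContDiffBump.convolution_tendsto_right_of_continuous (μ := volume) hf
    (g := fun u : ℝ => Complex.exp (Complex.I * u * ρ)) (by fun_prop) 0
  simp only [Complex.ofReal_zero, mul_zero, zero_mul, Complex.exp_zero] at this
  refine this.congr fun N => ?_
  rw [convolution, bumpCutoff]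
  congr 1
  ext u
  simp only [zero_sub, ContinuousLinearMap.lsmul_apply, Complex.real_smul]
  rw [mul_comm]
  congr 2
  push_cast
  ring

end Mollify

/-! ### Variation over disjoint intervals and limits in variation -/

section Variation

open Set Filter Topology AbsolutelyContinuousOnInterval
open scoped NNReal

/-- The increments over a finite family of disjoint intervals, in no particular order, are bounded
by the total variation. The proof removes the interval with the largest left endpoint. -/
lemma sum_edist_le_eVariationOn {E : Type*} [PseudoEMetricSpace E] (f : ℝ → E) {ι : Type*}
    (s : Finset ι) (I : ι → ℝ × ℝ)
    (hd : (s : Set ι).PairwiseDisjoint fun i => uIoc (I i).1 (I i).2) :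
    ∑ i ∈ s, edist (f (I i).1) (f (I i).2) ≤ eVariationOn f univ := by
  classical
  suffices H : ∀ c, (∀ i ∈ s, max (I i).1 (I i).2 ≤ c) →
      ∑ i ∈ s, edist (f (I i).1) (f (I i).2) ≤ eVariationOn f (Iic c) by
    obtain ⟨c, hc⟩ := (s.image fun i => max (I i).1 (I i).2).exists_le
    exact (H c fun i hi => hc _ (Finset.mem_image_of_mem _ hi)).trans
      (eVariationOn.mono f (subset_univ _))
  induction s using Finset.induction_on_max_value (f := fun i => min (I i).1 (I i).2) with
  | empty => simp
  | insert i s hi hmax ih =>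
    intro c hc
    have hd' := hd.subset (by simp : (s : Set ι) ⊆ (insert i s : Finset ι))
    rw [Finset.sum_insert hi]
    have hci := hc i (Finset.mem_insert_self _ _)
    rcases eq_or_ne (I i).1 (I i).2 with heq | hne
    · rw [heq, edist_self, zero_add]
      exact ih hd' c fun k hk => hc k (Finset.mem_insert_of_mem hk)
    · have hlt : min (I i).1 (I i).2 < max (I i).1 (I i).2 := min_lt_max.2 hne
      have h1 : ∑ k ∈ s, edist (f (I k).1) (f (I k).2)
          ≤ eVariationOn f (Iic (min (I i).1 (I i).2)) := by
        refine ih hd' _ fun k hk => ?_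
        by_contra! hcon
        have hki : k ≠ i := fun h => hi (h ▸ hk)
        have hdis := hd (by simp [hk] : k ∈ ((insert i s : Finset ι) : Set ι)) (by simp) hki
        have hm := hmax k hk
        -- a point slightly to the right of both left endpoints
        refine Set.disjoint_left.1 hdis
          (show min (max (I k).1 (I k).2) (max (I i).1 (I i).2) ∈ _ from ?_) ?_
        · exact ⟨lt_min (hm.trans_lt hcon) (hm.trans_lt hlt), min_le_left _ _⟩
        · exact ⟨lt_min hcon hlt, min_le_right _ _⟩
      have h2 : edist (f (I i).1) (f (I i).2)
          ≤ eVariationOn f (Icc (min (I i).1 (I i).2) c) := by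
        refine eVariationOn.edist_le f ?_ ?_
        · exact ⟨min_le_left _ _, (le_max_left _ _).trans hci⟩
        · exact ⟨min_le_right _ _, (le_max_right _ _).trans hci⟩
      calc _ ≤ eVariationOn f (Icc (min (I i).1 (I i).2) c)
            + eVariationOn f (Iic (min (I i).1 (I i).2)) := add_le_add h2 h1
        _ = eVariationOn f (Iic (min (I i).1 (I i).2))
            + eVariationOn f (Icc (min (I i).1 (I i).2) c) := add_comm _ _
        _ ≤ eVariationOn f (Iic (min (I i).1 (I i).2) ∪ Icc (min (I i).1 (I i).2) c) :=
            eVariationOn.add_le_union f fun x hx y hy => le_trans hx hy.1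
        _ ≤ _ := eVariationOn.mono f (union_subset
            (Iic_subset_Iic.2 (hlt.le.trans hci)) fun y hy => hy.2)

lemma sum_dist_le_eVariationOn {E : Type*} [PseudoMetricSpace E] {f : ℝ → E} {a b : ℝ}
    {J : ℕ × (ℕ → ℝ × ℝ)} (hJ : J ∈ disjWithin a b) :
    ENNReal.ofReal (∑ i ∈ Finset.range J.1, dist (f (J.2 i).1) (f (J.2 i).2))
      ≤ eVariationOn f univ := by
  rw [ENNReal.ofReal_sum_of_nonneg fun _ _ => dist_nonneg]
  simp only [← edist_dist]
  exact sum_edist_le_eVariationOn f _ _ hJ.2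

/-- Total variation is lower semicontinuous under pointwise convergence. -/
lemma eVariationOn_le_of_tendsto {E : Type*} [PseudoEMetricSpace E] {f : ℝ → E} {g : ℕ → ℝ → E}
    {c : ℕ → ℝ≥0∞} {c₀ : ℝ≥0∞} (hg : ∀ t, Tendsto (fun N => g N t) atTop (𝓝 (f t)))
    (hc : ∀ N, eVariationOn (g N) univ ≤ c N) (hlim : Tendsto c atTop (𝓝 c₀)) :
    eVariationOn f univ ≤ c₀ := by
  refine le_of_forall_lt_imp_le_of_dense fun v hv => ge_of_tendsto hlim ?_
  filter_upwards [eVariationOn.lowerSemicontinuous_aux (fun t _ => hg t) hv] with N hN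
  exact hN.le.trans (hc N)

/-- Limits in total variation of absolutely continuous functions are absolutely continuous. -/
lemma absolutelyContinuousOnInterval_of_eVariationOn {E : Type*} [NormedAddCommGroup E]
    {f : ℝ → E} {g : ℕ → ℝ → E} {a b : ℝ}
    (hg : ∀ N, AbsolutelyContinuousOnInterval (g N) a b)
    (hlim : Tendsto (fun N => eVariationOn (fun t => g N t - f t) univ) atTop (𝓝 0)) :
    AbsolutelyContinuousOnInterval f a b := by
  rw [absolutelyContinuousOnInterval_iff]
  intro ε hε
  obtain ⟨N, hN⟩ := (hlim.eventually_lt_const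
    (show (0 : ℝ≥0∞) < ENNReal.ofReal (ε / 2) by simpa using hε)).exists
  obtain ⟨δ, hδ, h1⟩ := (absolutelyContinuousOnInterval_iff _ _ _).1 (hg N) (ε / 2) (by linarith)
  refine ⟨δ, hδ, fun J hJ hlen => ?_⟩
  have h2 := h1 J hJ hlen
  have h3 := (sum_dist_le_eVariationOn (f := fun t => g N t - f t) hJ).trans_lt hN
  rw [ENNReal.ofReal_lt_ofReal_iff (by linarith)] at h3
  calc ∑ i ∈ Finset.range J.1, dist (f (J.2 i).1) (f (J.2 i).2)
      ≤ ∑ i ∈ Finset.range J.1, (dist (g N (J.2 i).1) (g N (J.2 i).2)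
          + dist (g N (J.2 i).1 - f (J.2 i).1) (g N (J.2 i).2 - f (J.2 i).2)) := by
        refine Finset.sum_le_sum fun i _ => ?_
        simp only [dist_eq_norm]
        refine le_trans (le_of_eq ?_) (norm_sub_le _ _)
        congr 1
        abel
    _ < ε := by rw [Finset.sum_add_distrib]; linarith

end Variation

/-! ### Variation of the unregularized quadratic quantity along a ray -/

section RayLimit

open Set Filter Topology
open scoped NNReal

variable {R : Type*} [NormedRing R] [NormedAlgebra ℂ R] [StarRing R] [NormedStarGroup R]
  [StarModule ℂ R] [FiniteDimensional ℂ R] {ι : Type*} [Fintype ι]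
  [CompleteSpace R] [SecondCountableTopology R]
  {a : ℝ → R} {φ : ι → ℝ → ℝ} {P : ι → ℝ → R} {B : ℝ} {X : ℝ → ℝ → R} {μ : Measure ℝ}
  [SFinite μ] {χ : ℝ → ℂ} {C : ℝ}

namespace RayFlow

/-- The Fourier integral of the initial value on the ray. -/
noncomputable def initialTransform (X : ℝ → ℝ → R) (μ : Measure ℝ) (χ : ℝ → ℂ) (x : ℝ) : R :=
  ∫ ρ : ℝ, (χ ρ * ρ * Complex.exp (Complex.I * (ρ * x : ℝ))) • X 0 ρ ∂μ

lemma integrable_initialTransform (hX : RayFlow a X μ) (hχ : IsCutoff χ C) (x : ℝ) :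
    Integrable (fun ρ : ℝ => (χ ρ * ρ * Complex.exp (Complex.I * (ρ * x : ℝ))) • X 0 ρ) μ := by
  have hC : 0 ≤ C := (norm_nonneg _).trans (hχ.norm_le 0)
  refine (hX.integrable.norm.const_mul C).mono' ?_ (ae_of_all _ fun ρ => ?_)
  · refine StronglyMeasurable.aestronglyMeasurable ?_
    refine ((stronglyMeasurable_cutoff hχ).mul ?_).smul (hX.stronglyMeasurable 0)
    exact Continuous.stronglyMeasurable (by fun_prop)
  · rw [norm_smul, norm_mul, mul_comm Complex.I, Complex.norm_exp_ofReal_mul_I, mul_one]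
    gcongr
    exact hχ.norm_mul_le ρ

lemma blockAvg_zero (hX : RayFlow a X μ) (hχ : IsCutoff χ C) (j k : ι) (x : ℝ) :
    blockAvg φ P X μ χ j k 0 x = P j 0 * initialTransform X μ χ x * star (P k 0) := by
  have hi := hX.integrable_initialTransform hχ x
  rw [initialTransform, ← integral_const_mul_of_integrable hi,
    ← integral_mul_const_of_integrable (hi.const_mul _), blockAvg]
  congr 1
  ext ρ
  simp only [block, osc, phase_zero, sub_zero, add_zero]
  rw [smul_smul, mul_smul_comm, smul_mul_assoc]

lemma eVariationOn_avg_le_initialTransform (hX : RayFlow a X μ) (h : SpectralFamily a φ P B)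
    (hχ : IsCutoff χ C) : eVariationOn (avg X μ χ) univ
      ≤ ENNReal.ofReal (2 * (Fintype.card ι) ^ 2 * B ^ 2) *
        ∫⁻ x, ‖initialTransform X μ χ x‖ₑ := by
  rcases isEmpty_or_nonempty ι with hι | ⟨⟨j₀⟩⟩
  · simpa using hX.eVariationOn_avg_le h hχ
  have hB : 0 ≤ B := (norm_nonneg _).trans (h.norm_proj_le j₀ 0)
  refine (hX.eVariationOn_avg_le h hχ).trans ?_
  have h1 : ∀ j k x, ‖blockAvg φ P X μ χ j k 0 x‖ₑ
      ≤ ENNReal.ofReal (B ^ 2) * ‖initialTransform X μ χ x‖ₑ := by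
    intro j k x
    rw [hX.blockAvg_zero hχ, ← ofReal_norm, ← ofReal_norm, ← ENNReal.ofReal_mul (by positivity)]
    refine ENNReal.ofReal_le_ofReal ?_
    calc _ ≤ ‖P j 0‖ * ‖initialTransform X μ χ x‖ * ‖star (P k 0)‖ := by
          refine (_root_.norm_mul_le _ _).trans ?_
          gcongr
          exact _root_.norm_mul_le _ _
      _ ≤ B * ‖initialTransform X μ χ x‖ * B := by
          rw [norm_star]
          gcongr
          · exact h.norm_proj_le j 0
          · exact h.norm_proj_le k 0
      _ = _ := by ring
  calc _ ≤ 2 * ∑ _j : ι, ∑ _k : ι,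
        (ENNReal.ofReal (B ^ 2) * ∫⁻ x, ‖initialTransform X μ χ x‖ₑ) := by
        gcongr with j _ k _
        rw [← lintegral_const_mul' _ _ ENNReal.ofReal_ne_top]
        exact lintegral_mono fun x => h1 j k x
    _ = _ := by
        simp only [Finset.sum_const, Finset.card_univ, nsmul_eq_mul]
        rw [ENNReal.ofReal_mul (by positivity), ENNReal.ofReal_mul (by norm_num),
          ENNReal.ofReal_pow (by positivity), ENNReal.ofReal_pow (by positivity),
          ENNReal.ofReal_natCast, ENNReal.ofReal_ofNat]
        ring

lemma absolutelyContinuousOnInterval_avg (hX : RayFlow a X μ) (h : SpectralFamily a φ P B)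
    (hχ : IsCutoff χ C) (s t : ℝ) : AbsolutelyContinuousOnInterval (avg X μ χ) s t := by
  set D : ℝ := C * (B ^ 2 * (2 * (Fintype.card ι) ^ 2 * B ^ 2)) * ∫ ρ, ‖X 0 ρ‖ ∂μ with hD
  have hC : 0 ≤ C := (norm_nonneg _).trans (hχ.norm_le 0)
  have hD0 : 0 ≤ D := by positivity
  have hc : Continuous fun r => ∑ j, ∑ k, |φ j r - φ k r| * D := by
    have := h.continuous_root
    fun_prop
  obtain ⟨A, hA⟩ := (isCompact_uIcc (a := s) (b := t)).exists_bound_of_continuousOn hc.continuousOn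
  have hA0 : 0 ≤ A := (norm_nonneg _).trans (hA s left_mem_uIcc)
  refine LipschitzOnWith.absolutelyContinuousOnInterval (K := ⟨A, hA0⟩) ?_
  refine LipschitzOnWith.of_dist_le_mul fun x hx y hy => ?_
  rw [dist_eq_norm, hX.avg_sub_avg h hχ, Real.dist_eq]
  refine intervalIntegral.norm_integral_le_of_norm_le_const fun r hr => ?_
  have hr' : r ∈ uIcc s t := uIcc_subset_uIcc hy hx (uIoc_subset_uIcc hr)
  refine le_trans ?_ ((le_abs_self _).trans (hA r hr'))
  rw [norm_smul, Complex.norm_I, one_mul]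
  refine (norm_sum_le _ _).trans (Finset.sum_le_sum fun j _ => ?_)
  refine (norm_sum_le _ _).trans (Finset.sum_le_sum fun k _ => ?_)
  rw [norm_smul, Complex.norm_real, Real.norm_eq_abs]
  gcongr
  exact hX.norm_blockAvg_le h hχ j k _ _

lemma _root_.KirchhoffSystem.IsCutoff.sub {χ χ' : ℝ → ℂ} {C C' : ℝ} (hχ : IsCutoff χ C)
    (hχ' : IsCutoff χ' C') :
    IsCutoff (fun ρ => χ ρ - χ' ρ) (C + C') where
  stronglyMeasurable := hχ.stronglyMeasurable.sub hχ'.stronglyMeasurable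
  norm_le ρ := (norm_sub_le _ _).trans (add_le_add (hχ.norm_le ρ) (hχ'.norm_le ρ))
  norm_mul_le ρ := by
    rw [sub_mul]
    exact (norm_sub_le _ _).trans (add_le_add (hχ.norm_mul_le ρ) (hχ'.norm_mul_le ρ))

/-- If the Fourier transform of the initial value on the ray, weighted by `ρ`, is an integrable
function `F`, then `t ↦ ∫ X t ρ dμ(ρ)` is absolutely continuous, with total variation bounded by
the `L¹` norm of `F`. The frequencies are cut off by transforms of bump functions, which amounts to
mollifying `F`; the regularized functions then converge in variation. -/
theorem variation_integral (hX : RayFlow a X μ) (h : SpectralFamily a φ P B) {F : ℝ → R}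
    (hF : Integrable F)
    (hid : ∀ (f : ContDiffBump (0 : ℝ)) (x : ℝ),
      initialTransform X μ (bumpCutoff f) x = mollify f F x) :
    eVariationOn (fun t => ∫ ρ, X t ρ ∂μ) univ
        ≤ ENNReal.ofReal (2 * (Fintype.card ι) ^ 2 * B ^ 2) * ∫⁻ x, ‖F x‖ₑ ∧
      ∀ s t, AbsolutelyContinuousOnInterval (fun t => ∫ ρ, X t ρ ∂μ) s t := by
  set D : ℝ≥0∞ := ENNReal.ofReal (2 * (Fintype.card ι) ^ 2 * B ^ 2) with hD
  have hDtop : D ≠ ⊤ := ENNReal.ofReal_ne_top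
  obtain ⟨f, hf⟩ : ∃ f : ℕ → ContDiffBump (0 : ℝ), Tendsto (fun N => (f N).rOut) atTop (𝓝 0) := by
    refine ⟨fun N => ⟨1 / (N + 1) / 2, 1 / (N + 1), by positivity, ?_⟩, ?_⟩
    · have : (0 : ℝ) < 1 / (N + 1) := by positivity
      linarith
    · exact tendsto_one_div_add_atTop_nhds_zero_nat
  have hcut := fun N => exists_isCutoff_bumpCutoff (f N)
  choose C hC using hcut
  set e : ℕ → ℝ≥0∞ := fun N => ∫⁻ x, ‖mollify (f N) F x - F x‖ₑ with he
  have helim : Tendsto e atTop (𝓝 0) := tendsto_lintegral_mollify_sub hf hF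
  have hmeas := fun N => (aestronglyMeasurable_mollify (f N) hF)
  have hpt : ∀ t, Tendsto (fun N => avg X μ (bumpCutoff (f N)) t) atTop (𝓝 (∫ ρ, X t ρ ∂μ)) := by
    intro t
    have hXt : Integrable (X t) μ :=
      (hX.integrable.norm.const_mul (2 * (Fintype.card ι) ^ 2 * B ^ 2)).mono'
        (hX.stronglyMeasurable t).aestronglyMeasurable
        (ae_of_all _ fun ρ => hX.norm_le_initial h t ρ)
    refine tendsto_integral_of_dominated_convergence (fun ρ => ‖X t ρ‖)
      (fun N => ((hC N).stronglyMeasurable.smul (hX.stronglyMeasurable t)).aestronglyMeasurable)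
      hXt.norm (fun N => ae_of_all _ fun ρ => ?_) (ae_of_all _ fun ρ => ?_)
    · rw [norm_smul]
      exact mul_le_of_le_one_left (norm_nonneg _) (norm_bumpCutoff_le _ _)
    · simpa using (tendsto_bumpCutoff hf ρ).smul_const (X t ρ)
  -- The regularized functions form a Cauchy sequence in variation; the limit `M → ∞` is taken by
  -- lower semicontinuity.
  have hdiff : ∀ N M, eVariationOn
      (fun t => avg X μ (bumpCutoff (f N)) t - avg X μ (bumpCutoff (f M)) t) univ
        ≤ D * (e N + e M) := by
    intro N M
    have e1 : (fun t => avg X μ (bumpCutoff (f N)) t - avg X μ (bumpCutoff (f M)) t)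
        = avg X μ (fun ρ => bumpCutoff (f N) ρ - bumpCutoff (f M) ρ) := by
      ext1 t
      rw [avg, avg, avg, ← integral_sub (hX.integrable_cutoff h (hC N) t)
        (hX.integrable_cutoff h (hC M) t)]
      simp only [sub_smul]
    rw [e1]
    refine (hX.eVariationOn_avg_le_initialTransform h ((hC N).sub (hC M))).trans ?_
    gcongr
    calc _ = ∫⁻ x, ‖mollify (f N) F x - mollify (f M) F x‖ₑ := by
          refine lintegral_congr fun x => ?_
          rw [← hid, ← hid, initialTransform, initialTransform, initialTransform,
            ← integral_sub (hX.integrable_initialTransform (hC N) x)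
              (hX.integrable_initialTransform (hC M) x)]
          simp only [← sub_smul, ← sub_mul]
      _ ≤ ∫⁻ x, (‖mollify (f N) F x - F x‖ₑ + ‖mollify (f M) F x - F x‖ₑ) := by
          refine lintegral_mono fun x => ?_
          have : mollify (f N) F x - mollify (f M) F x
              = (mollify (f N) F x - F x) - (mollify (f M) F x - F x) := by abel
          rw [this]
          exact enorm_sub_le
      _ = e N + e M := lintegral_add_left' ((hmeas N).sub hF.1).enorm _
  have hN : ∀ N, eVariationOn (fun t => avg X μ (bumpCutoff (f N)) t - ∫ ρ, X t ρ ∂μ) univ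
      ≤ D * e N := by
    intro N
    refine eVariationOn_le_of_tendsto (fun t => tendsto_const_nhds.sub (hpt t)) (hdiff N) ?_
    have := ENNReal.Tendsto.const_mul (a := D) (tendsto_const_nhds (x := e N) |>.add helim)
      (Or.inr hDtop)
    simpa using this
  refine ⟨?_, fun s t => absolutelyContinuousOnInterval_of_eVariationOn
    (fun N => hX.absolutelyContinuousOnInterval_avg h (hC N) s t) ?_⟩
  · refine eVariationOn_le_of_tendsto (c := fun N => D * ((∫⁻ x, ‖F x‖ₑ) + e N)) hpt
      (fun N => ?_) ?_
    · refine (hX.eVariationOn_avg_le_initialTransform h (hC N)).trans ?_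
      gcongr
      have : e N = ∫⁻ x, ‖mollify (f N) F x - F x‖ₑ := rfl
      rw [this, ← lintegral_add_left' hF.1.enorm]
      refine lintegral_mono fun x => ?_
      rw [hid]
      calc _ = ‖F x + (mollify (f N) F x - F x)‖ₑ := by congr 1; abel
        _ ≤ _ := enorm_add_le _ _
    · have := ENNReal.Tendsto.const_mul (a := D)
        (tendsto_const_nhds (x := ∫⁻ x, ‖F x‖ₑ) |>.add helim) (Or.inr hDtop)
      simpa using this
  · refine tendsto_of_tendsto_of_tendsto_of_le_of_le tendsto_const_nhds ?_ (fun _ => zero_le) hN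
    simpa using ENNReal.Tendsto.const_mul helim (Or.inr hDtop)

end RayFlow

end RayLimit

/-! ### Polar coordinates -/

section Polar

open Set Filter Topology

/-- The radial part `ρ^{n-1} dρ` of Lebesgue measure, as a measure on the line. -/
noncomputable def radial (n : ℕ) : Measure ℝ :=
  (volume.restrict (Ioi 0)).withDensity fun ρ => ENNReal.ofReal (ρ ^ (n - 1))

lemma map_volumeIoiPow (n : ℕ) :
    (Measure.volumeIoiPow (n - 1)).map Subtype.val = radial n := by
  ext s hs
  rw [Measure.map_apply measurable_subtype_coe hs, Measure.volumeIoiPow, radial,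
    withDensity_apply _ (measurable_subtype_coe hs), withDensity_apply _ hs,
    setLIntegral_subtype measurableSet_Ioi _ fun a : ℝ => ENNReal.ofReal (a ^ (n - 1)),
    Measure.restrict_restrict hs, Subtype.image_preimage_coe, inter_comm]

instance (n : ℕ) : SFinite (radial n) := by rw [radial]; infer_instance

instance (n : ℕ) : IsFiniteMeasure (surf n) := by rw [surf]; infer_instance

lemma ae_radial_pos (n : ℕ) : ∀ᵐ ρ ∂(radial n), 0 < ρ :=
  (withDensity_absolutelyContinuous _ _).ae_le (ae_restrict_mem measurableSet_Ioi)

lemma integral_radial {E : Type*} [NormedAddCommGroup E] [NormedSpace ℝ E] (n : ℕ) (g : ℝ → E) :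
    ∫ ρ, g ρ ∂(radial n) = ∫ ρ in Ioi (0 : ℝ), (ρ ^ (n - 1)) • g ρ := by
  have hm : Measurable fun ρ : ℝ => (ρ ^ (n - 1)).toNNReal := by fun_prop
  have := integral_withDensity_eq_integral_smul (μ := volume.restrict (Ioi (0 : ℝ))) hm g
  rw [radial]
  refine Eq.trans this (setIntegral_congr_fun measurableSet_Ioi fun ρ hρ => ?_)
  simp only [NNReal.smul_def]
  rw [Real.coe_toNNReal _ (pow_nonneg (le_of_lt hρ) _)]

lemma measurePreserving_polar (n : ℕ) (hn : 1 ≤ n) :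
    MeasurePreserving (fun p : USphere n × ℝ => p.2 • (p.1 : Space n)) ((surf n).prod (radial n))
      volume := by
  have : Nonempty (Fin n) := ⟨⟨0, hn⟩⟩
  have h0 : Measurable fun p : USphere n × ℝ => p.2 • (p.1 : Space n) := by fun_prop
  refine ⟨h0, ?_⟩
  have h1 := (volume : Measure (Space n)).measurePreserving_homeomorphUnitSphereProd
  have hd : Module.finrank ℝ (Space n) = n := by simp
  rw [hd] at h1
  have h2 : (surf n).prod (radial n) = ((surf n).prod (Measure.volumeIoiPow (n - 1))).map
      (Prod.map id Subtype.val) := by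
    rw [← Measure.map_prod_map _ _ measurable_id measurable_subtype_coe, Measure.map_id,
      map_volumeIoiPow]
  have hm : Measurable (Prod.map id Subtype.val : USphere n × Ioi (0 : ℝ) → USphere n × ℝ) :=
    measurable_id.prodMap measurable_subtype_coe
  rw [h2, Measure.map_map h0 hm, surf, ← h1.map_eq, Measure.map_map (h0.comp hm) h1.measurable]
  have h3 : ((fun p : USphere n × ℝ => p.2 • (p.1 : Space n)) ∘ Prod.map id Subtype.val) ∘
      homeomorphUnitSphereProd (Space n) = Subtype.val := by
    ext1 x
    have hx : ‖(x : Space n)‖ ≠ 0 := norm_ne_zero_iff.2 x.2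
    simp [smul_smul, hx]
  rw [h3, (MeasurableEmbedding.subtype_coe (measurableSet_singleton _).compl).map_comap,
    Subtype.range_coe, restrict_compl_singleton]

/-- The direction `ξ / |ξ|`, with an arbitrary value at the origin. -/
noncomputable def dir {n : ℕ} [Nonempty (USphere n)] (ξ : Space n) : USphere n :=
  open Classical in
  if h : ξ = 0 then Classical.arbitrary _ else ⟨‖ξ‖⁻¹ • ξ, by simp [norm_smul, h]⟩

lemma norm_smul_dir {n : ℕ} [Nonempty (USphere n)] (ξ : Space n) :
    ‖ξ‖ • (dir ξ : Space n) = ξ := by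
  by_cases h : ξ = 0
  · simp [h]
  · simp [dir, h, smul_smul]

lemma dir_smul {n : ℕ} [Nonempty (USphere n)] (ω : USphere n) {ρ : ℝ} (hρ : 0 < ρ) :
    dir (ρ • (ω : Space n)) = ω := by
  have hω : ‖(ω : Space n)‖ = 1 := by simp
  have h0 : (ω : Space n) ≠ 0 := by rw [← norm_ne_zero_iff, hω]; exact one_ne_zero
  ext1
  simp [dir, hρ.ne', h0, norm_smul, abs_of_pos hρ, smul_smul]

lemma measurable_dir {n : ℕ} [Nonempty (USphere n)] : Measurable (dir (n := n)) := by
  classical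
  have h : Measurable fun ξ : Space n => (dir ξ : Space n) := by
    have : (fun ξ : Space n => (dir ξ : Space n)) = fun ξ =>
        if ξ = 0 then ((Classical.arbitrary (USphere n) : USphere n) : Space n) else ‖ξ‖⁻¹ • ξ := by
      ext1 ξ
      by_cases hξ : ξ = 0 <;> simp [dir, hξ]
    rw [this]
    exact Measurable.ite (measurableSet_singleton 0) measurable_const (by fun_prop)
  exact h.subtype_mk

lemma ae_dir {n : ℕ} (hn : 1 ≤ n) [Nonempty (USphere n)] {p : USphere n → Prop}
    (hp : ∀ᵐ ω ∂(surf n), p ω) : ∀ᵐ ξ : Space n, p (dir ξ) := by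
  obtain ⟨N, hN, hNm, hN0⟩ := exists_measurable_superset_of_null hp
  have key : ∀ᵐ ξ : Space n, dir ξ ∉ N := by
    have hdN : MeasurableSet {ξ : Space n | dir ξ ∉ N} := measurable_dir hNm.compl
    rw [← (measurePreserving_polar n hn).map_eq,
      ae_map_iff (measurePreserving_polar n hn).measurable.aemeasurable hdN]
    have hS : MeasurableSet {x : USphere n × ℝ | dir (x.2 • (x.1 : Space n)) ∉ N} :=
      (measurable_dir.comp (measurePreserving_polar n hn).measurable) hNm.compl
    rw [Measure.ae_prod_iff_ae_ae hS]
    filter_upwards [measure_eq_zero_iff_ae_notMem.1 hN0] with ω hω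
    filter_upwards [ae_radial_pos n] with ρ hρ
    rwa [dir_smul ω hρ]
  filter_upwards [key] with ξ hξ
  by_contra h
  exact hξ (hN h)

lemma ae_ae_ray {n : ℕ} (hn : 1 ≤ n) {q : Space n → Prop} (hq : ∀ᵐ ξ : Space n, q ξ) :
    ∀ᵐ ω : USphere n ∂(surf n), ∀ᵐ ρ ∂(radial n), q (ρ • (ω : Space n)) :=
  Measure.ae_ae_of_ae_prod ((measurePreserving_polar n hn).quasiMeasurePreserving.ae hq)

lemma integral_polar {n : ℕ} (hn : 1 ≤ n) {E : Type*} [NormedAddCommGroup E] [NormedSpace ℝ E]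
    {f : Space n → E} (hf : Integrable f) :
    Integrable (fun p : USphere n × ℝ => f (p.2 • (p.1 : Space n))) ((surf n).prod (radial n)) ∧
    ∫ ξ, f ξ = ∫ ω : USphere n, ∫ ρ, f (ρ • (ω : Space n)) ∂(radial n) ∂(surf n) := by
  have h := measurePreserving_polar n hn
  have h1 : Integrable (fun p : USphere n × ℝ => f (p.2 • (p.1 : Space n)))
      ((surf n).prod (radial n)) := h.integrable_comp_of_integrable hf
  refine ⟨h1, ?_⟩
  rw [← integral_prod _ h1, ← h.map_eq, integral_map h.measurable.aemeasurable]
  rw [h.map_eq]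
  exact hf.1

end Polar

/-! ### Measurable dependence of a curve on a parameter -/

section Parameter

open Set Filter Topology

/-- A family of continuous curves that is measurable pointwise is measurable as a map into the
space of curves with the topology of locally uniform convergence. -/
lemma measurable_continuousMap_mk {Ω : Type*} [MeasurableSpace Ω] {f : Ω → ℝ → ℂ}
    (hc : ∀ ω, Continuous (f ω)) (hm : ∀ t, Measurable fun ω => f ω t) :
    @Measurable _ _ _ (borel C(ℝ, ℂ)) fun ω => (⟨f ω, hc ω⟩ : C(ℝ, ℂ)) := by
  rw [borel_eq_generateFrom_of_subbasis ContinuousMap.compactOpen_eq]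
  refine measurable_generateFrom ?_
  rintro _ ⟨K, hK, U, hU, rfl⟩
  simp only [mem_ofPred_eq] at hK hU
  obtain ⟨D, hDc, hD⟩ := TopologicalSpace.exists_countable_dense K
  have key : (fun ω => (⟨f ω, hc ω⟩ : C(ℝ, ℂ))) ⁻¹' {g : C(ℝ, ℂ) | MapsTo g K U}
      = ⋃ n : ℕ, ⋂ x ∈ D, {ω | ((n : ℝ≥0∞) + 1)⁻¹ ≤ Metric.infEDist (f ω x) Uᶜ} := by
    ext ω
    simp only [mem_preimage, mem_ofPred_eq, ContinuousMap.coe_mk, mem_iUnion, mem_iInter]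
    constructor
    · intro h
      obtain ⟨δ, hδ, hsub⟩ := (hK.image (hc ω)).exists_thickening_subset_open hU h.image_subset
      obtain ⟨n, hn⟩ := ENNReal.exists_inv_nat_lt (ENNReal.ofReal_pos.2 hδ).ne'
      refine ⟨n, fun x _ => ?_⟩
      refine Metric.le_infEDist.2 fun y hy => ?_
      by_contra! hcon
      refine hy (hsub (Metric.mem_thickening_iff.2 ⟨f ω x, mem_image_of_mem _ x.2, ?_⟩))
      rw [dist_comm, ← ENNReal.ofReal_lt_ofReal_iff hδ, ← edist_dist]
      refine hcon.trans (lt_of_le_of_lt ?_ hn)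
      exact ENNReal.inv_le_inv.2 le_self_add
    · rintro ⟨n, hn⟩ x hx
      have hcont : Continuous fun x : K => Metric.infEDist (f ω x) Uᶜ :=
        Metric.continuous_infEDist.comp ((hc ω).comp continuous_subtype_val)
      have hcl := isClosed_le (continuous_const (y := ((n : ℝ≥0∞) + 1)⁻¹)) hcont
      have hsub : D ⊆ {x : K | ((n : ℝ≥0∞) + 1)⁻¹ ≤ Metric.infEDist (f ω x) Uᶜ} :=
        fun y hy => mem_ofPred_eq ▸ hn y hy
      have h1 := mem_ofPred_eq ▸ closure_minimal hsub hcl (hD ⟨x, hx⟩)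
      by_contra hcon
      rw [Metric.infEDist_zero_of_mem (show f ω x ∈ Uᶜ from hcon)] at h1
      simp at h1
  rw [key]
  exact MeasurableSet.iUnion fun n => MeasurableSet.biInter hDc fun x _ =>
    measurableSet_le measurable_const (Metric.continuous_infEDist.measurable.comp (hm x))

/-- The derivative of a curve depends measurably on time and on the parameter. -/
lemma measurable_deriv_of_measurable {Ω : Type*} [MeasurableSpace Ω] {f : Ω → ℝ → ℂ}
    (hc : ∀ ω, Continuous (f ω)) (hm : ∀ t, Measurable fun ω => f ω t) :
    Measurable fun p : Ω × ℝ => deriv (f p.1) p.2 := by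
  borelize C(ℝ, ℂ)
  have h1 : Measurable fun p : C(ℝ, ℂ) × ℝ => deriv (p.1 : ℝ → ℂ) p.2 :=
    measurable_deriv_with_param (f := fun (g : C(ℝ, ℂ)) t => g t) (by fun_prop)
  have h2 : Measurable fun p : Ω × ℝ => ((⟨f p.1, hc p.1⟩ : C(ℝ, ℂ)), p.2) :=
    ((measurable_continuousMap_mk hc hm).comp measurable_fst).prodMk measurable_snd
  exact h1.comp h2

lemma measurable_eLpNorm_top {Ω : Type*} [MeasurableSpace Ω] {μ : Measure Ω} [SFinite μ]
    {E : Type*} [NormedAddCommGroup E] {F : ℝ → Ω → E}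
    (hF : Measurable fun p : ℝ × Ω => ‖F p.1 p.2‖ₑ) :
    Measurable fun t => eLpNorm (F t) ⊤ μ := by
  refine measurable_of_Iic fun c => ?_
  have : (fun t => eLpNorm (F t) ⊤ μ) ⁻¹' Iic c
      = {t | μ (Prod.mk t ⁻¹' {p : ℝ × Ω | c < ‖F p.1 p.2‖ₑ}) = 0} := by
    ext t
    simp only [mem_preimage, mem_Iic, mem_ofPred_eq, eLpNorm_exponent_top]
    constructor
    · intro h
      have := (ae_le_eLpNormEssSup (f := F t) (μ := μ)).mono fun x hx => hx.trans h
      simpa [ae_iff] using this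
    · intro h
      refine essSup_le_of_ae_le _ ?_
      simpa [ae_iff, EventuallyLE] using h
  rw [this]
  exact measurable_measure_prodMk_left (measurableSet_lt measurable_const hF)
    (measurableSet_singleton 0)

end Parameter

/-! ### Regular representatives of symbols -/

section Symbol

open Set Filter Topology

variable {n m : ℕ}

/-- A representative, on the unit sphere, of a symbol of class `𝒦(Λ, K)`: regularity and bounds
hold in every direction, and only the total variation is controlled almost everywhere. -/
structure IsRegular (Λ K : ℝ) (A : MatSymbol n m) (a : ℝ → USphere n → Matrix (Fin m) (Fin m) ℂ) :
    Prop where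
  locallyLipschitz : ∀ ω j k, LocallyLipschitz fun t => a t ω j k
  measurable : ∀ t j k, Measurable fun ω => a t ω j k
  norm_le : ∀ t ω j k, ‖a t ω j k‖ ≤ Λ
  ae_eq : ∀ᵐ ω : USphere n ∂(surf n), ∀ t, a t ω = A t (ω : Space n)
  variation : ∀ᵐ ω : USphere n ∂(surf n), ∀ j k,
    ∫⁻ t, ‖deriv (fun r => a r ω j k) t‖ₑ ≤ ENNReal.ofReal K

lemma locallyLipschitz_of_forall_Icc {E : Type*} [NormedAddCommGroup E] {f : ℝ → E}
    (h : ∀ T : ℕ, ∃ L : ℝ, ∀ t ∈ Icc (-(T : ℝ)) T, ∀ t' ∈ Icc (-(T : ℝ)) T,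
      ‖f t - f t'‖ ≤ L * |t - t'|) : LocallyLipschitz f := by
  intro x
  obtain ⟨T, hT⟩ := exists_nat_gt |x|
  obtain ⟨L, hL⟩ := h T
  rw [abs_lt] at hT
  refine ⟨L.toNNReal, Icc (-(T : ℝ)) T, Icc_mem_nhds hT.1 hT.2,
    LipschitzOnWith.of_dist_le_mul fun t ht t' ht' => ?_⟩
  rw [dist_eq_norm, Real.dist_eq]
  refine (hL t ht t' ht').trans ?_
  gcongr
  exact Real.le_coe_toNNReal L

/-- Countably many exceptional null sets, one for each rational time, are discarded; the Lipschitz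
bound then extends measurability and bounds to all times. The bound for the variation in almost
every direction follows from the bound for the integral of the essential supremum by Fubini. -/
theorem ClassK.exists_isRegular {Λ K : ℝ} {A : MatSymbol n m} (hΛ : 0 ≤ Λ) (hA : ClassK Λ K A) :
    ∃ a, IsRegular Λ K A a := by
  classical
  choose r hr hrA using fun (q : ℚ) j k => hA.measurable (q : ℝ) j k
  choose L hL using hA.lipLoc
  have hbd : ∀ q : ℚ, ∀ᵐ ω : USphere n ∂(surf n), ∀ j k, ‖A q (ω : Space n) j k‖ ≤ Λ := by
    intro q
    have h1 := ae_le_eLpNormEssSup (μ := surf n)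
      (f := fun (ω : USphere n) j k => A q (ω : Space n) j k)
    filter_upwards [h1] with ω hω j k
    have h2 : ‖A q (ω : Space n) j k‖ₑ ≤ ENNReal.ofReal Λ := by
      refine le_trans ?_ (hω.trans (hA.bound q))
      rw [← ofReal_norm, ← ofReal_norm]
      refine ENNReal.ofReal_le_ofReal ((norm_le_pi_norm (A q (ω : Space n) j) k).trans
        (norm_le_pi_norm (fun j k => A q (ω : Space n) j k) j))
    rwa [← ofReal_norm, ENNReal.ofReal_le_ofReal_iff hΛ] at h2
  have hgood : ∀ᵐ ω : USphere n ∂(surf n),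
      (∀ (q : ℚ) j k, A q (ω : Space n) j k = r q j k ω) ∧
      (∀ (q : ℚ) j k, ‖A q (ω : Space n) j k‖ ≤ Λ) ∧
      (∀ T : ℕ, ∀ t ∈ Icc (-(T : ℝ)) T, ∀ t' ∈ Icc (-(T : ℝ)) T, ∀ j k,
        ‖A t (ω : Space n) j k - A t' (ω : Space n) j k‖ ≤ L T * |t - t'|) := by
    refine Eventually.and ?_ (Eventually.and (ae_all_iff.2 hbd) (ae_all_iff.2 fun T => hL T))
    simp only [ae_all_iff]
    exact fun q j k => hrA q j k
  obtain ⟨N, hN, hNm, hN0⟩ := exists_measurable_superset_of_null hgood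
  have hmem : ∀ ω ∉ N, _ := fun ω hω => not_not.1 fun h => hω (hN h)
  have hNae : ∀ᵐ ω ∂(surf n), ω ∉ N := measure_eq_zero_iff_ae_notMem.1 hN0
  set a : ℝ → USphere n → Matrix (Fin m) (Fin m) ℂ :=
    fun t ω => if ω ∈ N then 0 else A t (ω : Space n) with ha
  have haN : ∀ t ω, ω ∉ N → a t ω = A t (ω : Space n) := fun t ω h => by simp [ha, h]
  have ha0 : ∀ t ω, ω ∈ N → a t ω = 0 := fun t ω h => by simp [ha, h]
  have hlip : ∀ ω j k, LocallyLipschitz fun t => a t ω j k := by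
    intro ω j k
    by_cases hω : ω ∈ N
    · simp only [ha0 _ _ hω]
      exact (LipschitzWith.const (0 : ℂ)).locallyLipschitz
    · simp only [haN _ _ hω]
      exact locallyLipschitz_of_forall_Icc fun T =>
        ⟨L T, fun t ht t' ht' => (hmem ω hω).2.2 T t ht t' ht' j k⟩
  have hmeasQ : ∀ (q : ℚ) j k, Measurable fun ω => a q ω j k := by
    intro q j k
    have : (fun ω => a q ω j k) = fun ω => if ω ∈ N then 0 else r q j k ω := by
      ext1 ω
      by_cases hω : ω ∈ N
      · simp [ha0 _ _ hω, hω]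
      · simp only [haN _ _ hω, hω, if_false]
        exact (hmem ω hω).1 q j k
    rw [this]
    exact Measurable.ite hNm measurable_const (hr q j k).measurable
  have hmeas : ∀ t j k, Measurable fun ω => a t ω j k := by
    intro t j k
    obtain ⟨x, hx, hxt⟩ := mem_closure_iff_seq_limit.1 (Rat.denseRange_cast (𝕜 := ℝ) t)
    refine measurable_of_tendsto_metrizable (f := fun i ω => a (x i) ω j k) (fun i => ?_)
      (tendsto_pi_nhds.2 fun ω => (((hlip ω j k).continuous.tendsto t).comp hxt))
    obtain ⟨q, hq⟩ := hx i
    simp only [← hq]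
    exact hmeasQ q j k
  have haeq : ∀ᵐ ω : USphere n ∂(surf n), ∀ t, a t ω = A t (ω : Space n) := by
    filter_upwards [hNae] with ω hω t using haN t ω hω
  refine ⟨a, hlip, hmeas, ?_, haeq, ?_⟩
  · intro t ω j k
    refine Rat.denseRange_cast.induction_on t
      (isClosed_le (hlip ω j k).continuous.norm continuous_const) fun q => ?_
    by_cases hω : ω ∈ N
    · simpa [ha0 _ _ hω] using hΛ
    · simp only [haN _ _ hω]
      exact (hmem ω hω).2.1 q j k
  · have hD : ∀ j k, Measurable fun p : USphere n × ℝ => deriv (fun r => a r p.1 j k) p.2 :=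
      fun j k => measurable_deriv_of_measurable (f := fun ω r => a r ω j k)
        (fun ω => (hlip ω j k).continuous) fun t => hmeas t j k
    set F : ℝ → USphere n → Fin m → Fin m → ℂ := fun t ω j k => deriv (fun r => a r ω j k) t
      with hF
    have hFm : Measurable fun p : ℝ × USphere n => F p.1 p.2 := by
      refine measurable_pi_lambda _ fun j => measurable_pi_lambda _ fun k => ?_
      exact (hD j k).comp measurable_swap
    have hg : Measurable fun t => eLpNorm (F t) ⊤ (surf n) :=
      measurable_eLpNorm_top hFm.enorm
    have hgK : ∫⁻ t, eLpNorm (F t) ⊤ (surf n) ≤ ENNReal.ofReal K := by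
      refine le_trans (le_of_eq ?_) hA.variation
      refine lintegral_congr fun t => eLpNorm_congr_ae ?_
      filter_upwards [haeq] with ω hω
      ext j k
      simp only [hF, hω]
    have h1 : ∀ᵐ t : ℝ, ∀ᵐ ω ∂(surf n), ‖F t ω‖ₑ ≤ eLpNorm (F t) ⊤ (surf n) :=
      ae_of_all _ fun t => ae_le_eLpNormEssSup
    have hset : MeasurableSet {p : ℝ × USphere n | ‖F p.1 p.2‖ₑ ≤ eLpNorm (F p.1) ⊤ (surf n)} :=
      measurableSet_le hFm.enorm (hg.comp measurable_fst)
    replace h1 := (Measure.ae_ae_comm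
      (p := fun t ω => ‖F t ω‖ₑ ≤ eLpNorm (F t) ⊤ (surf n)) hset).1 h1
    filter_upwards [h1] with ω hω j k
    refine le_trans (lintegral_mono_ae ?_) hgK
    filter_upwards [hω] with t ht
    refine le_trans ?_ ht
    rw [← ofReal_norm, ← ofReal_norm]
    exact ENNReal.ofReal_le_ofReal ((norm_le_pi_norm (F t ω j) k).trans (norm_le_pi_norm (F t ω) j))

end Symbol

/-! ### Spectral families of hyperbolic symbols -/

section MatrixCurve

open Set Filter Topology
open scoped Matrix.Norms.L2Operator

/-- A curve whose increments are dominated by those of a differentiable curve has its derivative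
dominated as well; where it is not differentiable, its derivative is zero by convention. -/
lemma norm_deriv_le_of_norm_sub_le {E F : Type*} [NormedAddCommGroup E] [NormedSpace ℝ E]
    [NormedAddCommGroup F] [NormedSpace ℝ F] {f : ℝ → E} {g : ℝ → F} {C : ℝ} {t : ℝ}
    (h : ∀ x, ‖f x - f t‖ ≤ C * ‖g x - g t‖) (hC : 0 ≤ C) (hg : DifferentiableAt ℝ g t) :
    ‖deriv f t‖ ≤ C * ‖deriv g t‖ := by
  by_cases hf : DifferentiableAt ℝ f t
  · have h1 := (hasDerivAt_iff_tendsto_slope.1 hf.hasDerivAt).norm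
    have h2 := ((hasDerivAt_iff_tendsto_slope.1 hg.hasDerivAt).norm).const_mul C
    refine le_of_tendsto_of_tendsto' h1 h2 fun x => ?_
    simp only [slope_def_module, norm_smul]
    calc _ ≤ ‖(x - t)⁻¹‖ * (C * ‖g x - g t‖) := by gcongr; exact h x
      _ = _ := by ring
  · rw [deriv_zero_of_not_differentiableAt hf, norm_zero]
    positivity

/-- The sum of the operator norms of the matrix units, which compares the operator norm with the
largest modulus of an entry. -/
noncomputable def unitSum (m : ℕ) : ℝ :=
  ∑ j : Fin m, ∑ k : Fin m, ‖Matrix.single j k (1 : ℂ)‖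

lemma matrix_eq_sum_smul {m : ℕ} (M : Matrix (Fin m) (Fin m) ℂ) :
    M = ∑ j, ∑ k, M j k • Matrix.single j k (1 : ℂ) := by
  conv_lhs => rw [Matrix.matrix_eq_sum_single M]
  simp [Matrix.smul_single]

lemma norm_matrix_le {m : ℕ} {M : Matrix (Fin m) (Fin m) ℂ} {c : ℝ} (h : ∀ j k, ‖M j k‖ ≤ c) :
    ‖M‖ ≤ c * unitSum m := by
  conv_lhs => rw [matrix_eq_sum_smul M]
  rw [unitSum, Finset.mul_sum]
  refine (norm_sum_le _ _).trans (Finset.sum_le_sum fun j _ => ?_)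
  rw [Finset.mul_sum]
  refine (norm_sum_le _ _).trans (Finset.sum_le_sum fun k _ => ?_)
  rw [norm_smul]
  gcongr
  exact h j k

variable {m : ℕ} {a : ℝ → Matrix (Fin m) (Fin m) ℂ}

lemma hasDerivAt_matrix {a' : Matrix (Fin m) (Fin m) ℂ} {t : ℝ}
    (h : ∀ j k, HasDerivAt (fun r => a r j k) (a' j k) t) : HasDerivAt a a' t := by
  have h1 : HasDerivAt (fun r => ∑ j, ∑ k, a r j k • Matrix.single j k (1 : ℂ))
      (∑ j, ∑ k, a' j k • Matrix.single j k (1 : ℂ)) t :=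
    HasDerivAt.fun_sum fun j _ => HasDerivAt.fun_sum fun k _ => (h j k).smul_const _
  rw [matrix_eq_sum_smul a']
  exact h1.congr_of_eventuallyEq (Eventually.of_forall fun r => matrix_eq_sum_smul (a r))

lemma locallyLipschitz_matrix (h : ∀ j k, LocallyLipschitz fun t => a t j k) :
    LocallyLipschitz a := by
  have h1 : LocallyLipschitz (fun r => ∑ j, ∑ k, a r j k • Matrix.single j k (1 : ℂ)) := by
    intro x
    choose K s hs hK using fun j k => h j k x
    refine ⟨∑ j, ∑ k, K j k * ‖Matrix.single j k (1 : ℂ)‖₊, ⋂ j, ⋂ k, s j k, ?_, ?_⟩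
    · simp only [iInter_mem]
      exact hs
    · refine LipschitzOnWith.of_dist_le_mul fun y hy z hz => ?_
      simp only [mem_iInter] at hy hz
      rw [dist_eq_norm, ← Finset.sum_sub_distrib]
      push_cast
      rw [Finset.sum_mul]
      refine (norm_sum_le _ _).trans (Finset.sum_le_sum fun j _ => ?_)
      rw [Finset.sum_mul, ← Finset.sum_sub_distrib]
      refine (norm_sum_le _ _).trans (Finset.sum_le_sum fun k _ => ?_)
      rw [← sub_smul, norm_smul]
      have := (hK j k).dist_le_mul y (hy j k) z (hz j k)
      rw [dist_eq_norm] at this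
      calc _ ≤ (K j k * dist y z) * ‖Matrix.single j k (1 : ℂ)‖ := by gcongr
        _ = _ := by ring
  have h2 : a = fun r => ∑ j, ∑ k, a r j k • Matrix.single j k (1 : ℂ) :=
    funext fun r => matrix_eq_sum_smul (a r)
  rw [h2]
  exact h1

lemma ae_differentiableAt_matrix (h : ∀ j k, LocallyLipschitz fun t => a t j k) :
    ∀ᵐ t, DifferentiableAt ℝ a t ∧
      ‖deriv a t‖ₑ ≤ ∑ j, ∑ k, ‖deriv (fun r => a r j k) t‖ₑ * ‖Matrix.single j k (1 : ℂ)‖ₑ := by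
  have h1 : ∀ᵐ t, ∀ j k, DifferentiableAt ℝ (fun r => a r j k) t := by
    simp only [ae_all_iff]
    exact fun j k => (h j k).ae_differentiableAt_real
  filter_upwards [h1] with t ht
  have h2 : HasDerivAt a (Matrix.of fun j k => deriv (fun r => a r j k) t) t :=
    hasDerivAt_matrix fun j k => (ht j k).hasDerivAt
  refine ⟨h2.differentiableAt, ?_⟩
  rw [h2.deriv]
  conv_lhs => rw [matrix_eq_sum_smul (Matrix.of fun j k => deriv (fun r => a r j k) t)]
  refine (enorm_sum_le _ _).trans (Finset.sum_le_sum fun j _ => ?_)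
  refine (enorm_sum_le _ _).trans (Finset.sum_le_sum fun k _ => ?_)
  rw [enorm_smul]
  rfl

/-- A strictly hyperbolic curve of matrices has, if its total variation is small, a spectral
family; the smallness condition and the bound for the projections are uniform. -/
theorem exists_spectralFamily (m : ℕ) {d : ℝ} (hd : 0 < d) (Λ : ℝ) :
    ∃ K₀ B : ℝ, 0 < K₀ ∧ ∀ a : ℝ → Matrix (Fin m) (Fin m) ℂ,
      (∀ j k, LocallyLipschitz fun t => a t j k) → (∀ t j k, ‖a t j k‖ ≤ Λ) →
      (∀ j k, ∫⁻ t, ‖deriv (fun r => a r j k) t‖ₑ ≤ ENNReal.ofReal K₀) →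
      (∀ t, ∃ φ : Fin m → ℝ, (∀ τ : ℂ, (τ • (1 : Matrix (Fin m) (Fin m) ℂ) - a t).det
        = ∏ j, (τ - (φ j : ℂ))) ∧ ∀ j k, j ≠ k → d ≤ |φ j - φ k|) →
      ∃ (φ : Fin m → ℝ → ℝ) (P : Fin m → ℝ → Matrix (Fin m) (Fin m) ℂ),
        SpectralFamily a φ P B := by
  have hm : m = 0 → (1 : Matrix (Fin m) (Fin m) ℂ) = 0 := by
    rintro rfl
    exact Subsingleton.elim _ _
  obtain ⟨B, C, hB, hC, hBC⟩ :=
    exists_lipschitz_specProj (R := Matrix (Fin m) (Fin m) ℂ) hd (Λ * unitSum m) hm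
  have hκ : 0 ≤ unitSum m := by unfold unitSum; positivity
  set D : ℝ := (m + 1) * (m * (C * unitSum m)) with hD
  have hD0 : 0 ≤ D := by positivity
  refine ⟨1 / (4 * (D + 1)), B, by positivity, fun a hlip hbd hvar hspec => ?_⟩
  have hex : ∀ t, ∃ ψ : Fin m → ℝ, HasGapSpectrum d (a t) ψ := fun t => by
    obtain ⟨φ, h1, h2⟩ := hspec t
    exact exists_hasGapSpectrum (a t) φ h1 h2
  choose ψ hψ using hex
  have hn : ∀ t, ‖a t‖ ≤ Λ * unitSum m := fun t => norm_matrix_le (hbd t)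
  have hkey := fun s t j => hBC (a s) (a t) (ψ s) (ψ t) (hψ s) (hψ t) (hn s) (hn t) j
  have hall := locallyLipschitz_matrix hlip
  have hc : Continuous a := hall.continuous
  refine ⟨fun j t => ψ t j, fun j t => specProj (a t) (ψ t) j, hc, fun j => ?_, fun j => ?_,
    fun j t => (hψ t).mul_specProj j, fun j t => (hψ t).specProj_mul j,
    fun t => (hψ t).sum_specProj hd hm, fun j t => (hkey t t j).1, fun j k hjk => ?_, ?_⟩
  · rw [continuous_iff_continuousAt]
    intro t
    rw [ContinuousAt, tendsto_iff_dist_tendsto_zero]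
    refine squeeze_zero (fun _ => dist_nonneg) (fun s => (hkey s t j).2.2) ?_
    have : Tendsto (fun s => C * ‖a s - a t‖) (𝓝 t) (𝓝 (C * ‖a t - a t‖)) :=
      ((hc.sub continuous_const).norm.const_mul C).tendsto t
    simpa using this
  · intro x
    obtain ⟨K, s, hs, hK⟩ := hall x
    refine ⟨C.toNNReal * K, s, hs, LipschitzOnWith.of_dist_le_mul fun y hy z hz => ?_⟩
    have := hK.dist_le_mul y hy z hz
    rw [dist_eq_norm] at this ⊢
    refine (hkey y z j).2.1.trans ?_
    rw [NNReal.coe_mul, Real.coe_toNNReal C hC, mul_assoc]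
    exact mul_le_mul_of_nonneg_left this hC
  · rcases lt_or_gt_of_ne hjk with h | h
    · exact Or.inl fun t => (hψ t).strictMono hd h
    · exact Or.inr fun t => (hψ t).strictMono hd h
  · have hj : ∀ j, ∫⁻ t, ‖deriv (fun t => specProj (a t) (ψ t) j) t‖ₑ
        ≤ ENNReal.ofReal (C * unitSum m * (1 / (4 * (D + 1)))) := by
      intro j
      calc _ ≤ ∫⁻ t, ENNReal.ofReal C * ∑ j, ∑ k, ‖deriv (fun r => a r j k) t‖ₑ
            * ‖Matrix.single j k (1 : ℂ)‖ₑ := by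
            refine lintegral_mono_ae ?_
            filter_upwards [ae_differentiableAt_matrix hlip] with t ht
            refine le_trans ?_ (mul_le_mul_right ht.2 _)
            rw [← ofReal_norm, ← ofReal_norm, ← ENNReal.ofReal_mul hC]
            exact ENNReal.ofReal_le_ofReal
              (norm_deriv_le_of_norm_sub_le (fun x => (hkey x t j).2.1) hC ht.1)
        _ = ENNReal.ofReal C * ∑ j, ∑ k, (∫⁻ t, ‖deriv (fun r => a r j k) t‖ₑ)
            * ‖Matrix.single j k (1 : ℂ)‖ₑ := by
            have hmeas : ∀ j k, Measurable fun t => ‖deriv (fun r => a r j k) t‖ₑ :=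
              fun j k => (measurable_deriv _).enorm
            rw [lintegral_const_mul _ (by fun_prop), lintegral_finsetSum _ (by fun_prop)]
            congr 1
            refine Finset.sum_congr rfl fun j _ => ?_
            rw [lintegral_finsetSum _ (by fun_prop)]
            exact Finset.sum_congr rfl fun k _ => lintegral_mul_const _ (hmeas j k)
        _ ≤ ENNReal.ofReal C * ∑ j : Fin m, ∑ k : Fin m, ENNReal.ofReal (1 / (4 * (D + 1)))
            * ‖Matrix.single j k (1 : ℂ)‖ₑ := by
            gcongr
            exact hvar _ _
        _ = _ := by
            simp only [← Finset.mul_sum, ← ofReal_norm]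
            rw [← Finset.sum_congr rfl fun j _ => ENNReal.ofReal_sum_of_nonneg fun k _ =>
              norm_nonneg (Matrix.single j k (1 : ℂ)), ← ENNReal.ofReal_sum_of_nonneg fun j _ =>
              Finset.sum_nonneg fun k _ => norm_nonneg _, ← ENNReal.ofReal_mul (by positivity),
              ← ENNReal.ofReal_mul hC]
            congr 1
            rw [unitSum]
            ring
    calc _ ≤ ((Fintype.card (Fin m) : ℝ≥0∞) + 1) * ∑ _j : Fin m,
          ENNReal.ofReal (C * unitSum m * (1 / (4 * (D + 1)))) := by
          gcongr with j
          exact hj j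
      _ = ENNReal.ofReal ((m + 1) * (m * (C * unitSum m * (1 / (4 * (D + 1)))))) := by
          rw [Finset.sum_const, Finset.card_univ, Fintype.card_fin, nsmul_eq_mul,
            ENNReal.ofReal_mul (by positivity : (0 : ℝ) ≤ m + 1),
            ENNReal.ofReal_mul (by positivity : (0 : ℝ) ≤ m),
            ENNReal.ofReal_add (by positivity) zero_le_one, ENNReal.ofReal_natCast,
            ENNReal.ofReal_one]
      _ ≤ ENNReal.ofReal (1 / 4) := by
          refine ENNReal.ofReal_le_ofReal ?_
          have : (m + 1) * (m * (C * unitSum m * (1 / (4 * (D + 1))))) = D / (D + 1) * (1 / 4) := by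
            rw [hD]; field_simp
          rw [this]
          have : D / (D + 1) ≤ 1 := by rw [div_le_one (by positivity)]; linarith
          linarith
      _ = 1 / 4 := by
          rw [ENNReal.ofReal_div_of_pos (by norm_num)]; simp

end MatrixCurve

/-! ### Jointly measurable versions of curves in `L²` -/

section Joint

open Set Filter Topology

/-- A continuous curve in `L²` has a version that is measurable in time and space. It is a pointwise
limit of step functions in time, chosen so close to the curve that their squared distances to it are
summable. -/
theorem exists_jointlyMeasurable {α : Type*} [MeasurableSpace α] {μ : Measure α} {E : Type*}
    [NormedAddCommGroup E] [SecondCountableTopology E] [CompleteSpace E]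
    [MeasurableSpace E] [BorelSpace E] {V : ℝ → Lp E 2 μ} (hV : Continuous V) :
    ∃ u : ℝ → α → E, Measurable (Function.uncurry u) ∧ ∀ t, u t =ᵐ[μ] V t := by
  have step : ∀ k : ℕ, ∃ N : ℕ, 0 < N ∧ ∀ t ∈ Icc (-(k : ℝ)) k,
      dist (V (⌊N * t⌋ / N)) (V t) ≤ (1 / 2) ^ k := by
    intro k
    have huc := isCompact_Icc.uniformContinuousOn_of_continuous
      (hV.continuousOn (s := Icc (-(k : ℝ) - 1) (k + 1)))
    obtain ⟨δ, hδ, h⟩ := Metric.uniformContinuousOn_iff.1 huc ((1 / 2) ^ k) (by positivity)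
    obtain ⟨N, hN⟩ := exists_nat_gt (max 1 (1 / δ))
    have hN1 : (1 : ℝ) < N := (le_max_left _ _).trans_lt hN
    have hN0 : (0 : ℝ) < N := zero_lt_one.trans hN1
    have hNδ : 1 / (N : ℝ) < δ := by
      rw [div_lt_iff₀ hN0, mul_comm, ← div_lt_iff₀ hδ]
      exact (le_max_right _ _).trans_lt hN
    refine ⟨N, by exact_mod_cast hN0, fun t ht => (h _ ?_ _ ?_ ?_).le⟩
    all_goals
      have h1 : (⌊N * t⌋ : ℝ) / N ≤ t := by
        rw [div_le_iff₀ hN0, mul_comm]; exact Int.floor_le _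
      have h2 : t - 1 / N < (⌊N * t⌋ : ℝ) / N := by
        rw [lt_div_iff₀ hN0, sub_mul, div_mul_cancel₀ _ hN0.ne', mul_comm]
        exact Int.sub_one_lt_floor _
      have h3 : 1 / (N : ℝ) < 1 := by rw [div_lt_one hN0]; exact hN1
    · exact ⟨by linarith [ht.1], by linarith [ht.2]⟩
    · exact ⟨by linarith [ht.1], by linarith [ht.2]⟩
    · rw [Real.dist_eq, abs_lt]
      constructor <;> linarith
  choose N hN0 hN using step
  set g : ℕ → ℝ × α → E := fun k p => V (⌊N k * p.1⌋ / N k) p.2 with hg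
  have hgm : ∀ k, StronglyMeasurable (g k) := by
    intro k
    have h1 : Measurable fun q : ℤ × α => V (q.1 / N k) q.2 :=
      measurable_from_prod_countable_right fun z => (Lp.stronglyMeasurable (V (z / N k))).measurable
    have h2 : Measurable fun p : ℝ × α => (⌊N k * p.1⌋, p.2) := by fun_prop
    exact (h1.comp h2).stronglyMeasurable
  refine ⟨fun t x => limUnder atTop fun k => g k (t, x),
    (StronglyMeasurable.limUnder (l := atTop) hgm).measurable, fun t => ?_⟩
  obtain ⟨k₀, hk₀⟩ := exists_nat_gt |t|
  have hmem : ∀ k, t ∈ Icc (-((k + k₀ : ℕ) : ℝ)) ((k + k₀ : ℕ) : ℝ) := by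
    intro k
    rw [abs_lt] at hk₀
    push_cast
    have : (0 : ℝ) ≤ k := by positivity
    exact ⟨by linarith, by linarith⟩
  have hd : ∀ k, ∫⁻ x, ‖g (k + k₀) (t, x) - V t x‖ₑ ^ (2 : ℝ) ∂μ ≤ (1 / 2 : ℝ≥0∞) ^ k := by
    intro k
    have h1 := hN (k + k₀) t (hmem k)
    rw [dist_eq_norm, Lp.norm_def] at h1
    set W := V (⌊N (k + k₀) * t⌋ / N (k + k₀)) - V t with hW
    have h2 : eLpNorm W 2 μ ≤ (1 / 2 : ℝ≥0∞) ^ k := by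
      have h3 : eLpNorm W 2 μ ≤ ENNReal.ofReal ((1 / 2) ^ (k + k₀)) :=
        (ENNReal.le_ofReal_iff_toReal_le (Lp.eLpNorm_ne_top W) (by positivity)).2 h1
      refine h3.trans ?_
      rw [ENNReal.ofReal_pow (by norm_num), ENNReal.ofReal_div_of_pos (by norm_num)]
      simp only [ENNReal.ofReal_one, ENNReal.ofReal_ofNat]
      exact pow_le_pow_right_of_le_one' (by simp) (by omega)
    have h4 : ∫⁻ x, ‖g (k + k₀) (t, x) - V t x‖ₑ ^ (2 : ℝ) ∂μ = eLpNorm W 2 μ ^ (2 : ℝ) := by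
      have := eLpNorm_nnreal_pow_eq_lintegral (f := W) (μ := μ) (p := 2) (by norm_num)
      simp only [NNReal.coe_ofNat, ENNReal.coe_ofNat] at this
      rw [this]
      refine lintegral_congr_ae ?_
      filter_upwards [Lp.coeFn_sub (V (⌊N (k + k₀) * t⌋ / N (k + k₀))) (V t)] with x hx
      rw [hW, hx]
      rfl
    rw [h4]
    calc eLpNorm W 2 μ ^ (2 : ℝ) ≤ ((1 / 2 : ℝ≥0∞) ^ k) ^ (2 : ℝ) := by gcongr
      _ ≤ ((1 / 2 : ℝ≥0∞) ^ k) ^ (1 : ℝ) :=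
          ENNReal.rpow_le_rpow_of_exponent_ge (pow_le_one' (by simp) _) (by norm_num)
      _ = _ := ENNReal.rpow_one _
  have hsum : ∫⁻ x, ∑' k, ‖g (k + k₀) (t, x) - V t x‖ₑ ^ (2 : ℝ) ∂μ ≠ ⊤ := by
    have hm : ∀ k, AEMeasurable (fun x => ‖g (k + k₀) (t, x) - V t x‖ₑ ^ (2 : ℝ)) μ := by
      intro k
      have h1 : StronglyMeasurable fun x => g (k + k₀) (t, x) :=
        (hgm _).comp_measurable measurable_prodMk_left
      exact ((h1.sub (Lp.stronglyMeasurable _)).enorm.pow_const _).aemeasurable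
    rw [lintegral_tsum hm]
    refine ne_top_of_le_ne_top ?_ (ENNReal.tsum_le_tsum hd)
    rw [ENNReal.tsum_geometric]
    simp
  have hae := ae_lt_top' (AEMeasurable.tsum fun k => ?_) hsum
  · filter_upwards [hae] with x hx
    have h1 := ENNReal.tendsto_atTop_zero_of_tsum_ne_top hx.ne
    have h2 : Tendsto (fun k => ‖g (k + k₀) (t, x) - V t x‖ₑ) atTop (𝓝 0) := by
      have := (ENNReal.continuous_rpow_const (y := 1 / 2)).tendsto _ |>.comp h1
      rw [ENNReal.zero_rpow_of_pos (by norm_num)] at this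
      refine this.congr fun k => ?_
      rw [Function.comp, ← ENNReal.rpow_mul]
      norm_num
    have h3 : Tendsto (fun k => g (k + k₀) (t, x)) atTop (𝓝 (V t x)) := by
      rw [tendsto_iff_edist_tendsto_0]
      simpa [edist_eq_enorm_sub] using h2
    exact ((tendsto_add_atTop_iff_nat (f := fun k => g k (t, x)) k₀).1 h3).limUnder_eq
  · have h1 : StronglyMeasurable fun x => g (k + k₀) (t, x) :=
      (hgm _).comp_measurable measurable_prodMk_left
    exact ((h1.sub (Lp.stronglyMeasurable _)).enorm.pow_const _).aemeasurable

end Joint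

/-! ### The equation on the Fourier side -/

section Fourier

open Set Filter Topology
open scoped ContDiff

variable {n m : ℕ} {A : MatSymbol n m} {U₀ : L2 n m} {U : ℝ → L2 n m}

lemma integral_inner_schwartz (ψ : 𝓢(Space n, EuclideanSpace ℂ (Fin m))) (V : L2 n m) :
    ∫ x, inner ℂ (ψ x) (V x) = inner ℂ (ψ.toLp 2 : L2 n m) V := by
  rw [L2.inner_def]
  refine integral_congr_ae ?_
  filter_upwards [ψ.coeFn_toLp 2] with x hx
  rw [hx]

lemma IsSolution.hasDerivAt_fourier (hU : IsSolution A U₀ U)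
    (Ψ : 𝓢(Space n, EuclideanSpace ℂ (Fin m))) (t : ℝ) :
    HasDerivAt (fun r => ∫ ξ, inner ℂ (Ψ ξ) ((𝓕 (U r) : L2 n m) ξ))
      (Complex.I * ∫ ξ : Space n, inner ℂ (Ψ ξ)
        (Matrix.toEuclideanLin (A t ((2 * Real.pi) • ξ)) ((𝓕 (U t) : L2 n m) ξ))) t := by
  have h := hU.equation (𝓕⁻ Ψ) t
  have h1 : 𝓕 (𝓕⁻ Ψ) = Ψ := FourierTransform.fourier_fourierInv_eq Ψ
  rw [opPairing, h1] at h
  convert! h using 2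
  rename_i r
  have h2 := Lp.inner_fourier_eq ((𝓕⁻ Ψ).toLp 2) (U r)
  rw [SchwartzMap.toLp_fourier_eq, h1] at h2
  rw [integral_inner_schwartz, integral_inner_schwartz]
  exact h2

/-- The equation tested, on the Fourier side, in one coordinate and against a real smooth function
of compact support. -/
lemma IsSolution.hasDerivAt_test (hU : IsSolution A U₀ U) {g : Space n → ℝ}
    (hg : ContDiff ℝ ∞ g) (hc : HasCompactSupport g) (j : Fin m) (t : ℝ) :
    HasDerivAt (fun r => ∫ ξ, g ξ • (𝓕 (U r) : L2 n m) ξ j)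
      (Complex.I * ∫ ξ : Space n, g ξ •
        (A t ((2 * Real.pi) • ξ)).mulVec (fun k => (𝓕 (U t) : L2 n m) ξ k) j) t := by
  have h1 : HasCompactSupport fun ξ => EuclideanSpace.single j ((g ξ : ℝ) : ℂ) :=
    hc.comp_left (g := fun x : ℝ => EuclideanSpace.single j (x : ℂ)) (by simp)
  have h2 : ContDiff ℝ ∞ fun ξ => EuclideanSpace.single j ((g ξ : ℝ) : ℂ) := by
    have : (fun ξ => EuclideanSpace.single j ((g ξ : ℝ) : ℂ))
        = fun ξ => g ξ • EuclideanSpace.single j (1 : ℂ) := by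
      ext ξ k
      simp
    rw [this]
    exact hg.smul contDiff_const
  have h := hU.hasDerivAt_fourier (h1.toSchwartzMap h2) t
  simpa [EuclideanSpace.inner_single_left, Matrix.toLpLin_apply] using h

end Fourier

/-! ### Solutions as functions of time for each frequency -/

section Pointwise

open Set Filter Topology

variable {n m : ℕ} {A : MatSymbol n m} {U₀ : L2 n m} {U : ℝ → L2 n m} {Λ K : ℝ}
  {a : ℝ → USphere n → Matrix (Fin m) (Fin m) ℂ}

lemma integral_norm_sq {α E : Type*} [MeasurableSpace α] {μ : Measure α} [NormedAddCommGroup E]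
    [InnerProductSpace ℂ E] (f : Lp E 2 μ) : ∫ x, ‖f x‖ ^ 2 ∂μ = ‖f‖ ^ 2 := by
  have h1 : inner ℂ f f = ∫ x, ((‖f x‖ ^ 2 : ℝ) : ℂ) ∂μ := by
    rw [L2.inner_def]
    refine integral_congr_ae (ae_of_all _ fun x => ?_)
    simp only [inner_self_eq_norm_sq_to_K]
    push_cast
    rfl
  rw [integral_complex_ofReal, inner_self_eq_norm_sq_to_K] at h1
  exact Complex.ofReal_injective (by rw [← h1]; push_cast; rfl)

lemma integrable_norm_sq {α E : Type*} [MeasurableSpace α] {μ : Measure α} [NormedAddCommGroup E]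
    (f : Lp E 2 μ) : Integrable (fun x => ‖f x‖ ^ 2) μ :=
  (Lp.memLp f).integrable_norm_pow (by norm_num)

lemma integrable_sq_of_jointlyMeasurable {α E : Type*} [MeasurableSpace α] {μ : Measure α}
    [SFinite μ] [NormedAddCommGroup E] [InnerProductSpace ℂ E] [MeasurableSpace E] [BorelSpace E]
    [SecondCountableTopology E] {V : ℝ → Lp E 2 μ} (hV : Continuous V) {u : ℝ → α → E}
    (hu : Measurable (Function.uncurry u)) (huV : ∀ t, u t =ᵐ[μ] V t) {I : Set ℝ} {T : ℝ}
    (hI : I ⊆ Icc (-T) T) :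
    Integrable (fun p : ℝ × α => ‖u p.1 p.2‖ ^ 2) ((volume.restrict I).prod μ) := by
  have h2 : ∀ t, (fun x => ‖u t x‖ ^ 2) =ᵐ[μ] fun x => ‖V t x‖ ^ 2 := fun t => by
    filter_upwards [huV t] with x hx
    rw [hx]
  have h3 : Measurable fun p : ℝ × α => ‖u p.1 p.2‖ ^ 2 := hu.norm.pow_const 2
  rw [integrable_prod_iff h3.aestronglyMeasurable]
  refine ⟨ae_of_all _ fun t => (integrable_norm_sq (V t)).congr (h2 t).symm, ?_⟩
  have h1 : (fun t => ∫ x, ‖‖u t x‖ ^ 2‖ ∂μ) = fun t => ‖V t‖ ^ 2 := by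
    ext1 t
    rw [← integral_norm_sq (V t), ← integral_congr_ae (h2 t)]
    simp
  rw [h1]
  exact (((hV.norm.pow 2).continuousOn (s := Icc (-T) T)).integrableOn_Icc).mono_set hI

variable [Nonempty (USphere n)]

lemma ae_symbol_eq (hn : 1 ≤ n) (hom : HomogeneousOne A) (ha : IsRegular Λ K A a) :
    ∀ᵐ ξ : Space n, ∀ t,
      A t ((2 * Real.pi) • ξ) = ((2 * Real.pi * ‖ξ‖ : ℝ) : ℂ) • a t (dir ξ) := by
  have : Nonempty (Fin n) := ⟨⟨0, hn⟩⟩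
  filter_upwards [ae_dir hn ha.ae_eq, Measure.ae_ne volume (0 : Space n)] with ξ hξ h0 t
  have h1 : (2 * Real.pi) • ξ = (2 * Real.pi * ‖ξ‖) • (dir ξ : Space n) := by
    rw [mul_smul (2 * Real.pi), norm_smul_dir]
  have h2 : (dir ξ : Space n) ≠ 0 := by
    rw [← norm_ne_zero_iff]; simp
  have h3 : 0 < ‖ξ‖ := norm_pos_iff.2 h0
  rw [h1, hom t _ _ (by positivity) h2, hξ t]

/-- The right-hand side `A(s, 2πξ) u(s, ξ)` of the equation, in the coordinate `j`. -/
noncomputable def field (a : ℝ → USphere n → Matrix (Fin m) (Fin m) ℂ)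
    (u : ℝ → Space n → Fin m → ℂ) (j : Fin m) (s : ℝ) (ξ : Space n) : ℂ :=
  ((2 * Real.pi * ‖ξ‖ : ℝ) : ℂ) * (a s (dir ξ)).mulVec (u s ξ) j

lemma IsRegular.measurable_uncurry (ha : IsRegular Λ K A a) (j k : Fin m) :
    Measurable fun p : ℝ × USphere n => a p.1 p.2 j k := by
  have := measurable_uncurry_of_continuous_of_measurable (u := fun t ω => a t ω j k)
    (fun ω => (ha.locallyLipschitz ω j k).continuous) (fun t => ha.measurable t j k)
  exact this

lemma measurable_field (ha : IsRegular Λ K A a) {u : ℝ → Space n → Fin m → ℂ}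
    (hu : ∀ k, Measurable fun p : ℝ × Space n => u p.1 p.2 k) (j : Fin m) :
    Measurable fun p : ℝ × Space n => field a u j p.1 p.2 := by
  have h1 : ∀ k, Measurable fun p : ℝ × Space n => a p.1 (dir p.2) j k := fun k =>
    (ha.measurable_uncurry j k).comp
      (measurable_fst.prodMk (measurable_dir.comp measurable_snd))
  simp only [field, Matrix.mulVec, dotProduct]
  refine Measurable.mul (by fun_prop) (Finset.measurable_fun_sum _ fun k _ => (h1 k).mul (hu k))

lemma norm_field_le (ha : IsRegular Λ K A a) (u : ℝ → Space n → Fin m → ℂ) (j : Fin m) (s : ℝ)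
    (ξ : Space n) {c : ℝ} (hc : ∀ k, ‖u s ξ k‖ ≤ c) :
    ‖field a u j s ξ‖ ≤ 2 * Real.pi * m * Λ * (‖ξ‖ * c) := by
  have hΛ : 0 ≤ Λ := (norm_nonneg _).trans (ha.norm_le s (dir ξ) j j)
  rw [field, norm_mul, Complex.norm_real, Real.norm_of_nonneg (by positivity), Matrix.mulVec,
    dotProduct]
  have h1 : ‖∑ k, a s (dir ξ) j k * u s ξ k‖ ≤ ∑ _k : Fin m, Λ * c := by
    refine (norm_sum_le _ _).trans (Finset.sum_le_sum fun k _ => ?_)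
    rw [norm_mul]
    exact mul_le_mul (ha.norm_le _ _ _ _) (hc k) (norm_nonneg _) hΛ
  rw [Finset.sum_const, Finset.card_univ, Fintype.card_fin, nsmul_eq_mul] at h1
  calc _ ≤ 2 * Real.pi * ‖ξ‖ * (m * (Λ * c)) := by gcongr
    _ = _ := by ring

lemma integrableOn_field (ha : IsRegular Λ K A a) {u : ℝ → Space n → EuclideanSpace ℂ (Fin m)}
    {V : ℝ → L2 n m} (hV : Continuous V) (hu : Measurable (Function.uncurry u))
    (huV : ∀ t, u t =ᵐ[volume] V t) {I : Set ℝ} {T : ℝ} (hI : I ⊆ Icc (-T) T) (R : ℝ) (j : Fin m) :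
    IntegrableOn (fun p : ℝ × Space n => field a (fun t ξ k => u t ξ k) j p.1 p.2)
      (univ ×ˢ Metric.closedBall 0 R) ((volume.restrict I).prod volume) := by
  have hfin : ((volume.restrict I).prod volume)
      (univ ×ˢ Metric.closedBall (0 : Space n) R) < ⊤ := by
    rw [Measure.prod_prod]
    refine ENNReal.mul_lt_top ?_ measure_closedBall_lt_top
    rw [Measure.restrict_apply_univ]
    exact (measure_mono hI).trans_lt measure_Icc_lt_top
  have hint : IntegrableOn (fun p : ℝ × Space n => 2 * Real.pi * m * Λ * (R ^ 2 + ‖u p.1 p.2‖ ^ 2))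
      (univ ×ˢ Metric.closedBall (0 : Space n) R) ((volume.restrict I).prod volume) := by
    refine Integrable.const_mul (Integrable.add ?_ ?_) _
    · exact integrableOn_const hfin.ne
    · exact (integrable_sq_of_jointlyMeasurable hV hu huV hI).integrableOn
  have huk : ∀ k, Measurable fun p : ℝ × Space n => u p.1 p.2 k := fun k => by
    have : Measurable fun v : EuclideanSpace ℂ (Fin m) => v k := by fun_prop
    exact this.comp hu
  refine hint.mono' (measurable_field ha huk j).aestronglyMeasurable ?_
  filter_upwards [ae_restrict_mem (MeasurableSet.univ.prod measurableSet_closedBall)] with p hp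
  have hΛ : 0 ≤ Λ := (norm_nonneg _).trans (ha.norm_le p.1 (dir p.2) j j)
  refine (norm_field_le ha _ j _ _ (c := ‖u p.1 p.2‖) fun k => PiLp.norm_apply_le _ k).trans ?_
  have h1 : ‖p.2‖ ≤ R := by simpa using hp.2
  gcongr
  nlinarith [norm_nonneg p.2, norm_nonneg (u p.1 p.2), sq_nonneg (‖p.2‖ - ‖u p.1 p.2‖)]

/-- The solution of a hyperbolic system has a version which, for every frequency, is a classical
solution of the ordinary differential equation in time. The version is
`u(0, ξ) + i ∫₀ᵗ A(s, 2πξ) u(s, ξ) ds`, where `u` is a jointly measurable version of the Fourier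
transform: the tested equation shows that it agrees with `u(t, ·)` almost everywhere, for each `t`,
so that `u` can be replaced by it under the integral. -/
theorem IsSolution.exists_pointwise (hn : 1 ≤ n) (hom : HomogeneousOne A)
    (ha : IsRegular Λ K A a) (hU : IsSolution A U₀ U) :
    ∃ w : ℝ → Space n → Fin m → ℂ, (∀ t k, Measurable fun ξ => w t ξ k) ∧
      (∀ ξ t j, HasDerivAt (fun r => w r ξ j) (Complex.I * field a w j t ξ) t) ∧
      ∀ t, ∀ᵐ ξ, ∀ j, w t ξ j = (𝓕 (U t) : L2 n m) ξ j := by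
  classical
  set V : ℝ → L2 n m := fun t => 𝓕 (U t) with hVdef
  have hV : Continuous V :=
    (Lp.fourierTransformₗᵢ (Space n) (EuclideanSpace ℂ (Fin m))).continuous.comp hU.continuous
  obtain ⟨u, hu, huV⟩ := exists_jointlyMeasurable hV
  set u' : ℝ → Space n → Fin m → ℂ := fun t ξ k => u t ξ k with hu'
  have huk : ∀ k, Measurable fun p : ℝ × Space n => u' p.1 p.2 k := fun k => by
    have : Measurable fun v : EuclideanSpace ℂ (Fin m) => v k := by fun_prop
    exact this.comp hu
  set b : Fin m → ℝ → Space n → ℂ := field a u' with hb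
  have hbm : ∀ j, Measurable fun p : ℝ × Space n => b j p.1 p.2 := measurable_field ha huk
  have hbint : ∀ {I : Set ℝ} {T : ℝ}, I ⊆ Icc (-T) T → ∀ (R : ℝ) j,
      IntegrableOn (fun p : ℝ × Space n => b j p.1 p.2)
        (univ ×ˢ Metric.closedBall 0 R) ((volume.restrict I).prod volume) :=
    fun hI R j => integrableOn_field ha hV hu huV hI R j
  have huIoc : ∀ t : ℝ, uIoc 0 t ⊆ Icc (-|t|) |t| := by
    intro t x hx
    rcases le_total 0 t with h | h
    · rw [uIoc_of_le h] at hx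
      rw [abs_of_nonneg h]
      exact ⟨by linarith [hx.1], hx.2⟩
    · rw [uIoc_of_ge h] at hx
      rw [abs_of_nonpos h]
      exact ⟨by linarith [hx.1], by linarith [hx.2]⟩
  -- for almost every frequency the right-hand side is locally integrable in time
  have hslice : ∀ᵐ ξ : Space n, ∀ j (t : ℝ), IntervalIntegrable (fun s => b j s ξ) volume 0 t := by
    have h1 : ∀ᵐ ξ : Space n, ∀ (N : ℕ) j, ξ ∈ Metric.closedBall (0 : Space n) N →
        IntegrableOn (fun s => b j s ξ) (Icc (-(N : ℝ)) N) := by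
      simp only [ae_all_iff]
      intro N j
      have h2 := hbint (subset_refl (Icc (-(N : ℝ)) N)) N j
      rw [← integrable_indicator_iff (MeasurableSet.univ.prod measurableSet_closedBall)] at h2
      filter_upwards [h2.prod_left_ae] with ξ hξ hmem
      refine hξ.congr (ae_of_all _ fun s => ?_)
      exact indicator_of_mem (show (s, ξ) ∈ univ ×ˢ Metric.closedBall (0 : Space n) (N : ℝ) from
        ⟨mem_univ _, hmem⟩) _
    filter_upwards [h1] with ξ hξ j t
    obtain ⟨N, hN⟩ := exists_nat_ge (max |t| ‖ξ‖)
    have h3 := hξ N j (by simpa using (le_max_right _ _).trans hN)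
    rw [intervalIntegrable_iff]
    refine h3.mono_set ((huIoc t).trans (Icc_subset_Icc ?_ ?_))
    · linarith [le_max_left |t| ‖ξ‖]
    · exact (le_max_left _ _).trans hN
  set v : Fin m → ℝ → Space n → ℂ := fun j t ξ => u' 0 ξ j + Complex.I * ∫ s in (0 : ℝ)..t, b j s ξ
    with hv
  have hvm : ∀ j t, Measurable (v j t) := by
    intro j t
    have h1 : StronglyMeasurable fun p : Space n × ℝ => b j p.2 p.1 :=
      ((hbm j).comp measurable_swap).stronglyMeasurable
    have h2 : Measurable fun ξ => ∫ s in (0 : ℝ)..t, b j s ξ := by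
      simp only [intervalIntegral]
      exact (h1.integral_prod_right'.sub h1.integral_prod_right').measurable
    exact ((huk j).comp measurable_prodMk_left).add (h2.const_mul _)
  have huloc : ∀ t j, LocallyIntegrable (fun ξ => u' t ξ j) := by
    intro t j
    have h1 : LocallyIntegrable (V t) := (Lp.memLp (V t)).locallyIntegrable (by norm_num)
    refine h1.mono (((huk j).comp measurable_prodMk_left).aestronglyMeasurable) ?_
    filter_upwards [huV t] with ξ hξ
    rw [← hξ]
    exact PiLp.norm_apply_le _ j
  have hwloc : ∀ t j, LocallyIntegrable (fun ξ => ∫ s in (0 : ℝ)..t, b j s ξ) := by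
    intro t j
    rw [locallyIntegrable_iff]
    intro k hk
    obtain ⟨R, hR⟩ := hk.isBounded.subset_closedBall 0
    have h2 := (hbint (huIoc t) R j)
    rw [IntegrableOn, ← Measure.prod_restrict, Measure.restrict_univ] at h2
    have h3 := h2.integral_prod_right
    refine IntegrableOn.mono_set ?_ hR
    rw [IntegrableOn]
    rcases le_total 0 t with h | h
    · simpa only [intervalIntegral.integral_of_le h, uIoc_of_le h] using h3
    · simp only [intervalIntegral.integral_of_ge h, uIoc_of_ge h] at h3 ⊢
      exact h3.neg
  have hsymb := ae_symbol_eq hn hom ha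
  -- the integrated form of the tested equation
  have hvu : ∀ t j, ∀ᵐ ξ, v j t ξ = u' t ξ j := by
    intro t j
    refine ae_eq_of_integral_contDiff_smul_eq ((huloc 0 j).add ((hwloc t j).smul Complex.I))
      (huloc t j) fun g hg hgc => ?_
    obtain ⟨R, hR⟩ := hgc.isCompact.isBounded.subset_closedBall 0
    obtain ⟨G, hG⟩ := hg.continuous.bounded_above_of_compact_support hgc
    have hgb : ∀ {I : Set ℝ} {T : ℝ}, I ⊆ Icc (-T) T →
        Integrable (fun p : ℝ × Space n => g p.2 • b j p.1 p.2)
          ((volume.restrict I).prod volume) := by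
      intro I T hI
      have h1 : IntegrableOn (fun p : ℝ × Space n => g p.2 • b j p.1 p.2)
          (univ ×ˢ Metric.closedBall 0 R) ((volume.restrict I).prod volume) := by
        refine Integrable.bdd_smul (φ := fun p : ℝ × Space n => g p.2) (hbint hI R j) G ?_
          (ae_of_all _ fun p => hG p.2)
        exact (hg.continuous.comp continuous_snd).aestronglyMeasurable
      rwa [integrableOn_iff_integrable_of_support_subset] at h1
      intro p hp
      refine ⟨mem_univ _, hR (subset_tsupport _ ?_)⟩
      intro h0
      exact hp (by simp [h0])
    have hder : ∀ s, HasDerivAt (fun r => ∫ ξ, g ξ • u' r ξ j)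
        (Complex.I * ∫ ξ, g ξ • b j s ξ) s := by
      intro s
      have h1 := hU.hasDerivAt_test hg hgc j s
      have h2 : (fun r => ∫ ξ, g ξ • u' r ξ j) = fun r => ∫ ξ, g ξ • (𝓕 (U r) : L2 n m) ξ j := by
        ext1 r
        refine integral_congr_ae ?_
        filter_upwards [huV r] with ξ hξ
        simp only [hu', hξ, hVdef]
      have h3 : ∫ ξ, g ξ • b j s ξ = ∫ ξ : Space n, g ξ •
          (A s ((2 * Real.pi) • ξ)).mulVec (fun k => (𝓕 (U s) : L2 n m) ξ k) j := by
        refine integral_congr_ae ?_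
        filter_upwards [huV s, hsymb] with ξ hξ hs
        simp only [hb, field, hs s, Matrix.smul_mulVec, Pi.smul_apply, smul_eq_mul, hu', hξ, hVdef]
      rw [h2, h3]
      exact h1
    have hcont : Continuous fun r => ∫ ξ, g ξ • u' r ξ j :=
      continuous_iff_continuousAt.2 fun s => (hder s).continuousAt
    have hint : IntervalIntegrable (fun s => Complex.I * ∫ ξ, g ξ • b j s ξ) volume 0 t := by
      rw [intervalIntegrable_iff]
      exact (hgb (huIoc t)).integral_prod_left.const_mul _
    have hFTC := intervalIntegral.integral_eq_sub_of_hasDerivAt (fun s _ => hder s) hint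
    rw [intervalIntegral.integral_const_mul,
      intervalIntegral_integral_swap (f := fun s ξ => g ξ • b j s ξ) (hgb (huIoc t))] at hFTC
    have hg0 : Integrable fun ξ => g ξ • u' 0 ξ j :=
      (huloc 0 j).integrable_smul_left_of_hasCompactSupport hg.continuous hgc
    have hg1 : Integrable fun ξ => g ξ • ∫ s in (0 : ℝ)..t, b j s ξ :=
      (hwloc t j).integrable_smul_left_of_hasCompactSupport hg.continuous hgc
    have h4 : ∀ ξ, g ξ • v j t ξ
        = g ξ • u' 0 ξ j + Complex.I * (g ξ • ∫ s in (0 : ℝ)..t, b j s ξ) := by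
      intro ξ
      rw [hv]
      simp only [smul_add, mul_smul_comm]
    simp only [intervalIntegral.integral_smul] at hFTC
    calc ∫ ξ, g ξ • v j t ξ
        = (∫ ξ, g ξ • u' 0 ξ j) + Complex.I * ∫ ξ, g ξ • ∫ s in (0 : ℝ)..t, b j s ξ := by
          simp only [h4]
          rw [integral_add hg0 (hg1.const_mul _), integral_const_mul]
      _ = ∫ ξ, g ξ • u' t ξ j := by rw [hFTC]; ring
  -- discard the frequencies without local integrability, then those where `v ≠ u`
  obtain ⟨N, hN, hNm, hN0⟩ := exists_measurable_superset_of_null hslice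
  have hmemN : ∀ ξ ∉ N, _ := fun ξ hξ => not_not.1 fun h => hξ (hN h)
  set v' : Fin m → ℝ → Space n → ℂ := fun j t ξ => if ξ ∈ N then 0 else v j t ξ with hv'
  have hv'c : ∀ j ξ, Continuous fun t => v' j t ξ := by
    intro j ξ
    by_cases hξ : ξ ∈ N
    · simp only [hv', hξ, if_true]; exact continuous_const
    · simp only [hv', hξ, if_false, hv]
      have hi : ∀ a b', IntervalIntegrable (fun s => b j s ξ) volume a b' := fun a b' =>
        ((hmemN ξ hξ) j a).symm.trans ((hmemN ξ hξ) j b')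
      exact continuous_const.add
        (continuous_const.mul (intervalIntegral.continuous_primitive hi 0))
  have hv'm : ∀ j t, Measurable (v' j t) := fun j t =>
    Measurable.ite hNm measurable_const (hvm j t)
  have hv'u : ∀ t, ∀ᵐ ξ, ∀ j, v' j t ξ = u' t ξ j := by
    intro t
    filter_upwards [measure_eq_zero_iff_ae_notMem.1 hN0, ae_all_iff.2 (hvu t)] with ξ h1 h2 j
    simp only [hv', h1, if_false, h2 j]
  have hae : ∀ᵐ ξ : Space n, ∀ᵐ s : ℝ, ∀ j, v' j s ξ = u' s ξ j := by
    have hset : MeasurableSet {p : ℝ × Space n | ∀ j, v' j p.1 p.2 = u' p.1 p.2 j} := by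
      have : {p : ℝ × Space n | ∀ j, v' j p.1 p.2 = u' p.1 p.2 j}
          = ⋂ j, {p | v' j p.1 p.2 = u' p.1 p.2 j} := by ext; simp
      rw [this]
      refine MeasurableSet.iInter fun j => measurableSet_eq_fun ?_ (huk j)
      exact measurable_uncurry_of_continuous_of_measurable (u := fun t ξ => v' j t ξ)
        (hv'c j) (hv'm j)
    exact (Measure.ae_ae_comm (p := fun s ξ => ∀ j, v' j s ξ = u' s ξ j) hset).1
      (ae_of_all _ hv'u)
  obtain ⟨N', hN', hNm', hN0'⟩ := exists_measurable_superset_of_null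
    (hae.and (measure_eq_zero_iff_ae_notMem.1 hN0))
  have hmemN' : ∀ ξ ∉ N', _ := fun ξ hξ => not_not.1 fun h => hξ (hN' h)
  refine ⟨fun t ξ j => if ξ ∈ N' then 0 else v' j t ξ, fun t k =>
    Measurable.ite hNm' measurable_const (hv'm k t), fun ξ t j => ?_, fun t => ?_⟩
  · by_cases hξ : ξ ∈ N'
    · have h0 : field a (fun t ξ j => if ξ ∈ N' then 0 else v' j t ξ) j t ξ = 0 := by
        simp [field, hξ, Matrix.mulVec, dotProduct]
      rw [h0]
      simp only [hξ, if_true, mul_zero]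
      exact hasDerivAt_const _ _
    · obtain ⟨h1, h2⟩ := hmemN' ξ hξ
      set w : ℝ → Space n → Fin m → ℂ := fun t ξ j => v' j t ξ with hw
      have h3 : field a (fun t ξ j => if ξ ∈ N' then 0 else v' j t ξ) j t ξ = field a w j t ξ := by
        simp [field, hξ, hw]
      have h4 : ∀ r, v' j r ξ = u' 0 ξ j + Complex.I * ∫ s in (0 : ℝ)..r, field a w j s ξ := by
        intro r
        simp only [hv', h2, if_false, hv]
        congr 2
        refine intervalIntegral.integral_congr_ae ?_
        filter_upwards [h1] with s hs _
        simp only [hb, field, hw]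
        congr 2
        funext k
        exact (hs k).symm
      have h5 : Continuous fun s => field a w j s ξ := by
        simp only [field, Matrix.mulVec, dotProduct, hw]
        refine continuous_const.mul (continuous_finsetSum _ fun k _ =>
          (ha.locallyLipschitz _ _ _).continuous.mul (hv'c k ξ))
      simp only [hξ, if_false]
      rw [show (fun s => v' j s ξ) = _ from funext h4, h3]
      exact ((intervalIntegral.integral_hasDerivAt_right (h5.intervalIntegrable _ _)
        (h5.stronglyMeasurableAtFilter _ _) h5.continuousAt).const_mul _).const_add _
  · filter_upwards [measure_eq_zero_iff_ae_notMem.1 hN0', hv'u t, huV t] with ξ h1 h2 h3 j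
    simp only [h1, if_false, h2 j, hu', h3, hVdef]

end Pointwise

/-! ### Total variation of integrals, and derivatives of functions of bounded variation -/

section Superposition

open Set Filter Topology AbsolutelyContinuousOnInterval

variable {Ω : Type*} [MeasurableSpace Ω] {μ : Measure Ω} {k : Ω → ℝ → ℝ} {G : Ω → ℝ≥0∞}

lemma eVariationOn_integral_le (hk : ∀ t, Integrable (fun ω => k ω t) μ)
    (hG : ∀ᵐ ω ∂μ, eVariationOn (k ω) univ ≤ G ω) :
    eVariationOn (fun t => ∫ ω, k ω t ∂μ) univ ≤ ∫⁻ ω, G ω ∂μ := by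
  refine iSup_le fun p => ?_
  obtain ⟨n, u, hu, -⟩ := p
  calc ∑ i ∈ Finset.range n, edist (∫ ω, k ω (u (i + 1)) ∂μ) (∫ ω, k ω (u i) ∂μ)
      ≤ ∑ i ∈ Finset.range n, ∫⁻ ω, ‖k ω (u (i + 1)) - k ω (u i)‖ₑ ∂μ := by
        refine Finset.sum_le_sum fun i _ => ?_
        rw [edist_eq_enorm_sub, ← integral_sub (hk _) (hk _)]
        exact enorm_integral_le_lintegral_enorm _
    _ = ∫⁻ ω, ∑ i ∈ Finset.range n, ‖k ω (u (i + 1)) - k ω (u i)‖ₑ ∂μ :=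
        (lintegral_finsetSum' _ fun i _ => ((hk _).sub (hk _)).1.enorm).symm
    _ ≤ ∫⁻ ω, G ω ∂μ := by
        refine lintegral_mono_ae ?_
        filter_upwards [hG] with ω hω
        refine le_trans ?_ hω
        simp only [← edist_eq_enorm_sub]
        exact eVariationOn.sum_le (f := k ω) (n := n) hu fun i => mem_univ _

/-- A superposition of absolutely continuous functions is absolutely continuous, by dominated
convergence along the filter that defines absolute continuity; the total variations dominate. -/
lemma absolutelyContinuousOnInterval_integral (hk : ∀ t, Integrable (fun ω => k ω t) μ)
    (hG : ∀ᵐ ω ∂μ, eVariationOn (k ω) univ ≤ G ω) (hGm : AEMeasurable G μ)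
    (hGi : ∫⁻ ω, G ω ∂μ ≠ ⊤) {a b : ℝ}
    (hac : ∀ᵐ ω ∂μ, AbsolutelyContinuousOnInterval (k ω) a b) :
    AbsolutelyContinuousOnInterval (fun t => ∫ ω, k ω t ∂μ) a b := by
  have hcg : (totalLengthFilter (X := ℝ)).IsCountablyGenerated := by
    rw [totalLengthFilter]; infer_instance
  have hlim := tendsto_integral_filter_of_dominated_convergence (μ := μ)
    (l := totalLengthFilter (X := ℝ) ⊓ 𝓟 (disjWithin a b))
    (F := fun E ω => ∑ i ∈ Finset.range E.1, dist (k ω (E.2 i).1) (k ω (E.2 i).2))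
    (f := fun _ => (0 : ℝ)) (fun ω => (G ω).toReal)
    (Eventually.of_forall fun E => ?_) ?_ (integrable_toReal_of_lintegral_ne_top hGm hGi)
    (by filter_upwards [hac] with ω hω using hω)
  · rw [integral_zero] at hlim
    refine squeeze_zero (fun _ => Finset.sum_nonneg fun _ _ => dist_nonneg) (fun E => ?_) hlim
    rw [integral_finsetSum _ fun i _ => by
      simpa only [dist_eq_norm, Pi.sub_apply] using ((hk (E.2 i).1).sub (hk (E.2 i).2)).norm]
    refine Finset.sum_le_sum fun i _ => ?_
    rw [dist_eq_norm, ← integral_sub (hk _) (hk _)]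
    simp only [dist_eq_norm]
    exact norm_integral_le_integral_norm _
  · refine Finset.aestronglyMeasurable_fun_sum _ fun i _ => ?_
    simpa only [dist_eq_norm, Pi.sub_apply] using ((hk (E.2 i).1).sub (hk (E.2 i).2)).norm.1
  · filter_upwards [mem_inf_of_right (mem_principal_self _)] with E hE
    filter_upwards [hG, ae_lt_top' hGm hGi] with ω hω hfin
    rw [Real.norm_of_nonneg (Finset.sum_nonneg fun _ _ => dist_nonneg),
      ← ENNReal.ofReal_le_iff_le_toReal hfin.ne]
    exact (sum_dist_le_eVariationOn hE).trans hω

/-- The derivative of a function of bounded variation is bounded by that of its variation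
function, whose integral is at most the total variation. -/
lemma lintegral_enorm_deriv_le_eVariationOn (f : ℝ → ℝ) :
    ∫⁻ t, ‖deriv f t‖ₑ ≤ eVariationOn f univ := by
  by_cases hf : eVariationOn f univ = ⊤
  · rw [hf]; exact le_top
  have hbv : BoundedVariationOn f univ := hf
  have hl := hbv.locallyBoundedVariationOn
  set v := variationOnFromTo f univ 0 with hv
  have hmono : Monotone v := monotoneOn_univ.1 (variationOnFromTo.monotoneOn hl (mem_univ 0))
  have hle : ∀ x y, ‖f x - f y‖ ≤ 1 * ‖v x - v y‖ := by
    intro x y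
    rw [one_mul, Real.norm_eq_abs, Real.norm_eq_abs]
    rcases le_total y x with h | h
    · exact (variationOnFromTo.abs_sub_le_sub_of_le hl (mem_univ 0) (mem_univ _) (mem_univ _)
        h).trans (le_abs_self _)
    · rw [abs_sub_comm, abs_sub_comm (v x)]
      exact (variationOnFromTo.abs_sub_le_sub_of_le hl (mem_univ 0) (mem_univ _) (mem_univ _)
        h).trans (le_abs_self _)
  have hder : ∀ᵐ t, ‖deriv f t‖ₑ ≤ ‖deriv v t‖ₑ := by
    filter_upwards [hmono.ae_differentiableAt] with t ht
    rw [← ofReal_norm, ← ofReal_norm]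
    refine ENNReal.ofReal_le_ofReal ?_
    simpa using norm_deriv_le_of_norm_sub_le (fun x => hle x t) zero_le_one ht
  have hN : ∀ N : ℕ, ∫⁻ t in Icc (-(N : ℝ)) N, ‖deriv v t‖ₑ ≤ eVariationOn f univ := by
    intro N
    have hNN : -(N : ℝ) ≤ N := by linarith [(Nat.cast_nonneg N : (0 : ℝ) ≤ N)]
    have hmon : MonotoneOn v (uIcc (-(N : ℝ)) N) := hmono.monotoneOn _
    have h1 := hmon.intervalIntegral_deriv_mem_uIcc
    have hd0 : ∀ t, 0 ≤ deriv v t := fun t => hmono.deriv_nonneg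
    rw [uIcc_of_le (sub_nonneg.2 (hmono hNN))] at h1
    have h2 := hmon.intervalIntegrable_deriv
    rw [intervalIntegrable_iff_integrableOn_Ioc_of_le hNN] at h2
    rw [restrict_Ioc_eq_restrict_Icc.symm]
    have h3 : ∫⁻ t in Ioc (-(N : ℝ)) N, ‖deriv v t‖ₑ
        = ENNReal.ofReal (∫ t in (-(N : ℝ))..N, deriv v t) := by
      rw [intervalIntegral.integral_of_le hNN,
        ofReal_integral_eq_lintegral_ofReal h2 (ae_of_all _ hd0)]
      refine lintegral_congr fun t => ?_
      rw [← ofReal_norm, Real.norm_of_nonneg (hd0 t)]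
    rw [h3]
    refine ENNReal.ofReal_le_of_le_toReal (h1.2.trans ?_)
    rw [hv, variationOnFromTo.sub_right hl (mem_univ _) (mem_univ _) (mem_univ _)]
    exact (le_abs_self _).trans (variationOnFromTo.abs_le_eVariationOn hbv)
  refine (lintegral_mono_ae hder).trans ?_
  have hunion : (⋃ N : ℕ, Icc (-(N : ℝ)) N) = univ := by
    refine eq_univ_of_forall fun t => mem_iUnion.2 ?_
    obtain ⟨N, hN⟩ := exists_nat_ge |t|
    exact ⟨N, abs_le.1 hN⟩
  have h4 : ∫⁻ t, ‖deriv v t‖ₑ = ⨆ N : ℕ, ∫⁻ t in Icc (-(N : ℝ)) N, ‖deriv v t‖ₑ := by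
    rw [← setLIntegral_univ, ← hunion]
    refine setLIntegral_iUnion_of_directed _ ?_
    refine Monotone.directed_le fun i j hij => ?_
    have : (i : ℝ) ≤ j := by exact_mod_cast hij
    exact Icc_subset_Icc (by linarith) this
  rw [h4]
  exact iSup_le hN

lemma absolutelyContinuousOnInterval_of_dist_le {E X : Type*} [PseudoMetricSpace E]
    [PseudoMetricSpace X] {s : ℝ → X} {f : ℝ → E} {L a b : ℝ}
    (hs : AbsolutelyContinuousOnInterval s a b)
    (h : ∀ x y, dist (f x) (f y) ≤ L * dist (s x) (s y)) :
    AbsolutelyContinuousOnInterval f a b := by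
  have h1 : Tendsto (fun E : ℕ × (ℕ → ℝ × ℝ) =>
      L * ∑ i ∈ Finset.range E.1, dist (s (E.2 i).1) (s (E.2 i).2))
      (totalLengthFilter ⊓ 𝓟 (disjWithin a b)) (𝓝 (L * 0)) := Tendsto.const_mul L hs
  rw [mul_zero] at h1
  refine squeeze_zero (fun _ => Finset.sum_nonneg fun _ _ => dist_nonneg) (fun E => ?_) h1
  rw [Finset.mul_sum]
  exact Finset.sum_le_sum fun i _ => h _ _

end Superposition

/-! ### Quadratic forms on the Fourier side -/

section Form

variable {n m : ℕ}

lemma fourier_postcompCLM (T : EuclideanSpace ℂ (Fin m) →L[ℂ] EuclideanSpace ℂ (Fin m))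
    (g : 𝓢(Space n, EuclideanSpace ℂ (Fin m))) :
    𝓕 (g.postcompCLM T) = (𝓕 g).postcompCLM T := by
  ext1 ξ
  have hg : Integrable (fun x => Real.fourierChar (-inner ℝ x ξ) • g x) :=
    (Real.fourierIntegral_convergent_iff ξ).2 g.integrable
  have h1 : ∀ x, Real.fourierChar (-inner ℝ x ξ) • T (g x)
      = T (Real.fourierChar (-inner ℝ x ξ) • g x) := fun x => by
    rw [Circle.smul_def, Circle.smul_def, map_smul]
  have h2 := T.integral_comp_comm hg
  rw [SchwartzMap.postcompCLM_apply, SchwartzMap.fourier_coe, SchwartzMap.fourier_coe,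
    Real.fourier_eq, Real.fourier_eq, ← h2]
  exact integral_congr_ae (ae_of_all _ h1)

lemma compLpL_toLp (T : EuclideanSpace ℂ (Fin m) →L[ℂ] EuclideanSpace ℂ (Fin m))
    (g : 𝓢(Space n, EuclideanSpace ℂ (Fin m))) :
    T.compLpL 2 volume (g.toLp 2 : L2 n m) = (g.postcompCLM T).toLp 2 := by
  ext1
  filter_upwards [T.coeFn_compLpL (g.toLp 2 : L2 n m), g.coeFn_toLp 2,
    (g.postcompCLM T).coeFn_toLp 2] with x h1 h2 h3
  rw [h1, h2, h3, SchwartzMap.postcompCLM_apply]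

/-- The Fourier transform commutes with constant matrices. -/
lemma fourier_compLpL (T : EuclideanSpace ℂ (Fin m) →L[ℂ] EuclideanSpace ℂ (Fin m)) (f : L2 n m) :
    𝓕 (T.compLpL 2 volume f) = T.compLpL 2 volume (𝓕 f : L2 n m) := by
  have hd := SchwartzMap.denseRange_toLpCLM (E := Space n)
    (F := EuclideanSpace ℂ (Fin m)) (μ := volume) (p := 2) (by simp)
  have hc : Continuous fun f : L2 n m => (𝓕 f : L2 n m) :=
    (Lp.fourierTransformₗᵢ (Space n) (EuclideanSpace ℂ (Fin m))).continuous
  refine hd.induction_on (p := fun f : L2 n m =>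
    𝓕 (T.compLpL 2 volume f) = T.compLpL 2 volume (𝓕 f : L2 n m)) f ?_ fun g => ?_
  · exact isClosed_eq (hc.comp (T.compLpL 2 volume).continuous)
      ((T.compLpL 2 volume).continuous.comp hc)
  · rw [show SchwartzMap.toLpCLM ℝ (EuclideanSpace ℂ (Fin m)) 2 volume g = g.toLp 2 from rfl,
      SchwartzMap.toLp_fourier_eq, compLpL_toLp, compLpL_toLp, SchwartzMap.toLp_fourier_eq,
      fourier_postcompCLM]

/-- Plancherel's identity for the quadratic form of a matrix. -/
lemma quadForm_eq_fourier (S : Matrix (Fin m) (Fin m) ℂ) (U : L2 n m) :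
    quadForm S U = (∫ ξ, (S.mulVec fun j => (𝓕 U : L2 n m) ξ j) ⬝ᵥ
      star fun j => (𝓕 U : L2 n m) ξ j).re := by
  set T : EuclideanSpace ℂ (Fin m) →L[ℂ] EuclideanSpace ℂ (Fin m) :=
    (Matrix.toEuclideanLin S).toContinuousLinearMap with hT
  have h1 : ∀ V : L2 n m, ∫ x, (S.mulVec fun j => V x j) ⬝ᵥ star (fun j => V x j)
      = inner ℂ V (T.compLpL 2 volume V) := by
    intro V
    rw [L2.inner_def]
    refine integral_congr_ae ?_
    filter_upwards [T.coeFn_compLpL V] with x hx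
    rw [hx, EuclideanSpace.inner_eq_star_dotProduct]
    rfl
  rw [quadForm, h1, h1, ← fourier_compLpL, Lp.inner_fourier_eq]

end Form

/-! ### The flow on a ray -/

section RayMatrix

open Set Filter Topology
open scoped Matrix.Norms.L2Operator

variable {n m : ℕ}

/-- The matrix `y y^*` along the ray in the direction `ω`, extended by zero to `ρ ≤ 0`. -/
noncomputable def rayMatrix (y : Space n → Fin m → ℂ) (ω : USphere n) (ρ : ℝ) :
    Matrix (Fin m) (Fin m) ℂ :=
  if 0 < ρ then Matrix.vecMulVec (y (ρ • (ω : Space n))) (star (y (ρ • (ω : Space n)))) else 0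

lemma rayMatrix_of_pos (y : Space n → Fin m → ℂ) (ω : USphere n) {ρ : ℝ} (hρ : 0 < ρ)
    (j k : Fin m) :
    rayMatrix y ω ρ j k = y (ρ • (ω : Space n)) j * star (y (ρ • (ω : Space n)) k) := by
  simp [rayMatrix, hρ, Matrix.vecMulVec_apply]

/-- Frequencies in the convention `f̂(ξ) = ∫ exp(-ix·ξ) f(x) dx`. -/
noncomputable def rescale (w : Space n → Fin m → ℂ) (ξ : Space n) : Fin m → ℂ :=
  w ((2 * Real.pi)⁻¹ • ξ)

lemma integral_matrix_apply {α : Type*} [MeasurableSpace α] {μ : Measure α}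
    {f : α → Matrix (Fin m) (Fin m) ℂ} (hf : Integrable f μ) (j k : Fin m) :
    (∫ x, f x ∂μ) j k = ∫ x, f x j k ∂μ :=
  ((Matrix.entryLinearMap ℂ ℂ j k).toContinuousLinearMap.integral_comp_comm hf).symm

lemma integrable_matrix {α : Type*} [MeasurableSpace α] {μ : Measure α}
    {f : α → Matrix (Fin m) (Fin m) ℂ} (hf : ∀ j k, Integrable (fun x => f x j k) μ) :
    Integrable f μ := by
  have h1 : Integrable (fun x => ∑ j, ∑ k, f x j k • Matrix.single j k (1 : ℂ)) μ :=
    integrable_finsetSum _ fun j _ => integrable_finsetSum _ fun k _ => (hf j k).smul_const _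
  exact h1.congr (ae_of_all _ fun x => (matrix_eq_sum_smul (f x)).symm)

lemma stronglyMeasurable_matrix {α : Type*} [MeasurableSpace α]
    {f : α → Matrix (Fin m) (Fin m) ℂ} (hf : ∀ j k, Measurable (fun x => f x j k)) :
    StronglyMeasurable f := by
  have h1 : StronglyMeasurable (fun x => ∑ j, ∑ k, f x j k • Matrix.single j k (1 : ℂ)) :=
    Finset.stronglyMeasurable_fun_sum _ fun j _ => Finset.stronglyMeasurable_fun_sum _ fun k _ =>
      (hf j k).stronglyMeasurable.smul_const _
  have h2 : f = _ := funext fun x => matrix_eq_sum_smul (f x)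
  rw [h2]
  exact h1

lemma measurable_rayMatrix {y : Space n → Fin m → ℂ} (hy : ∀ k, Measurable fun ξ => y ξ k)
    (ω : USphere n) (j k : Fin m) : Measurable fun ρ => rayMatrix y ω ρ j k := by
  have h1 : (fun ρ => rayMatrix y ω ρ j k) = fun ρ : ℝ =>
      if 0 < ρ then y (ρ • (ω : Space n)) j * star (y (ρ • (ω : Space n)) k) else 0 := by
    ext1 ρ
    by_cases hρ : 0 < ρ
    · rw [rayMatrix_of_pos y ω hρ, if_pos hρ]
    · simp [rayMatrix, hρ]
  have h2 : Measurable fun ρ : ℝ => ρ • (ω : Space n) := by fun_prop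
  rw [h1]
  exact Measurable.ite measurableSet_Ioi
    (((hy j).comp h2).mul (continuous_star.measurable.comp ((hy k).comp h2))) measurable_const

variable [Nonempty (USphere n)] {A : MatSymbol n m} {Λ K : ℝ}
  {a : ℝ → USphere n → Matrix (Fin m) (Fin m) ℂ}

lemma field_ray (a : ℝ → USphere n → Matrix (Fin m) (Fin m) ℂ) (w : ℝ → Space n → Fin m → ℂ)
    (ω : USphere n) {ρ : ℝ} (hρ : 0 < ρ) (t : ℝ) (j : Fin m) :
    field a w j t ((2 * Real.pi)⁻¹ • ρ • (ω : Space n))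
      = ρ * (a t ω).mulVec (rescale (w t) (ρ • (ω : Space n))) j := by
  have h1 : dir ((2 * Real.pi)⁻¹ • ρ • (ω : Space n)) = ω := by
    rw [smul_smul]
    exact dir_smul ω (by positivity)
  have h2 : 2 * Real.pi * ‖(2 * Real.pi)⁻¹ • ρ • (ω : Space n)‖ = ρ := by
    rw [norm_smul, norm_smul, norm_eq_of_mem_sphere, Real.norm_of_nonneg hρ.le,
      Real.norm_of_nonneg (by positivity)]
    field_simp
  rw [field, h1, h2]
  rfl

/-- The matrices `v v^*` of a solution satisfy the equation of a ray flow. -/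
lemma rayFlow_of_hasDerivAt {w : ℝ → Space n → Fin m → ℂ}
    (hw : ∀ t k, Measurable fun ξ => w t ξ k)
    (hder : ∀ ξ t j, HasDerivAt (fun r => w r ξ j) (Complex.I * field a w j t ξ) t)
    {ω : USphere n} (hint : Integrable (rayMatrix (rescale (w 0)) ω) (radial n)) :
    RayFlow (fun t => a t ω) (fun t => rayMatrix (rescale (w t)) ω) (radial n) where
  stronglyMeasurable t := by
    refine stronglyMeasurable_matrix (measurable_rayMatrix (fun k => ?_) ω)
    exact (hw t k).comp (measurable_const_smul _)
  integrable := hint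
  hasDerivAt ρ t := by
    by_cases hρ : 0 < ρ
    · refine hasDerivAt_matrix fun j k => ?_
      simp only [rayMatrix_of_pos _ _ hρ]
      set v := rescale (w t) (ρ • (ω : Space n)) with hv
      have h1 : ∀ j, HasDerivAt (fun r => rescale (w r) (ρ • (ω : Space n)) j)
          (Complex.I * (ρ * (a t ω).mulVec v j)) t := by
        intro j
        have := hder ((2 * Real.pi)⁻¹ • ρ • (ω : Space n)) t j
        rwa [field_ray a w ω hρ] at this
      have h2 := (h1 j).mul (h1 k).star
      convert! h2 using 1
      have h3 : rayMatrix (rescale (w t)) ω ρ = Matrix.vecMulVec v (star v) := by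
        simp [rayMatrix, hρ, hv]
      rw [h3, Matrix.mul_vecMulVec, Matrix.vecMulVec_mul, Matrix.star_eq_conjTranspose,
        ← Matrix.star_mulVec]
      simp only [Matrix.smul_apply, Matrix.sub_apply, Matrix.vecMulVec_apply, Pi.star_apply,
        smul_eq_mul, star_mul', Complex.star_def, Complex.conj_I, Complex.conj_ofReal]
      ring
    · have h0 : ∀ r, rayMatrix (rescale (w r)) ω ρ = 0 := fun r => by simp [rayMatrix, hρ]
      simp only [h0, mul_zero, zero_mul, sub_zero, smul_zero]
      exact hasDerivAt_const _ _

end RayMatrix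

/-! ### The transform of the data along a ray -/

section Data

open Set Filter Topology
open scoped Matrix.Norms.L2Operator

variable {n m : ℕ}

/-- A translated bump function as a complex-valued test function. -/
lemma exists_schwartz_bump (f : ContDiffBump (0 : ℝ)) (x : ℝ) :
    ∃ χ : 𝓢(ℝ, ℂ), ∀ τ, χ τ = (f.normed volume (x - τ) : ℂ) := by
  have h1 : HasCompactSupport fun τ => f.normed volume (x - τ) :=
    f.hasCompactSupport_normed.comp_homeomorph (Homeomorph.subLeft x)
  have h2 : HasCompactSupport fun τ => (f.normed volume (x - τ) : ℂ) :=
    h1.comp_left (g := fun r : ℝ => (r : ℂ)) Complex.ofReal_zero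
  have h3 : ContDiff ℝ ((⊤ : ℕ∞) : WithTop ℕ∞) fun τ => (f.normed volume (x - τ) : ℂ) :=
    Complex.ofRealCLM.contDiff.comp (f.contDiff_normed.comp (contDiff_const.sub contDiff_id))
  exact ⟨h2.toSchwartzMap h3, fun τ => rfl⟩

lemma integrable_bump_smul {E : Type*} [NormedAddCommGroup E] [NormedSpace ℝ E]
    (f : ContDiffBump (0 : ℝ)) (x : ℝ) {F : ℝ → E} (hF : Integrable F) :
    Integrable fun τ => f.normed volume (x - τ) • F τ := by
  obtain ⟨C, hC⟩ := (f.continuous_normed (μ := volume)).bounded_above_of_compact_support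
    f.hasCompactSupport_normed
  exact Integrable.bdd_smul (φ := fun τ => f.normed volume (x - τ)) hF C
    (f.continuous_normed.comp (continuous_const.sub continuous_id)).aestronglyMeasurable
    (ae_of_all _ fun τ => hC _)

/-- The distributional transforms of the entries along a ray give the transform of the initial
matrices, tested with bump functions. -/
lemma initialTransform_eq_mollify (hn : 1 ≤ n) {ω : USphere n}
    {X : ℝ → ℝ → Matrix (Fin m) (Fin m) ℂ} {h : Space n → Fin m → ℂ}
    (hX : ∀ᵐ ρ ∂(radial n), ∀ j k,
      X 0 ρ j k = h (ρ • (ω : Space n)) j * star (h (ρ • (ω : Space n)) k))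
    (hXi : Integrable (X 0) (radial n)) (hXm : StronglyMeasurable (X 0))
    {F : ℝ → Matrix (Fin m) (Fin m) ℂ} (hF : Integrable F)
    (hFt : ∀ j k, IsHalfLineTransform
      (fun ρ => h (ρ • (ω : Space n)) j * star (h (ρ • (ω : Space n)) k) * (ρ : ℂ) ^ n)
      (fun τ => F τ j k))
    (f : ContDiffBump (0 : ℝ)) (x : ℝ) :
    RayFlow.initialTransform X (radial n) (bumpCutoff f) x = mollify f F x := by
  obtain ⟨χ, hχ⟩ := exists_schwartz_bump f x
  obtain ⟨C, hC⟩ := exists_isCutoff_bumpCutoff f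
  have hC0 : 0 ≤ C := (norm_nonneg _).trans (hC.norm_le 0)
  have hint : Integrable (fun ρ : ℝ =>
      (bumpCutoff f ρ * ρ * Complex.exp (Complex.I * (ρ * x : ℝ))) • X 0 ρ) (radial n) := by
    refine (hXi.norm.const_mul C).mono' ?_ (ae_of_all _ fun ρ => ?_)
    · refine StronglyMeasurable.aestronglyMeasurable ?_
      refine ((RayFlow.stronglyMeasurable_cutoff hC).mul ?_).smul hXm
      exact Continuous.stronglyMeasurable (by fun_prop)
    · rw [norm_smul, norm_mul, mul_comm Complex.I, Complex.norm_exp_ofReal_mul_I, mul_one]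
      gcongr
      exact hC.norm_mul_le ρ
  ext j k
  rw [RayFlow.initialTransform, integral_matrix_apply hint, mollify,
    integral_matrix_apply (integrable_bump_smul f x hF)]
  have h1 : ∫ τ, (f.normed volume (x - τ) • F τ) j k = ∫ τ, F τ j k * χ τ := by
    refine integral_congr_ae (ae_of_all _ fun τ => ?_)
    simp only [hχ, Matrix.smul_apply, Complex.real_smul]
    ring
  rw [h1, hFt j k χ]
  have h2 : ∫ ρ, ((bumpCutoff f ρ * ρ * Complex.exp (Complex.I * (ρ * x : ℝ))) • X 0 ρ) j k
      ∂(radial n) = ∫ ρ : ℝ, (bumpCutoff f ρ * ρ * Complex.exp (Complex.I * (ρ * x : ℝ)))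
        * (h (ρ • (ω : Space n)) j * star (h (ρ • (ω : Space n)) k)) ∂(radial n) := by
    refine integral_congr_ae ?_
    filter_upwards [hX] with ρ hρ
    rw [Matrix.smul_apply, smul_eq_mul, hρ]
  rw [h2, integral_radial]
  refine setIntegral_congr_fun measurableSet_Ioi fun ρ _ => ?_
  have h3 : ∫ τ : ℝ, Complex.exp (Complex.I * τ * ρ) * χ τ
      = Complex.exp (Complex.I * (ρ * x : ℝ)) * bumpCutoff f ρ := by
    rw [← integral_exp_mul_bump]
    exact integral_congr_ae (ae_of_all _ fun τ => by simp only [hχ])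
  -- the weight `ρ^n` of the ray transform is `ρ` times the radial density `ρ^{n-1}`
  obtain ⟨p, rfl⟩ : ∃ p, n = p + 1 := ⟨n - 1, by omega⟩
  simp only [h3, Complex.real_smul, Nat.add_sub_cancel]
  push_cast
  ring

end Data

/-! ### Variation of quadratic forms of solutions -/

section QuadForm

open Set Filter Topology
open scoped Matrix.Norms.L2Operator

variable {n m : ℕ}

/-- The linear functional `M ↦ tr (S M)`, which on `v v^*` is the quadratic form of `S`. -/
noncomputable def traceForm (S : Matrix (Fin m) (Fin m) ℂ) : Matrix (Fin m) (Fin m) ℂ →L[ℂ] ℂ :=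
  (Matrix.traceLinearMap (Fin m) ℂ ℂ ∘ₗ LinearMap.mulLeft ℂ S).toContinuousLinearMap

lemma traceForm_vecMulVec (S : Matrix (Fin m) (Fin m) ℂ) (v : Fin m → ℂ) :
    traceForm S (Matrix.vecMulVec v (star v)) = S.mulVec v ⬝ᵥ star v := by
  change (S * Matrix.vecMulVec v (star v)).trace = _
  rw [Matrix.mul_vecMulVec, Matrix.trace_vecMulVec]

/-- The constant in the bound for the variation of `⟨SU, U⟩`. The factor `(2π)^{-n}` comes from
Plancherel's identity. -/
noncomputable def variationConst (n : ℕ) (S : Matrix (Fin m) (Fin m) ℂ) (B : ℝ) : ℝ :=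
  ((2 * Real.pi)⁻¹) ^ n * ‖traceForm S‖ * (2 * (Fintype.card (Fin m)) ^ 2 * B ^ 2) * unitSum m

lemma variationConst_nonneg (n : ℕ) (S : Matrix (Fin m) (Fin m) ℂ) (B : ℝ) :
    0 ≤ variationConst n S B := by
  unfold variationConst unitSum; positivity

variable {A : MatSymbol n m} {U₀ : L2 n m} {U : ℝ → L2 n m} {Λ K B : ℝ}
  {a : ℝ → USphere n → Matrix (Fin m) (Fin m) ℂ}

/-- The contribution of a single ray to the quadratic form. -/
noncomputable def rayForm (S : Matrix (Fin m) (Fin m) ℂ) (y : Space n → Fin m → ℂ)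
    (ω : USphere n) : ℝ :=
  ((2 * Real.pi)⁻¹) ^ n * (traceForm S (∫ ρ, rayMatrix y ω ρ ∂(radial n))).re

lemma enorm_of_le (M : Fin m → Fin m → ℂ) :
    ‖Matrix.of M‖ₑ ≤ ENNReal.ofReal (unitSum m) * ∑ j, ∑ l, ‖M j l‖ₑ := by
  have h1 : ‖Matrix.of M‖ ≤ (∑ j, ∑ l, ‖M j l‖) * unitSum m := by
    refine norm_matrix_le fun j l => ?_
    refine le_trans ?_ (Finset.single_le_sum
      (f := fun j => ∑ l, ‖M j l‖) (fun _ _ => by positivity) (Finset.mem_univ j))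
    exact Finset.single_le_sum (f := fun l => ‖M j l‖) (fun _ _ => by positivity)
      (Finset.mem_univ l)
  rw [← ofReal_norm, mul_comm]
  refine (ENNReal.ofReal_le_ofReal h1).trans (le_of_eq ?_)
  rw [ENNReal.ofReal_mul (by positivity),
    ENNReal.ofReal_sum_of_nonneg fun _ _ => by positivity]
  congr 1
  refine Finset.sum_congr rfl fun j _ => ?_
  rw [ENNReal.ofReal_sum_of_nonneg fun _ _ => by positivity]
  simp only [ofReal_norm]

lemma lintegral_enorm_of_le {M : Fin m → Fin m → ℝ → ℂ}
    (hM : ∀ j l, AEMeasurable fun τ => ‖M j l τ‖ₑ) :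
    ∫⁻ τ, ‖Matrix.of fun j l => M j l τ‖ₑ
      ≤ ENNReal.ofReal (unitSum m) * ∑ j, ∑ l, ∫⁻ τ, ‖M j l τ‖ₑ := by
  have h1 : ∑ j, ∑ l, ∫⁻ τ, ‖M j l τ‖ₑ = ∫⁻ τ, ∑ j, ∑ l, ‖M j l τ‖ₑ := by
    rw [lintegral_finsetSum' _ fun j _ => Finset.aemeasurable_fun_sum _ fun l _ => hM j l]
    exact Finset.sum_congr rfl fun j _ => (lintegral_finsetSum' _ fun l _ => hM j l).symm
  rw [h1, ← lintegral_const_mul' _ _ ENNReal.ofReal_ne_top]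
  exact lintegral_mono fun τ => enorm_of_le fun j l => M j l τ

lemma dist_re_traceForm_le (S : Matrix (Fin m) (Fin m) ℂ) {c : ℝ} (hc : 0 ≤ c)
    (M N : Matrix (Fin m) (Fin m) ℂ) :
    dist (c * (traceForm S M).re) (c * (traceForm S N).re) ≤ c * ‖traceForm S‖ * dist M N := by
  rw [Real.dist_eq, ← mul_sub, abs_mul, abs_of_nonneg hc, ← Complex.sub_re, ← map_sub,
    mul_assoc, dist_eq_norm]
  gcongr
  exact (Complex.abs_re_le_norm _).trans ((traceForm S).le_opNorm _)

/-- Total variation and absolute continuity of the contribution of a single ray. -/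
lemma rayForm_variation [Nonempty (USphere n)] (hn : 1 ≤ n) {w : ℝ → Space n → Fin m → ℂ}
    (hwm : ∀ t k, Measurable fun ξ => w t ξ k)
    (hder : ∀ ξ t j, HasDerivAt (fun r => w r ξ j) (Complex.I * field a w j t ξ) t)
    {ω : USphere n} {h : Space n → Fin m → ℂ} {M : Fin m → Fin m → ℝ → ℂ}
    (hM : ∀ j l, Integrable (M j l))
    (hMt : ∀ j l, IsHalfLineTransform
      (fun ρ => h (ρ • (ω : Space n)) j * star (h (ρ • (ω : Space n)) l) * (ρ : ℂ) ^ n) (M j l))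
    (hdata : ∀ᵐ ρ ∂(radial n), ∀ j,
      rescale (w 0) (ρ • (ω : Space n)) j = h (ρ • (ω : Space n)) j)
    (hint : Integrable (rayMatrix (rescale (w 0)) ω) (radial n))
    {φ : Fin m → ℝ → ℝ} {P : Fin m → ℝ → Matrix (Fin m) (Fin m) ℂ}
    (hspec : SpectralFamily (fun t => a t ω) φ P B) (S : Matrix (Fin m) (Fin m) ℂ) :
    eVariationOn (fun t => rayForm S (rescale (w t)) ω) univ
        ≤ ENNReal.ofReal (variationConst n S B) * ∑ j, ∑ l, ∫⁻ τ, ‖M j l τ‖ₑ ∧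
      ∀ s t, AbsolutelyContinuousOnInterval (fun t => rayForm S (rescale (w t)) ω) s t := by
  have hX := rayFlow_of_hasDerivAt hwm hder hint
  have hMi : Integrable fun τ => Matrix.of fun j l => M j l τ := integrable_matrix fun j l => hM j l
  have hXe : ∀ᵐ ρ ∂(radial n), ∀ j l, rayMatrix (rescale (w 0)) ω ρ j l
      = h (ρ • (ω : Space n)) j * star (h (ρ • (ω : Space n)) l) := by
    filter_upwards [hdata, ae_radial_pos n] with ρ h5 hρ j l
    rw [rayMatrix_of_pos _ _ hρ, h5, h5]
  have hvar := hX.variation_integral hspec hMi fun f x =>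
    initialTransform_eq_mollify (X := fun t => rayMatrix (rescale (w t)) ω) hn hXe hint
      (hX.stronglyMeasurable 0) hMi hMt f x
  set c : ℝ := ((2 * Real.pi)⁻¹) ^ n with hc
  have hc0 : 0 ≤ c := by positivity
  have hκ : 0 ≤ unitSum m := by unfold unitSum; positivity
  refine ⟨?_, fun s t => absolutelyContinuousOnInterval_of_dist_le (hvar.2 s t)
    fun x y => dist_re_traceForm_le S hc0 _ _⟩
  have hL : LipschitzOnWith (c * ‖traceForm S‖).toNNReal
      (fun M : Matrix (Fin m) (Fin m) ℂ => c * (traceForm S M).re) univ := by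
    refine LipschitzOnWith.of_dist_le_mul fun M _ N _ => ?_
    rw [Real.coe_toNNReal _ (by positivity)]
    exact dist_re_traceForm_le S hc0 M N
  have h1 := hL.comp_eVariationOn_le (s := univ)
    (g := fun t => ∫ ρ, rayMatrix (rescale (w t)) ω ρ ∂(radial n)) (mapsTo_univ _ _)
  have h2 := lintegral_enorm_of_le fun j l => (hM j l).1.enorm
  calc eVariationOn (fun t => rayForm S (rescale (w t)) ω) univ
      ≤ ENNReal.ofReal (c * ‖traceForm S‖) *
        (ENNReal.ofReal (2 * (Fintype.card (Fin m)) ^ 2 * B ^ 2) *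
          (ENNReal.ofReal (unitSum m) * ∑ j, ∑ l, ∫⁻ τ, ‖M j l τ‖ₑ)) := by
        refine h1.trans ?_
        gcongr
        · exact le_rfl
        · exact hvar.1.trans (by gcongr)
    _ = _ := by
        rw [variationConst, ← hc, ← mul_assoc, ← mul_assoc, ← ENNReal.ofReal_mul (by positivity),
          ← ENNReal.ofReal_mul (by positivity)]

lemma integrable_mul_star {V : L2 n m} {w : Space n → Fin m → ℂ}
    (hw : ∀ k, Measurable fun ξ => w ξ k) (hwV : ∀ᵐ ξ, ∀ j, w ξ j = V ξ j) (j k : Fin m) :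
    Integrable fun ξ => w ξ j * star (w ξ k) := by
  refine (integrable_norm_sq V).mono'
    ((hw j).mul (continuous_star.measurable.comp (hw k))).aestronglyMeasurable ?_
  filter_upwards [hwV] with ξ hξ
  rw [norm_mul, norm_star, hξ, hξ, sq]
  gcongr <;> exact PiLp.norm_apply_le _ _

lemma integrable_rayMatrix (hn : 1 ≤ n) {y : Space n → Fin m → ℂ}
    (hy : ∀ j k, Integrable fun ξ => y ξ j * star (y ξ k)) :
    ∀ᵐ ω ∂(surf n), Integrable (rayMatrix y ω) (radial n) := by
  have h1 : ∀ᵐ ω : USphere n ∂(surf n), ∀ j k, Integrable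
      (fun ρ => y (ρ • (ω : Space n)) j * star (y (ρ • (ω : Space n)) k)) (radial n) := by
    simp only [ae_all_iff]
    exact fun j k => (integral_polar hn (hy j k)).1.prod_right_ae
  filter_upwards [h1] with ω hω
  refine integrable_matrix fun j k => (hω j k).congr ?_
  filter_upwards [ae_radial_pos n] with ρ hρ
  rw [rayMatrix_of_pos y ω hρ]

/-- The quadratic form as an integral over directions of the ray integrals of `v v^*`. -/
lemma quadForm_eq_integral (hn : 1 ≤ n) (S : Matrix (Fin m) (Fin m) ℂ) {V : L2 n m}
    {w : Space n → Fin m → ℂ} (hw : ∀ k, Measurable fun ξ => w ξ k)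
    (hwV : ∀ᵐ ξ, ∀ j, w ξ j = (𝓕 V : L2 n m) ξ j) :
    Integrable (rayForm S (rescale w)) (surf n) ∧
      quadForm S V = ∫ ω, rayForm S (rescale w) ω ∂(surf n) := by
  unfold rayForm
  set c : ℝ := ((2 * Real.pi)⁻¹) ^ n with hc
  have hc0 : c ≠ 0 := by positivity
  set y := rescale w with hy
  have hyi : ∀ j k, Integrable fun ξ => y ξ j * star (y ξ k) := fun j k =>
    (integrable_mul_star hw hwV j k).comp_smul (by positivity : (2 * Real.pi)⁻¹ ≠ 0)
  set f : Space n → ℂ := fun ξ => traceForm S (Matrix.vecMulVec (y ξ) (star (y ξ))) with hf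
  have hMi : Integrable fun ξ => Matrix.vecMulVec (y ξ) (star (y ξ)) :=
    integrable_matrix fun j k => hyi j k
  have hfi : Integrable f := (traceForm S).integrable_comp hMi
  obtain ⟨hpi, hp⟩ := integral_polar hn hfi
  have hray : (fun ω : USphere n => ∫ ρ, f (ρ • (ω : Space n)) ∂(radial n)) =ᵐ[surf n]
      fun ω => traceForm S (∫ ρ, rayMatrix y ω ρ ∂(radial n)) := by
    filter_upwards [integrable_rayMatrix hn hyi] with ω hω
    rw [← (traceForm S).integral_comp_comm hω]
    refine integral_congr_ae ?_
    filter_upwards [ae_radial_pos n] with ρ hρ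
    simp only [hf, rayMatrix, hρ, if_true]
  have hg : Integrable (fun ω => traceForm S (∫ ρ, rayMatrix y ω ρ ∂(radial n))) (surf n) :=
    hpi.integral_prod_left.congr hray
  refine ⟨(Complex.reCLM.integrable_comp hg).const_mul c, ?_⟩
  have h1 : ∫ ξ, f ξ = ((c⁻¹ : ℝ) : ℂ) * ∫ ξ, S.mulVec (w ξ) ⬝ᵥ star (w ξ) := by
    have h2 := Measure.integral_comp_smul_of_nonneg volume
      (fun ξ : Space n => S.mulVec (w ξ) ⬝ᵥ star (w ξ)) (2 * Real.pi)⁻¹ (hR := by positivity)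
    rw [finrank_euclideanSpace_fin, Complex.real_smul] at h2
    rw [← h2]
    simp only [hf, traceForm_vecMulVec]
    rfl
  have h3 : quadForm S V = (∫ ξ, S.mulVec (w ξ) ⬝ᵥ star (w ξ)).re := by
    rw [quadForm_eq_fourier]
    congr 1
    refine integral_congr_ae ?_
    filter_upwards [hwV] with ξ hξ
    have : w ξ = fun j => (𝓕 V : L2 n m) ξ j := funext hξ
    rw [this]
  have h4 : ∫ ξ, S.mulVec (w ξ) ⬝ᵥ star (w ξ) = (c : ℂ) * ∫ ξ, f ξ := by
    rw [h1, ← mul_assoc, ← Complex.ofReal_mul, mul_inv_cancel₀ hc0, Complex.ofReal_one, one_mul]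
  rw [h3, h4, Complex.re_ofReal_mul, hp, integral_congr_ae hray, integral_const_mul]
  congr 1
  exact (Complex.reCLM.integral_comp_comm hg).symm

/-- The function `t ↦ ⟨SU(t), U(t)⟩` is absolutely continuous, and its total variation is bounded
by the `L¹` norms of the transforms of the data along rays. -/
theorem IsSolution.eVariationOn_quadForm_le (hn : 1 ≤ n) [Nonempty (USphere n)]
    (hom : HomogeneousOne A) (ha : IsRegular Λ K A a) (hU : IsSolution A U₀ U)
    (hspec : ∀ᵐ ω ∂(surf n), ∃ (φ : Fin m → ℝ → ℝ) (P : Fin m → ℝ → Matrix (Fin m) (Fin m) ℂ),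
      SpectralFamily (fun t => a t ω) φ P B)
    (S : Matrix (Fin m) (Fin m) ℂ) {F : Fin m → Fin m → ℝ × USphere n → ℂ}
    (hF : ∀ j k, IsRayTransform U₀ j k (F j k)) :
    eVariationOn (fun t => quadForm S (U t)) univ ≤ ENNReal.ofReal (variationConst n S B) *
        ∑ j, ∑ k, ∫⁻ τ : ℝ, ∫⁻ ω, ‖F j k (τ, ω)‖ₑ ∂(surf n) ∧
      ∀ s t, AbsolutelyContinuousOnInterval (fun t => quadForm S (U t)) s t := by
  obtain ⟨w, hwm, hder, hwU⟩ := hU.exists_pointwise hn hom ha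
  have hq := fun t => quadForm_eq_integral hn S (hwm t) (hwU t)
  have hπ : (2 * Real.pi)⁻¹ ≠ 0 := by positivity
  set G₀ : USphere n → ℝ≥0∞ := fun ω => ∑ j, ∑ l, ∫⁻ τ : ℝ, ‖F j l (τ, ω)‖ₑ with hG₀
  -- the transforms along almost every ray
  have hslice : ∀ᵐ ω : USphere n ∂(surf n), ∀ j l, Integrable (fun τ => F j l (τ, ω)) := by
    simp only [ae_all_iff]
    exact fun j l => (hF j l).1.prod_left_ae
  have htrans : ∀ᵐ ω : USphere n ∂(surf n), ∀ j l, IsHalfLineTransform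
      (fun ρ => hat U₀ (ρ • (ω : Space n)) j * star (hat U₀ (ρ • (ω : Space n)) l) * (ρ : ℂ) ^ n)
      (fun τ => F j l (τ, ω)) := by
    simp only [ae_all_iff]
    exact fun j l => (hF j l).2
  have hdata : ∀ᵐ ω : USphere n ∂(surf n), ∀ᵐ ρ ∂(radial n), ∀ j,
      rescale (w 0) (ρ • (ω : Space n)) j = hat U₀ (ρ • (ω : Space n)) j := by
    have h1 := (Measure.quasiMeasurePreserving_smul (volume : Measure (Space n)) hπ).ae (hwU 0)
    rw [hU.initial] at h1
    exact ae_ae_ray hn (q := fun ξ => ∀ j, rescale (w 0) ξ j = hat U₀ ξ j) h1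
  have hX0 : ∀ᵐ ω ∂(surf n), Integrable (rayMatrix (rescale (w 0)) ω) (radial n) :=
    integrable_rayMatrix hn fun j l =>
      (integrable_mul_star (hwm 0) (hwU 0) j l).comp_smul hπ
  have hmain : ∀ᵐ ω ∂(surf n), eVariationOn (fun t => rayForm S (rescale (w t)) ω) univ
      ≤ ENNReal.ofReal (variationConst n S B) * G₀ ω ∧
      ∀ s t, AbsolutelyContinuousOnInterval (fun t => rayForm S (rescale (w t)) ω) s t := by
    filter_upwards [hslice, htrans, hdata, hX0, hspec] with ω h1 h2 h3 h4 ⟨φ, P, h5⟩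
    exact rayForm_variation hn hwm hder h1 h2 h3 h4 h5 S
  have hFm : ∀ j l, AEMeasurable (fun p : ℝ × USphere n => ‖F j l p‖ₑ) (volume.prod (surf n)) :=
    fun j l => (hF j l).1.1.enorm
  have hFm' : ∀ j l, AEMeasurable (fun ω : USphere n => ∫⁻ τ : ℝ, ‖F j l (τ, ω)‖ₑ) (surf n) :=
    fun j l => (hFm j l).lintegral_prod_left'
  have hGm : AEMeasurable G₀ (surf n) :=
    Finset.aemeasurable_fun_sum _ fun j _ => Finset.aemeasurable_fun_sum _ fun l _ => hFm' j l
  have hGint : ∫⁻ ω, ENNReal.ofReal (variationConst n S B) * G₀ ω ∂(surf n)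
      = ENNReal.ofReal (variationConst n S B) *
        ∑ j, ∑ l, ∫⁻ τ : ℝ, ∫⁻ ω, ‖F j l (τ, ω)‖ₑ ∂(surf n) := by
    rw [lintegral_const_mul' _ _ ENNReal.ofReal_ne_top, hG₀, lintegral_finsetSum' _ fun j _ =>
      Finset.aemeasurable_fun_sum _ fun l _ => hFm' j l]
    congr 1
    refine Finset.sum_congr rfl fun j _ => ?_
    rw [lintegral_finsetSum' _ fun l _ => hFm' j l]
    exact Finset.sum_congr rfl fun l _ =>
      (lintegral_lintegral_swap (f := fun τ ω => ‖F j l (τ, ω)‖ₑ) (hFm j l)).symm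
  have hfin : ∫⁻ ω, ENNReal.ofReal (variationConst n S B) * G₀ ω ∂(surf n) ≠ ⊤ := by
    rw [hGint]
    refine ENNReal.mul_ne_top ENNReal.ofReal_ne_top ?_
    refine (ENNReal.sum_lt_top.2 fun j _ => ENNReal.sum_lt_top.2 fun l _ => ?_).ne
    rw [← lintegral_prod _ (hFm j l)]
    exact (hF j l).1.2
  have hfun : (fun t => quadForm S (U t))
      = fun t => ∫ ω, rayForm S (rescale (w t)) ω ∂(surf n) := funext fun t => (hq t).2
  rw [hfun]
  have hmain1 := hmain.mono fun _ h => h.1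
  refine ⟨?_, fun s t => ?_⟩
  · rw [← hGint]
    exact eVariationOn_integral_le (k := fun ω t => rayForm S (rescale (w t)) ω)
      (fun t => (hq t).1) hmain1
  · exact absolutelyContinuousOnInterval_integral (k := fun ω t => rayForm S (rescale (w t)) ω)
      (fun t => (hq t).1) hmain1 (hGm.const_mul _) hfin (hmain.mono fun _ h => h.2 s t)

end QuadForm

/-! ### Coefficients of Kirchhoff systems -/

section Coefficient

open Set Filter Topology
open scoped Matrix.Norms.L2Operator

variable {n m : ℕ}

lemma nonempty_uSphere (hn : 1 ≤ n) : Nonempty (USphere n) :=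
  ⟨⟨EuclideanSpace.single ⟨0, hn⟩ 1, by simp⟩⟩

lemma linf_le_of_ae_le {F : USphere n → Fin m → Fin m → ℂ} {C : ℝ≥0∞}
    (h : ∀ᵐ ω ∂(surf n), ∀ j k, ‖F ω j k‖ₑ ≤ C) : linf F ≤ C := by
  rw [linf, eLpNorm_exponent_top]
  refine eLpNormEssSup_le_of_ae_enorm_bound ?_
  filter_upwards [h] with ω hω
  rw [← edist_zero_right, edist_pi_le_iff]
  refine fun j => edist_pi_le_iff.2 fun k => ?_
  rw [Pi.zero_apply, Pi.zero_apply, edist_zero_right]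
  exact hω j k

lemma ae_le_linf (F : USphere n → Fin m → Fin m → ℂ) :
    ∀ᵐ ω ∂(surf n), ∀ j k, ‖F ω j k‖ₑ ≤ linf F := by
  have h : ∀ᵐ ω ∂(surf n), ‖F ω‖ₑ ≤ linf F := ae_le_eLpNormEssSup
  filter_upwards [h] with ω hω j k
  refine le_trans ?_ hω
  rw [← ofReal_norm, ← ofReal_norm]
  exact ENNReal.ofReal_le_ofReal ((norm_le_pi_norm (F ω j) k).trans (norm_le_pi_norm (F ω) j))

lemma LipOn.linf_le {J : Set ℝ} {L : ℝ} {𝒜 : MatSymbol n m} (h : LipOn J L 𝒜) {s t : ℝ}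
    (hs : s ∈ J) (ht : t ∈ J) :
    linf (fun (ω : USphere n) j k => 𝒜 s (ω : Space n) j k)
      ≤ linf (fun (ω : USphere n) j k => 𝒜 t (ω : Space n) j k)
        + ENNReal.ofReal (L * |s - t|) := by
  refine linf_le_of_ae_le ?_
  filter_upwards [h, ae_le_linf fun (ω : USphere n) j k => 𝒜 t (ω : Space n) j k]
    with ω h1 h2 j k
  calc ‖𝒜 s (ω : Space n) j k‖ₑ
      = ‖𝒜 t (ω : Space n) j k + (𝒜 s (ω : Space n) j k - 𝒜 t (ω : Space n) j k)‖ₑ := by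
        rw [add_sub_cancel]
    _ ≤ ‖𝒜 t (ω : Space n) j k‖ₑ + ‖𝒜 s (ω : Space n) j k - 𝒜 t (ω : Space n) j k‖ₑ :=
        enorm_add_le _ _
    _ ≤ _ := by
        gcongr
        · exact h2 j k
        · rw [← ofReal_norm]
          exact ENNReal.ofReal_le_ofReal (h1 s hs t ht j k)

lemma LipOn.lintegral_linf_deriv_le {J : Set ℝ} {L : ℝ} {𝒜 : MatSymbol n m} (h : LipOn J L 𝒜)
    (hL : 0 ≤ L) {s : ℝ → ℝ} (hs : ∀ t, s t ∈ J) (hbv : BoundedVariationOn s univ) :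
    ∫⁻ t, linf (fun (ω : USphere n) j k => deriv (fun r => 𝒜 (s r) (ω : Space n) j k) t)
      ≤ ENNReal.ofReal L * eVariationOn s univ := by
  refine le_trans ?_ (mul_le_mul_right (lintegral_enorm_deriv_le_eVariationOn s) _)
  rw [← lintegral_const_mul' _ _ ENNReal.ofReal_ne_top]
  refine lintegral_mono_ae ?_
  filter_upwards [hbv.locallyBoundedVariationOn.ae_differentiableAt] with t ht
  refine linf_le_of_ae_le ?_
  filter_upwards [h] with ω hω j k
  rw [← ofReal_norm, ← ofReal_norm, ← ENNReal.ofReal_mul hL]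
  exact ENNReal.ofReal_le_ofReal
    (norm_deriv_le_of_norm_sub_le (fun x => hω _ (hs x) _ (hs t) j k) hL ht)

lemma LipOn.absolutelyContinuousOnInterval {J : Set ℝ} {L : ℝ} {𝒜 : MatSymbol n m}
    (h : LipOn J L 𝒜) {s : ℝ → ℝ} (hs : ∀ t, s t ∈ J)
    (hac : ∀ a b, AbsolutelyContinuousOnInterval s a b) :
    ∀ᵐ ω : USphere n ∂(surf n), ∀ j k a b,
      AbsolutelyContinuousOnInterval (fun t => 𝒜 (s t) (ω : Space n) j k) a b := by
  filter_upwards [h] with ω hω j k a b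
  refine absolutelyContinuousOnInterval_of_dist_le (hac a b) (L := L) fun x y => ?_
  rw [dist_eq_norm, Real.dist_eq]
  exact hω _ (hs x) _ (hs y) j k

/-- For data of class `𝒴`, near-optimal ray transforms exist. -/
lemma MemY.exists_isRayTransform {U₀ : L2 n m} (hY : MemY U₀) {ε : ℝ≥0∞} (hε : 0 < ε) :
    ∃ F : Fin m → Fin m → ℝ × USphere n → ℂ, (∀ j k, IsRayTransform U₀ j k (F j k)) ∧
      ∑ j, ∑ k, ∫⁻ τ : ℝ, ∫⁻ ω, ‖F j k (τ, ω)‖ₑ ∂(surf n) ≤ yNorm U₀ + m * (m * ε) := by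
  have hfin : ∀ j k, (⨅ (F : ℝ × USphere n → ℂ) (_ : IsRayTransform U₀ j k F),
      ∫⁻ τ : ℝ, ∫⁻ ω, ‖F (τ, ω)‖ₑ ∂(surf n)) ≠ ⊤ := fun j k =>
    (ENNReal.sum_lt_top.1 (ENNReal.sum_lt_top.1 hY j (Finset.mem_univ j)) k
      (Finset.mem_univ k)).ne
  have h := fun j k => ENNReal.lt_add_right (hfin j k) hε.ne'
  simp only [iInf_lt_iff] at h
  choose F hF hle using h
  refine ⟨F, hF, ?_⟩
  calc ∑ j, ∑ k, ∫⁻ τ : ℝ, ∫⁻ ω, ‖F j k (τ, ω)‖ₑ ∂(surf n)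
      ≤ ∑ j, ∑ k, ((⨅ (F : ℝ × USphere n → ℂ) (_ : IsRayTransform U₀ j k F),
          ∫⁻ τ : ℝ, ∫⁻ ω, ‖F (τ, ω)‖ₑ ∂(surf n)) + ε) :=
        Finset.sum_le_sum fun j _ => Finset.sum_le_sum fun k _ => (hle j k).le
    _ = yNorm U₀ + m * (m * ε) := by
        simp [Finset.sum_add_distrib, yNorm]

/-- Under smallness of the variation of the symbol, `⟨SU, U⟩` is absolutely continuous and its
total variation is controlled by `|U₀|_𝒴`. -/
theorem exists_eVariationOn_quadForm_le (hn : 1 ≤ n) (S : Matrix (Fin m) (Fin m) ℂ) {Λ d : ℝ}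
    (hΛ : 0 ≤ Λ) (hd : 0 < d) :
    ∃ K₀ D : ℝ, 0 < K₀ ∧ 0 ≤ D ∧ ∀ K ≤ K₀, ∀ A : MatSymbol n m,
      ClassK Λ K A → StrictlyHyperbolic d A → ∀ (U₀ : L2 n m) (U : ℝ → L2 n m),
      MemY U₀ → IsSolution A U₀ U →
        eVariationOn (fun t => quadForm S (U t)) univ ≤ ENNReal.ofReal D * yNorm U₀ ∧
        ∀ a b, AbsolutelyContinuousOnInterval (fun t => quadForm S (U t)) a b := by
  have := nonempty_uSphere hn
  obtain ⟨K₀, B, hK₀, hspec⟩ := exists_spectralFamily m hd Λ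
  refine ⟨K₀, variationConst n S B, hK₀, variationConst_nonneg n S B, ?_⟩
  intro K hK A hA hhyp U₀ U hY hU
  obtain ⟨a, ha⟩ := hA.exists_isRegular hΛ
  obtain ⟨φ, hφ⟩ := hhyp
  have hfam : ∀ᵐ ω ∂(surf n), ∃ (φ : Fin m → ℝ → ℝ)
      (P : Fin m → ℝ → Matrix (Fin m) (Fin m) ℂ), SpectralFamily (fun t => a t ω) φ P B := by
    filter_upwards [hφ, ha.ae_eq, ha.variation] with ω h1 h2 h3
    refine hspec (fun t => a t ω) (ha.locallyLipschitz ω) (fun t => ha.norm_le t ω)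
      (fun j k => (h3 j k).trans (ENNReal.ofReal_le_ofReal hK)) fun t =>
        ⟨fun j => φ j t ω, ?_, (h1 t).2⟩
    rw [h2 t]
    exact (h1 t).1
  have key := fun (F : Fin m → Fin m → ℝ × USphere n → ℂ)
    (hF : ∀ j k, IsRayTransform U₀ j k (F j k)) =>
      hU.eVariationOn_quadForm_le hn hA.homogeneous ha hfam S hF
  refine ⟨?_, ?_⟩
  · set D := ENNReal.ofReal (variationConst n S B)
    have hlim : Tendsto (fun ε : ℝ≥0∞ => D * (yNorm U₀ + m * (m * ε))) (𝓝[>] 0)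
        (𝓝 (D * (yNorm U₀ + m * (m * 0)))) := by
      refine Tendsto.mono_left ?_ nhdsWithin_le_nhds
      refine ENNReal.Tendsto.const_mul (Tendsto.add tendsto_const_nhds ?_)
        (Or.inr ENNReal.ofReal_ne_top)
      exact ENNReal.Tendsto.const_mul (ENNReal.Tendsto.const_mul tendsto_id
        (Or.inr (ENNReal.natCast_ne_top m))) (Or.inr (ENNReal.natCast_ne_top m))
    rw [mul_zero, mul_zero, add_zero] at hlim
    refine ge_of_tendsto hlim ?_
    filter_upwards [self_mem_nhdsWithin] with ε hε
    obtain ⟨F, hF, hle⟩ := hY.exists_isRayTransform hε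
    exact (key F hF).1.trans (by gcongr)
  · obtain ⟨F, hF, -⟩ := hY.exists_isRayTransform one_pos
    exact (key F hF).2

end Coefficient

end KirchhoffSystem

theorem mainTheorem2 (n m : ℕ) (hn : 1 ≤ n) (S : Matrix (Fin m) (Fin m) ℂ) (hS : S.IsHermitian)
    (Λ d L : ℝ) (hΛ : 0 < Λ) (hd : 0 < d) (hL : 0 ≤ L) :
    ∃ K₀ M c : ℝ, 0 < K₀ ∧ 0 < M ∧ 0 < c ∧ c * K₀ < 1 ∧
      ∀ (K : ℝ), 0 < K → K ≤ K₀ →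
      -- the linear symbol `A(t, ξ)`
      ∀ (A : KirchhoffSystem.MatSymbol n m),
        KirchhoffSystem.ClassK Λ K A → KirchhoffSystem.StrictlyHyperbolic d A →
      -- the coefficient `𝒜(s, ξ)` of the Kirchhoff system, defined for `s ∈ J`
      ∀ (J : Set ℝ) (𝒜 : KirchhoffSystem.MatSymbol n m),
        KirchhoffSystem.KirchhoffCoefficient J L 𝒜 →
      -- data, solution, and the function `s(t)`
      ∀ (U₀ : KirchhoffSystem.L2 n m) (U : ℝ → KirchhoffSystem.L2 n m),
        KirchhoffSystem.MemY U₀ → KirchhoffSystem.IsSolution A U₀ U →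
      ∀ (s : ℝ → ℝ), (∀ t, s t = KirchhoffSystem.quadForm S (U t)) → (∀ t, s t ∈ J) →
        (∀ t, KirchhoffSystem.linf (fun (ω : KirchhoffSystem.USphere n) j k => 𝒜 (s t) (ω : KirchhoffSystem.Space n) j k)
          ≤ KirchhoffSystem.linf (fun (ω : KirchhoffSystem.USphere n) j k => 𝒜 (s 0) (ω : KirchhoffSystem.Space n) j k)
            + ENNReal.ofReal (M * (K * ‖U₀‖ ^ 2
                + 1 / (1 - c * K) * (KirchhoffSystem.yNorm U₀).toReal))) ∧
        (∀ᵐ ω : KirchhoffSystem.USphere n ∂(KirchhoffSystem.surf n), ∀ j k a b,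
          AbsolutelyContinuousOnInterval (fun t => 𝒜 (s t) (ω : KirchhoffSystem.Space n) j k) a b) ∧
        ∫⁻ t : ℝ, KirchhoffSystem.linf (fun (ω : KirchhoffSystem.USphere n) j k =>
            deriv (fun r => 𝒜 (s r) (ω : KirchhoffSystem.Space n) j k) t)
          ≤ ENNReal.ofReal (M * (K * ‖U₀‖ ^ 2
                + 1 / (1 - c * K) * (KirchhoffSystem.yNorm U₀).toReal)) := by
  obtain ⟨K₀, D, hK₀, hD, hvar⟩ :=
    KirchhoffSystem.exists_eVariationOn_quadForm_le hn S hΛ.le hd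
  have hcK : 1 / (2 * K₀) * K₀ = 1 / 2 := by field_simp
  -- `c` is chosen so that `c K₀ = 1 / 2`. Since `1 / (1 - c K) ≥ 1`, the right-hand sides are
  -- at least `L D |U₀|_𝒴`.
  refine ⟨K₀, L * D + 1, 1 / (2 * K₀), hK₀, by positivity, by positivity, by
    rw [hcK]; norm_num, ?_⟩
  intro K hK hKK A hA hhyp J 𝒜 h𝒜 U₀ U hY hU s hs hsJ
  obtain ⟨hV, hac⟩ := hvar K hKK A hA hhyp U₀ U hY hU
  obtain rfl : s = fun t => KirchhoffSystem.quadForm S (U t) := funext hs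
  set s := fun t => KirchhoffSystem.quadForm S (U t)
  have hbv : BoundedVariationOn s Set.univ :=
    ne_top_of_le_ne_top (ENNReal.mul_ne_top ENNReal.ofReal_ne_top hY.ne) hV
  set Y : ℝ := (KirchhoffSystem.yNorm U₀).toReal with hYdef
  have hY0 : 0 ≤ Y := ENNReal.toReal_nonneg
  have hYe : KirchhoffSystem.yNorm U₀ = ENNReal.ofReal Y := (ENNReal.ofReal_toReal hY.ne).symm
  rw [hYe, ← ENNReal.ofReal_mul hD] at hV
  have hbound : L * (D * Y) ≤ (L * D + 1) * (K * ‖U₀‖ ^ 2 + 1 / (1 - 1 / (2 * K₀) * K) * Y) := by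
    have h1 : 1 / (2 * K₀) * K ≤ 1 / 2 := by rw [← hcK]; gcongr
    have h2 : 0 ≤ 1 / (2 * K₀) * K := by positivity
    have h3 : 1 ≤ 1 / (1 - 1 / (2 * K₀) * K) := by
      rw [le_div_iff₀ (by linarith)]; linarith
    calc L * (D * Y) = (L * D) * Y := by ring
      _ ≤ (L * D + 1) * (K * ‖U₀‖ ^ 2 + 1 / (1 - 1 / (2 * K₀) * K) * Y) := by
        gcongr
        · linarith
        · exact (le_mul_of_one_le_left hY0 h3).trans (le_add_of_nonneg_left (by positivity))
  refine ⟨fun t => ?_, h𝒜.lipschitz.absolutelyContinuousOnInterval hsJ hac, ?_⟩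
  · refine (h𝒜.lipschitz.linf_le (hsJ t) (hsJ 0)).trans ?_
    refine add_le_add le_rfl (ENNReal.ofReal_le_ofReal (le_trans ?_ hbound))
    gcongr
    have h1 := (eVariationOn.edist_le s (Set.mem_univ t) (Set.mem_univ 0)).trans hV
    rw [edist_dist, ENNReal.ofReal_le_ofReal_iff (by positivity), Real.dist_eq] at h1
    exact h1
  · refine (h𝒜.lipschitz.lintegral_linf_deriv_le hL hsJ hbv).trans ?_
    calc ENNReal.ofReal L * eVariationOn s Set.univ
        ≤ ENNReal.ofReal L * ENNReal.ofReal (D * Y) := by gcongr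
      _ = ENNReal.ofReal (L * (D * Y)) := (ENNReal.ofReal_mul hL).symm
      _ ≤ _ := ENNReal.ofReal_le_ofReal hbound
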